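/- Let $k$ be a complete non-Archimedean valued field (the trivial valuation is allowed). All Banach spaces over $k$ have ultrametric norms, and $\hat\otimes$ is the completed tensor product for the non-Archimedean projective norm $\|z\|=\inf\max_i\|a_i\|\|b_i\|$ over representations $z=\sum a_i\otimes b_i$. Let $V$ be a Banach space over $k$ with a pre-braiding $c$ of norm at most $1$, i.e. a bounded linear map $c:V\hat\otimes V\to V\hat\otimes V$ with $\|c\|\le 1$ and $(c\otimes \mathrm{Id})(\mathrm{Id}\otimes c)(c\otimes \mathrm{Id})=(\mathrm{Id}\otimes c)(c\otimes \mathrm{Id})(\mathrm{Id}\otimes c)$. For $r>0$ let $T_r^c(V)=\{(x_n)_{n\ge 0}: x_n\in V^{\hat\otimes n},\ r^n\|x_n\|\to 0\}$ with norm $\sup_n r^n\|x_n\|$. It is an analytically graded pre-braided Banach Hopf algebra: multiplication is concatenation, the pre-braiding $\tilde c$ is induced by $c$, the counit is the projection to $V^{\hat\otimes 0}=k$, and the comultiplication $\Delta$ is multiplicative for the product $(\mu\otimes\mu)(\mathrm{Id}\otimes\tilde c\otimes\mathrm{Id})$ on $T_r^c(V)\hat\otimes T_r^c(V)$, with $\Delta(v)=1\otimes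 v+v\otimes 1$ for $v\in V$. A homogeneous two-sided ideal $I$ is a coideal if $\Delta(I)\subset\overline{I\otimes T_r^c(V)+T_r^c(V)\otimes I}$. Let $I(V_r)$ be the sum of all homogeneous two-sided ideals of $T_r^c(V)$ that are contained in the part of degree $\ge 2$ and are coideals, and let $\mathfrak B_r^c(V)=T_r^c(V)/I(V_r)$. A non-degenerate symmetric bilinear form on $(V,c)$ is a bounded linear map $\langle-,-\rangle:V\hat\otimes V\to k$ that is symmetric, for which both induced maps $V\to V^*$ are injective, and which is compatible with $c$: $\langle c(x),y\rangle=\langle x,c(y)\rangle$ for $x,y\in V\hat\otimes V$, where $\langle v\otimes w,v'\otimes w'\rangle=\langle v,v'\rangle\langle w,w'\rangle$. Suppose that such a form is given. Then for all $r,s>0$ such that the norm of the form is at most $rs$, the form has a unique extension to a dual pairing of Hopf algebras $T_r^c(V)\hat\otimes T_s^c(V)\to k$, that is, a bounded pairing with $\langle xx',y\rangle=\langle x\otimes x',\Delta y\rangle$, $\langle x,yy'\rangle=\langle \Delta x,y\otimes y'\rangle$, $\langle 1,y\rangle=\varepsilon(y)$ and $\langle x,1\rangle=\varepsilon(x)$.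 Let $I_r=\{x\in T_r^c(V):\langle x,y\rangle=0\text{ for all }y\in T_s^c(V)\}$ be its radical. The subspaces $I(V_r)$ and $I_r$ are closed, the structure maps of $T_r^c(V)$ (multiplication, unit, comultiplication, counit, pre-braiding and grading) descend to $\mathfrak B_r^c(V)$ and to $T_r^c(V)/I_r$, and the map $\mathfrak B_r^c(V)\to T_r^c(V)/I_r$ induced by the identity of $T_r^c(V)$ is well defined and is an isometric isomorphism that respects these structure maps. In particular $I_r$ depends neither on $s$ nor on the choice of the non-degenerate symmetric bilinear form. -/

import Mathlib

noncomputable section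

namespace NichNA

open scoped TensorProduct Topology
open Filter UniformSpace

universe u v w

/-! ### Bounded linear maps

The valuation of `k` may be trivial, so boundedness is recorded explicitly. -/

/-- A morphism of the category of Banach spaces over `k`: a bounded linear transformation. -/
structure BMap (k : Type*) [NormedField k] (E F : Type*)
    [SeminormedAddCommGroup E] [NormedSpace k E]
    [SeminormedAddCommGroup F] [NormedSpace k F] where
  /-- the underlying linear map -/
  lin : E →ₗ[k] F
  bounded : ∃ C : ℝ, ∀ x, ‖lin x‖ ≤ C * ‖x‖

namespace BMap

section basic

variable {k : Type*} [NormedField k] {E F G : Type*}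
  [SeminormedAddCommGroup E] [NormedSpace k E]
  [SeminormedAddCommGroup F] [NormedSpace k F]
  [SeminormedAddCommGroup G] [NormedSpace k G]

instance : FunLike (BMap k E F) E F where
  coe f := f.lin
  coe_injective f g h := by
    cases f; cases g
    congr
    exact DFunLike.coe_injective h

@[simp] theorem coe_lin (f : BMap k E F) (x : E) : f.lin x = f x := rfl

@[simp] theorem mk_apply (f : E →ₗ[k] F) (h) (x : E) : (BMap.mk f h) x = f x := rfl

instance : LinearMapClass (BMap k E F) k E F where
  map_add f := map_add f.lin
  map_smulₛₗ f := map_smulₛₗ f.lin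

/-- `f` has operator norm at most `C`. -/
def NormLE (f : BMap k E F) (C : ℝ) : Prop := ∀ x, ‖f x‖ ≤ C * ‖x‖

theorem exists_normLE (f : BMap k E F) : ∃ C : ℝ, 0 ≤ C ∧ f.NormLE C := by
  obtain ⟨C, hC⟩ := f.bounded
  refine ⟨max C 0, le_max_right _ _, fun x => (hC x).trans ?_⟩
  gcongr
  exact le_max_left _ _

theorem continuous (f : BMap k E F) : Continuous f := by
  obtain ⟨C, -, hC⟩ := f.exists_normLE
  exact AddMonoidHomClass.continuous_of_bound f C hC

variable (k E) in
/-- The identity. -/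
protected def id : BMap k E E := ⟨LinearMap.id, 1, fun x => by simp⟩

@[simp] theorem id_apply (x : E) : BMap.id k E x = x := rfl

theorem id_normLE : (BMap.id k E).NormLE 1 := fun x => by simp

/-- Composition. -/
def comp (g : BMap k F G) (f : BMap k E F) : BMap k E G :=
  ⟨g.lin ∘ₗ f.lin, by
    obtain ⟨C, hC0, hC⟩ := g.exists_normLE
    obtain ⟨D, hD0, hD⟩ := f.exists_normLE
    refine ⟨C * D, fun x => (hC _).trans ?_⟩
    rw [mul_assoc]
    exact mul_le_mul_of_nonneg_left (hD x) hC0⟩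

@[simp] theorem comp_apply (g : BMap k F G) (f : BMap k E F) (x : E) :
    g.comp f x = g (f x) := rfl

theorem NormLE.comp {g : BMap k F G} {f : BMap k E F} {C D : ℝ} (hC0 : 0 ≤ C)
    (hg : g.NormLE C) (hf : f.NormLE D) : (g.comp f).NormLE (C * D) := fun x => by
  refine (hg _).trans ?_
  rw [mul_assoc]
  exact mul_le_mul_of_nonneg_left (hf x) hC0

theorem NormLE.comp_one {g : BMap k F G} {f : BMap k E F} {D : ℝ}
    (hg : g.NormLE 1) (hf : f.NormLE D) : (g.comp f).NormLE D := by
  simpa using NormLE.comp zero_le_one hg hf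

end basic

end BMap

/-! ### The completed tensor product of non-Archimedean Banach spaces -/

/-- The algebraic tensor product; a synonym that carries the non-Archimedean projective
seminorm. -/
def PTensor (k : Type*) [NormedField k] (E F : Type*)
    [SeminormedAddCommGroup E] [NormedSpace k E]
    [SeminormedAddCommGroup F] [NormedSpace k F] := E ⊗[k] F

namespace PTensor

variable {k : Type*} [NormedField k] {E F G : Type*}
  [SeminormedAddCommGroup E] [NormedSpace k E]
  [SeminormedAddCommGroup F] [NormedSpace k F]
  [SeminormedAddCommGroup G] [NormedSpace k G]

instance : AddCommGroup (PTensor k E F) := inferInstanceAs (AddCommGroup (E ⊗[k] F))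
instance : Module k (PTensor k E F) := inferInstanceAs (Module k (E ⊗[k] F))

/-- Pure tensors. -/
def mk : E →ₗ[k] F →ₗ[k] PTensor k E F := TensorProduct.mk k E F

/-- The finite sums of pure tensors `a ⊗ b` with `‖a‖ * ‖b‖ ≤ M`. -/
def sums (k : Type*) [NormedField k] (E F : Type*)
    [SeminormedAddCommGroup E] [NormedSpace k E]
    [SeminormedAddCommGroup F] [NormedSpace k F] (M : ℝ) : AddSubmonoid (PTensor k E F) :=
  AddSubmonoid.closure {z | ∃ a b, ‖a‖ * ‖b‖ ≤ M ∧ z = mk a b}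

/-- The non-Archimedean projective seminorm: the infimum over all representations
`z = ∑ aᵢ ⊗ bᵢ` of `max ‖aᵢ‖ * ‖bᵢ‖`. -/
def pnorm (z : PTensor k E F) : ℝ := sInf {M : ℝ | 0 ≤ M ∧ z ∈ sums k E F M}

theorem sums_mono {M N : ℝ} (h : M ≤ N) : sums k E F M ≤ sums k E F N :=
  AddSubmonoid.closure_mono fun _ ⟨a, b, hab, hz⟩ => ⟨a, b, hab.trans h, hz⟩

theorem exists_mem_sums (z : PTensor k E F) : ∃ M : ℝ, 0 ≤ M ∧ z ∈ sums k E F M := by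
  induction z using TensorProduct.induction_on with
  | zero => exact ⟨0, le_rfl, zero_mem _⟩
  | tmul a b => exact ⟨‖a‖ * ‖b‖, by positivity, AddSubmonoid.subset_closure ⟨a, b, le_rfl, rfl⟩⟩
  | add x y hx hy =>
    obtain ⟨M, hM, hx⟩ := hx
    obtain ⟨N, hN, hy⟩ := hy
    exact ⟨max M N, le_max_of_le_left hM,
      add_mem (sums_mono (le_max_left _ _) hx) (sums_mono (le_max_right _ _) hy)⟩

theorem bddBelow_sums (z : PTensor k E F) : BddBelow {M : ℝ | 0 ≤ M ∧ z ∈ sums k E F M} :=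
  ⟨0, fun _ h => h.1⟩

theorem pnorm_nonneg (z : PTensor k E F) : 0 ≤ pnorm z :=
  Real.sInf_nonneg fun _ h => h.1

theorem pnorm_le {z : PTensor k E F} {M : ℝ} (hM : 0 ≤ M) (h : z ∈ sums k E F M) :
    pnorm z ≤ M := csInf_le (bddBelow_sums z) ⟨hM, h⟩

theorem mem_sums_of_lt {z : PTensor k E F} {M : ℝ} (h : pnorm z < M) : z ∈ sums k E F M := by
  obtain ⟨N, ⟨_, hN⟩, hNM⟩ := exists_lt_of_csInf_lt (exists_mem_sums z) h
  exact sums_mono hNM.le hN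

theorem pnorm_add_le (x y : PTensor k E F) : pnorm (x + y) ≤ max (pnorm x) (pnorm y) := by
  refine le_of_forall_gt fun M hM => ?_
  obtain ⟨N, h1, h2⟩ := exists_between hM
  have hx := mem_sums_of_lt ((le_max_left _ _).trans_lt h1)
  have hy := mem_sums_of_lt ((le_max_right _ _).trans_lt h1)
  exact (pnorm_le ((pnorm_nonneg x).trans ((le_max_left _ _).trans h1.le))
    (add_mem hx hy)).trans_lt h2

theorem smul_mem_sums (c : k) {z : PTensor k E F} {M : ℝ} (h : z ∈ sums k E F M) :
    c • z ∈ sums k E F (‖c‖ * M) := by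
  induction h using AddSubmonoid.closure_induction with
  | mem z hz =>
    obtain ⟨a, b, hab, rfl⟩ := hz
    refine AddSubmonoid.subset_closure ⟨c • a, b, ?_, by simp⟩
    rw [norm_smul, mul_assoc]
    gcongr
  | zero => simp
  | add x y _ _ hx hy => rw [smul_add]; exact add_mem hx hy

theorem pnorm_smul_le (c : k) (z : PTensor k E F) : pnorm (c • z) ≤ ‖c‖ * pnorm z := by
  refine le_of_forall_pos_le_add fun ε hε => ?_
  have h : z ∈ sums k E F (pnorm z + ε / (‖c‖ + 1)) := mem_sums_of_lt (by
    have : 0 < ε / (‖c‖ + 1) := by positivity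
    linarith)
  have h0 := pnorm_nonneg z
  refine (pnorm_le (by positivity) (smul_mem_sums c h)).trans ?_
  rw [mul_add]
  gcongr
  rw [mul_div_assoc', div_le_iff₀ (by positivity)]
  nlinarith [norm_nonneg c]

theorem pnorm_zero : pnorm (0 : PTensor k E F) = 0 :=
  le_antisymm (pnorm_le le_rfl (zero_mem _)) (pnorm_nonneg _)

theorem pnorm_neg_le (z : PTensor k E F) : pnorm (-z) ≤ pnorm z := by
  simpa using pnorm_smul_le (-1 : k) z

instance : SeminormedAddCommGroup (PTensor k E F) :=
  AddGroupSeminorm.toSeminormedAddCommGroup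
    { toFun := pnorm
      map_zero' := pnorm_zero
      add_le' := fun x y => (pnorm_add_le x y).trans
        (max_le_add_of_nonneg (pnorm_nonneg x) (pnorm_nonneg y))
      neg' := fun x => le_antisymm (pnorm_neg_le x) (by simpa using pnorm_neg_le (-x)) }

theorem norm_def (z : PTensor k E F) : ‖z‖ = pnorm z := rfl

instance : NormedSpace k (PTensor k E F) where
  norm_smul_le c z := pnorm_smul_le c z

theorem norm_add_le_max (x y : PTensor k E F) : ‖x + y‖ ≤ max ‖x‖ ‖y‖ := pnorm_add_le x y

theorem norm_mk_le (a : E) (b : F) : ‖(mk a b : PTensor k E F)‖ ≤ ‖a‖ * ‖b‖ :=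
  pnorm_le (by positivity) (AddSubmonoid.subset_closure ⟨a, b, le_rfl, rfl⟩)

/-- The linear map out of the algebraic tensor product given by a bilinear map. -/
def lift (f : E →ₗ[k] F →ₗ[k] G) : PTensor k E F →ₗ[k] G := TensorProduct.lift f

@[simp] theorem lift_mk (f : E →ₗ[k] F →ₗ[k] G) (a : E) (b : F) : lift f (mk a b) = f a b :=
  TensorProduct.lift.tmul a b

theorem norm_lift_le [IsUltrametricDist G] (f : E →ₗ[k] F →ₗ[k] G) {C : ℝ} (hC : 0 ≤ C)
    (h : ∀ a b, ‖f a b‖ ≤ C * (‖a‖ * ‖b‖)) (z : PTensor k E F) : ‖lift f z‖ ≤ C * ‖z‖ := by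
  have key : ∀ M : ℝ, 0 ≤ M → z ∈ sums k E F M → ‖lift f z‖ ≤ C * M := by
    intro M hM hz
    induction hz using AddSubmonoid.closure_induction with
    | mem z hz =>
      obtain ⟨a, b, hab, rfl⟩ := hz
      rw [lift_mk]
      exact (h a b).trans (by gcongr)
    | zero => simp; positivity
    | add x y _ _ hx hy =>
      rw [map_add]
      exact (IsUltrametricDist.norm_add_le_max _ _).trans (max_le hx hy)
  refine le_of_forall_pos_le_add fun ε hε => ?_
  have h0 := pnorm_nonneg z
  have hz : z ∈ sums k E F (pnorm z + ε / (C + 1)) := mem_sums_of_lt (by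
    have : 0 < ε / (C + 1) := by positivity
    linarith)
  refine (key _ (by positivity) hz).trans ?_
  rw [mul_add, norm_def]
  gcongr
  rw [mul_div_assoc', div_le_iff₀ (by positivity)]
  nlinarith

end PTensor

/-- The completed tensor product of `E` and `F` over the non-Archimedean field `k`. -/
def CTensor (k : Type*) [NormedField k] (E F : Type*)
    [SeminormedAddCommGroup E] [NormedSpace k E]
    [SeminormedAddCommGroup F] [NormedSpace k F] := Completion (PTensor k E F)

namespace CTensor

variable {k : Type*} [NormedField k] {E F G H E' F' G' : Type*}
  [SeminormedAddCommGroup E] [NormedSpace k E]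
  [SeminormedAddCommGroup F] [NormedSpace k F]
  [SeminormedAddCommGroup E'] [NormedSpace k E']
  [SeminormedAddCommGroup F'] [NormedSpace k F']
  [SeminormedAddCommGroup G'] [NormedSpace k G']
  [SeminormedAddCommGroup H] [NormedSpace k H]

instance : NormedAddCommGroup (CTensor k E F) :=
  inferInstanceAs (NormedAddCommGroup (Completion (PTensor k E F)))
instance : NormedSpace k (CTensor k E F) :=
  inferInstanceAs (NormedSpace k (Completion (PTensor k E F)))
instance : CompleteSpace (CTensor k E F) :=
  inferInstanceAs (CompleteSpace (Completion (PTensor k E F)))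

/-- The canonical map from the algebraic tensor product. -/
def ofAlg : PTensor k E F →ₗ[k] CTensor k E F :=
  (Completion.toComplₗᵢ (𝕜 := k) (E := PTensor k E F)).toLinearMap

theorem norm_ofAlg (z : PTensor k E F) : ‖(ofAlg z : CTensor k E F)‖ = ‖z‖ :=
  Completion.norm_coe z

theorem denseRange_ofAlg : DenseRange (ofAlg : PTensor k E F → CTensor k E F) :=
  Completion.denseRange_coe

instance : IsUltrametricDist (CTensor k E F) := by
  refine IsUltrametricDist.isUltrametricDist_of_forall_norm_add_le_max_norm fun x y => ?_
  refine denseRange_ofAlg.induction_on₂ (p := fun x y => ‖x + y‖ ≤ max ‖x‖ ‖y‖)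
    (isClosed_le (by fun_prop) (by fun_prop)) (fun a b => ?_) x y
  rw [← map_add, norm_ofAlg, norm_ofAlg, norm_ofAlg]
  exact PTensor.norm_add_le_max a b

/-- Pure tensors `x ⊗ y`, as a bilinear map. -/
def tmul : E →ₗ[k] F →ₗ[k] CTensor k E F := PTensor.mk.compr₂ ofAlg

theorem norm_tmul_le (x : E) (y : F) : ‖(tmul x y : CTensor k E F)‖ ≤ ‖x‖ * ‖y‖ :=
  (norm_ofAlg _).trans_le (PTensor.norm_mk_le x y)

/-- To prove a closed property of all tensors, it is enough to check pure tensors and sums. -/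
theorem induction {p : CTensor k E F → Prop} (hc : IsClosed {z | p z}) (h0 : p 0)
    (ht : ∀ x y, p (tmul x y)) (ha : ∀ x y, p x → p y → p (x + y)) (z : CTensor k E F) : p z := by
  refine denseRange_ofAlg.induction_on z hc fun a => ?_
  induction a using TensorProduct.induction_on with
  | zero => exact (map_zero (ofAlg (k := k) (E := E) (F := F))).symm ▸ h0
  | tmul x y => exact ht x y
  | add x y hx hy =>
    exact (map_add (ofAlg (k := k) (E := E) (F := F)) x y).symm ▸ ha _ _ hx hy

section lift

variable [NormedAddCommGroup G] [NormedSpace k G] [CompleteSpace G] [IsUltrametricDist G]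

/-- The map out of the completed tensor product given by a bounded bilinear map. -/
def lift (f : E →ₗ[k] F →ₗ[k] G) (h : ∃ C : ℝ, ∀ a b, ‖f a b‖ ≤ C * (‖a‖ * ‖b‖)) :
    BMap k (CTensor k E F) G :=
  have h' : ∃ C : ℝ, 0 ≤ C ∧ ∀ a b, ‖f a b‖ ≤ C * (‖a‖ * ‖b‖) := by
    obtain ⟨C, hC⟩ := h
    refine ⟨max C 0, le_max_right _ _, fun a b => (hC a b).trans ?_⟩
    gcongr
    exact le_max_left _ _
  let φ : NormedAddGroupHom (PTensor k E F) G :=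
    { toFun := PTensor.lift f
      map_add' := map_add _
      bound' := by
        obtain ⟨C, hC0, hC⟩ := h'
        exact ⟨C, PTensor.norm_lift_le f hC0 hC⟩ }
  { lin :=
      { toFun := φ.extension
        map_add' := map_add φ.extension
        map_smul' := fun c x => by
          refine denseRange_ofAlg.induction_on
            (p := fun x => φ.extension (c • x) = c • φ.extension x) x ?_ fun a => ?_
          · exact isClosed_eq (φ.extension.continuous.comp (continuous_const_smul c))
              (φ.extension.continuous.const_smul c)
          · refine (congrArg φ.extension
              (map_smul (ofAlg (k := k) (E := E) (F := F)) c a).symm).trans ?_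
            refine (φ.extension_coe (c • a)).trans ?_
            refine Eq.trans ?_ (congrArg (c • ·) (φ.extension_coe a).symm)
            exact map_smul (PTensor.lift f) c a }
    bounded := ⟨‖φ.extension‖, φ.extension.le_opNorm⟩ }

theorem lift_ofAlg (f : E →ₗ[k] F →ₗ[k] G) (h) (z : PTensor k E F) :
    lift f h (ofAlg z) = PTensor.lift f z :=
  NormedAddGroupHom.extension_coe _ z

@[simp] theorem lift_tmul (f : E →ₗ[k] F →ₗ[k] G) (h) (x : E) (y : F) :
    lift f h (tmul x y) = f x y := (lift_ofAlg f h _).trans (PTensor.lift_mk f x y)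

theorem lift_normLE (f : E →ₗ[k] F →ₗ[k] G) (h) {C : ℝ} (hC : 0 ≤ C)
    (hf : ∀ a b, ‖f a b‖ ≤ C * (‖a‖ * ‖b‖)) : (lift f h).NormLE C := fun z => by
  refine denseRange_ofAlg.induction_on (p := fun z => ‖lift f h z‖ ≤ C * ‖z‖) z ?_ fun a => ?_
  · exact isClosed_le (lift f h).continuous.norm (continuous_const.mul continuous_norm)
  · rw [lift_ofAlg, norm_ofAlg]
    exact PTensor.norm_lift_le f hC hf a

end lift

/-- Two bounded maps that agree on pure tensors are equal. -/
theorem hom_ext [NormedAddCommGroup G] [NormedSpace k G] {f g : BMap k (CTensor k E F) G}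
    (h : ∀ x y, f (tmul x y) = g (tmul x y)) : f = g := by
  refine DFunLike.ext _ _ fun z => induction (p := fun z => f z = g z)
    (isClosed_eq f.continuous g.continuous) (by simp) h (fun x y hx hy => ?_) z
  rw [map_add, map_add, hx, hy]

/-- The tensor product of two bounded maps. -/
def map (f : BMap k E E') (g : BMap k F F') : BMap k (CTensor k E F) (CTensor k E' F') :=
  lift (tmul.compl₁₂ f.lin g.lin) (by
    obtain ⟨C, hC0, hC⟩ := f.exists_normLE
    obtain ⟨D, hD0, hD⟩ := g.exists_normLE
    refine ⟨C * D, fun a b => (norm_tmul_le _ _).trans ?_⟩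
    calc ‖f a‖ * ‖g b‖ ≤ (C * ‖a‖) * (D * ‖b‖) :=
          mul_le_mul (hC a) (hD b) (norm_nonneg _) (by positivity)
      _ = _ := by ring)

@[simp] theorem map_tmul (f : BMap k E E') (g : BMap k F F') (x : E) (y : F) :
    map f g (tmul x y) = tmul (f x) (g y) := lift_tmul _ _ x y

theorem map_normLE {f : BMap k E E'} {g : BMap k F F'} {C D : ℝ} (hC : 0 ≤ C) (hD : 0 ≤ D)
    (hf : f.NormLE C) (hg : g.NormLE D) : (map f g).NormLE (C * D) :=
  lift_normLE _ _ (by positivity) fun a b => (norm_tmul_le _ _).trans (by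
    calc ‖f a‖ * ‖g b‖ ≤ (C * ‖a‖) * (D * ‖b‖) :=
          mul_le_mul (hf a) (hg b) (norm_nonneg _) (by positivity)
      _ = _ := by ring)

theorem map_normLE_one {f : BMap k E E'} {g : BMap k F F'}
    (hf : f.NormLE 1) (hg : g.NormLE 1) : (map f g).NormLE 1 := by
  simpa using map_normLE zero_le_one zero_le_one hf hg

/-- The symmetry `τ : x ⊗ y ↦ y ⊗ x`. -/
def swap : BMap k (CTensor k E F) (CTensor k F E) :=
  lift tmul.flip ⟨1, fun a b => by
    rw [one_mul, mul_comm]; exact norm_tmul_le b a⟩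

@[simp] theorem swap_tmul (x : E) (y : F) :
    swap (tmul x y : CTensor k E F) = tmul y x := lift_tmul _ _ x y

theorem swap_normLE : (swap : BMap k (CTensor k E F) (CTensor k F E)).NormLE 1 :=
  lift_normLE _ _ zero_le_one fun a b => by
    rw [one_mul, mul_comm]; exact norm_tmul_le b a

/-- `z ↦ z ⊗ g` followed by the associativity constraint, for fixed `g`. -/
def assocAux (g : H) : BMap k (CTensor k E F) (CTensor k E (CTensor k F H)) :=
  map (BMap.id k E) ⟨tmul.flip g, ‖g‖, fun x => by
    rw [mul_comm]; exact norm_tmul_le x g⟩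

@[simp] theorem assocAux_tmul (g : H) (x : E) (y : F) :
    assocAux g (tmul x y : CTensor k E F) = tmul x (tmul y g) := map_tmul _ _ x y

theorem assocAux_normLE (g : H) : (assocAux g : BMap k (CTensor k E F) _).NormLE ‖g‖ := by
  have := map_normLE (f := BMap.id k E)
    (g := ⟨(tmul (k := k) (E := F)).flip g, ‖g‖, fun x => by
      rw [mul_comm]; exact norm_tmul_le x g⟩) zero_le_one (norm_nonneg g) BMap.id_normLE
    (fun x => by rw [mul_comm]; exact norm_tmul_le x g)
  rwa [one_mul] at this

/-- `e ⊗ ·` followed by the inverse associativity constraint, for fixed `e`. -/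
def assocInvAux (e : E) : BMap k (CTensor k F H) (CTensor k (CTensor k E F) H) :=
  map ⟨tmul e, ‖e‖, fun x => norm_tmul_le e x⟩ (BMap.id k H)

@[simp] theorem assocInvAux_tmul (e : E) (y : F) (z : H) :
    assocInvAux e (tmul y z : CTensor k F H) = tmul (tmul e y) z := map_tmul _ _ y z

theorem assocInvAux_normLE (e : E) : (assocInvAux e : BMap k (CTensor k F H) _).NormLE ‖e‖ := by
  have := map_normLE (f := ⟨tmul (k := k) (F := F) e, ‖e‖, fun x => norm_tmul_le e x⟩)
    (g := BMap.id k H) (norm_nonneg e) zero_le_one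
    (fun x => norm_tmul_le e x) BMap.id_normLE
  rwa [mul_one] at this

/-- The bilinear map underlying the associativity constraint. -/
def assocBil : CTensor k E F →ₗ[k] H →ₗ[k] CTensor k E (CTensor k F H) :=
  LinearMap.mk₂ k (fun z g => assocAux g z)
    (fun x y g => map_add _ x y) (fun c x g => map_smul _ c x)
    (fun z g g' => induction (p := fun z => assocAux (g + g') z = assocAux g z + assocAux g' z)
      (isClosed_eq (BMap.continuous _) ((BMap.continuous _).add (BMap.continuous _)))
      (by simp) (fun x y => by simp)
      (fun x y hx hy => by rw [map_add, map_add, map_add, hx, hy]; abel) z)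
    (fun c z g => induction (p := fun z => assocAux (c • g) z = c • assocAux g z)
      (isClosed_eq (BMap.continuous _) ((BMap.continuous _).const_smul c))
      (by simp) (fun x y => by simp)
      (fun x y hx hy => by rw [map_add, map_add, hx, hy, smul_add]) z)

/-- The bilinear map underlying the inverse associativity constraint. -/
def assocInvBil : E →ₗ[k] CTensor k F H →ₗ[k] CTensor k (CTensor k E F) H :=
  LinearMap.mk₂ k (fun e z => assocInvAux e z)
    (fun e e' z => induction
      (p := fun z => assocInvAux (e + e') z = assocInvAux e z + assocInvAux e' z)
      (isClosed_eq (BMap.continuous _) ((BMap.continuous _).add (BMap.continuous _)))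
      (by simp) (fun x y => by simp)
      (fun x y hx hy => by rw [map_add, map_add, map_add, hx, hy]; abel) z)
    (fun c e z => induction (p := fun z => assocInvAux (c • e) z = c • assocInvAux e z)
      (isClosed_eq (BMap.continuous _) ((BMap.continuous _).const_smul c))
      (by simp) (fun x y => by simp)
      (fun x y hx hy => by rw [map_add, map_add, hx, hy, smul_add]) z)
    (fun e x y => map_add _ x y) (fun c e x => map_smul _ c x)

theorem norm_assocBil_le (z : CTensor k E F) (g : H) :
    ‖assocBil z g‖ ≤ 1 * (‖z‖ * ‖g‖) := by
  rw [one_mul, mul_comm]; exact assocAux_normLE g z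

theorem norm_assocInvBil_le (e : E) (z : CTensor k F H) :
    ‖assocInvBil e z‖ ≤ 1 * (‖e‖ * ‖z‖) := by
  rw [one_mul]; exact assocInvAux_normLE e z

/-- The associativity constraint. -/
def assoc : BMap k (CTensor k (CTensor k E F) H) (CTensor k E (CTensor k F H)) :=
  lift assocBil ⟨1, norm_assocBil_le⟩

/-- The inverse of the associativity constraint. -/
def assocInv : BMap k (CTensor k E (CTensor k F H)) (CTensor k (CTensor k E F) H) :=
  lift assocInvBil ⟨1, norm_assocInvBil_le⟩

@[simp] theorem assoc_tmul (x : E) (y : F) (z : H) :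
    assoc (tmul (tmul x y) z : CTensor k (CTensor k E F) H) = tmul x (tmul y z) :=
  (lift_tmul _ _ _ _).trans (assocAux_tmul z x y)

@[simp] theorem assocInv_tmul (x : E) (y : F) (z : H) :
    assocInv (tmul x (tmul y z) : CTensor k E (CTensor k F H)) = tmul (tmul x y) z :=
  (lift_tmul _ _ _ _).trans (assocInvAux_tmul x y z)

theorem assoc_normLE : (assoc : BMap k (CTensor k (CTensor k E F) H) _).NormLE 1 :=
  lift_normLE _ _ zero_le_one norm_assocBil_le

theorem assocInv_normLE : (assocInv : BMap k (CTensor k E (CTensor k F H)) _).NormLE 1 :=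
  lift_normLE _ _ zero_le_one norm_assocInvBil_le

/-- `Id ⊗ f ⊗ Id` on four tensor factors. -/
def mid (f : BMap k (CTensor k F E') (CTensor k F' G')) :
    BMap k (CTensor k (CTensor k E F) (CTensor k E' H))
      (CTensor k (CTensor k E F') (CTensor k G' H)) :=
  assocInv.comp <| (map (BMap.id k E) <|
    assoc.comp <| (map f (BMap.id k H)).comp assocInv).comp assoc

theorem mid_normLE {f : BMap k (CTensor k F E') (CTensor k F' G')} (hf : f.NormLE 1) :
    (mid f : BMap k (CTensor k (CTensor k E F) (CTensor k E' H)) _).NormLE 1 :=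
  assocInv_normLE.comp_one <| BMap.NormLE.comp_one
    (map_normLE_one BMap.id_normLE <| assoc_normLE.comp_one <|
      (map_normLE_one hf BMap.id_normLE).comp_one assocInv_normLE) assoc_normLE

@[simp] theorem mid_swap_tmul (x : E) (y : F) (z : E') (t : H) :
    mid swap (tmul (tmul x y) (tmul z t) : CTensor k (CTensor k E F) (CTensor k E' H)) =
      tmul (tmul x z) (tmul y t) := by
  simp [mid]

/-- Scalar multiplication `k ⊗ E → E`. -/
def smulMap [NormedAddCommGroup G] [NormedSpace k G] [CompleteSpace G] [IsUltrametricDist G] :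
    BMap k (CTensor k k G) G :=
  lift (LinearMap.lsmul k G) ⟨1, fun a b => by simp [norm_smul]⟩

@[simp] theorem smulMap_tmul [NormedAddCommGroup G] [NormedSpace k G] [CompleteSpace G]
    [IsUltrametricDist G] (a : k) (x : G) : smulMap (tmul a x) = a • x := lift_tmul _ _ a x

end CTensor

/-! ### Contracting coproducts of scaled Banach spaces -/

/-- The null sequences `(xₙ)` with `xₙ ∈ Eₙ` and `r ^ n * ‖xₙ‖ → 0`. -/
def c0Submodule (k : Type u) [NormedField k] (E : ℕ → Type v) [∀ n, NormedAddCommGroup (E n)]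
    [∀ n, NormedSpace k (E n)] (r : {r : ℝ // 0 < r}) : Submodule k (∀ n, E n) where
  carrier := {x | Tendsto (fun n => (r : ℝ) ^ n * ‖x n‖) atTop (𝓝 0)}
  zero_mem' := by simp
  add_mem' {x y} hx hy := by
    refine squeeze_zero (fun n => mul_nonneg (pow_nonneg r.2.le n) (norm_nonneg _)) (fun n => ?_)
      (by simpa using Tendsto.add hx hy)
    rw [← mul_add]
    exact mul_le_mul_of_nonneg_left (norm_add_le _ _) (pow_nonneg r.2.le n)
  smul_mem' c x hx := by
    have := Tendsto.const_mul ‖c‖ hx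
    rw [mul_zero] at this
    refine this.congr fun n => ?_
    rw [Pi.smul_apply, norm_smul]
    ring

/-- The contracting coproduct, in the category of non-Archimedean Banach spaces, of the spaces
`Eₙ` with norm scaled by `r ^ n`. -/
def C0Sum (k : Type u) [NormedField k] (E : ℕ → Type v) [∀ n, NormedAddCommGroup (E n)]
    [∀ n, NormedSpace k (E n)] (r : {r : ℝ // 0 < r}) : Type v := c0Submodule k E r

namespace C0Sum

variable {k : Type u} [NormedField k] {E : ℕ → Type v} [∀ n, NormedAddCommGroup (E n)]
  [∀ n, NormedSpace k (E n)] {r : {r : ℝ // 0 < r}}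

instance : AddCommGroup (C0Sum k E r) := inferInstanceAs (AddCommGroup (c0Submodule k E r))
instance : Module k (C0Sum k E r) := inferInstanceAs (Module k (c0Submodule k E r))

/-- The `n`-th component of an element of the coproduct. -/
def coord (n : ℕ) : C0Sum k E r →ₗ[k] E n := (LinearMap.proj n).comp (c0Submodule k E r).subtype

theorem ext {x y : C0Sum k E r} (h : ∀ n, coord n x = coord n y) : x = y :=
  Subtype.ext (funext h)

theorem tendsto (x : C0Sum k E r) :
    Tendsto (fun n => (r : ℝ) ^ n * ‖coord n x‖) atTop (𝓝 0) := x.2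

/-- An element of the coproduct from its components. -/
def ofSeq (x : ∀ n, E n) (h : Tendsto (fun n => (r : ℝ) ^ n * ‖x n‖) atTop (𝓝 0)) :
    C0Sum k E r := ⟨x, h⟩

@[simp] theorem coord_ofSeq (x : ∀ n, E n) (h) (n : ℕ) :
    coord n (ofSeq (k := k) (r := r) x h) = x n := rfl

/-- The norm `sup r ^ n * ‖xₙ‖`. -/
instance : Norm (C0Sum k E r) := ⟨fun x => ⨆ n, (r : ℝ) ^ n * ‖coord n x‖⟩

theorem norm_def (x : C0Sum k E r) : ‖x‖ = ⨆ n, (r : ℝ) ^ n * ‖coord n x‖ := rfl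

theorem bddAbove (x : C0Sum k E r) : BddAbove (Set.range fun n => (r : ℝ) ^ n * ‖coord n x‖) :=
  x.tendsto.bddAbove_range

theorem coord_le (x : C0Sum k E r) (n : ℕ) : (r : ℝ) ^ n * ‖coord n x‖ ≤ ‖x‖ :=
  le_ciSup x.bddAbove n

theorem norm_le {x : C0Sum k E r} {C : ℝ} (h : ∀ n, (r : ℝ) ^ n * ‖coord n x‖ ≤ C) : ‖x‖ ≤ C :=
  ciSup_le h

theorem norm_nonneg_aux (x : C0Sum k E r) : 0 ≤ ‖x‖ :=
  (mul_nonneg (pow_nonneg r.2.le 0) (norm_nonneg _)).trans (coord_le x 0)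

theorem norm_add_le_max_aux (x y : C0Sum k E r) [∀ n, IsUltrametricDist (E n)] :
    ‖x + y‖ ≤ max ‖x‖ ‖y‖ := norm_le fun n => by
  have hr : (0 : ℝ) ≤ (r : ℝ) ^ n := pow_nonneg r.2.le n
  rw [map_add]
  refine (mul_le_mul_of_nonneg_left (IsUltrametricDist.norm_add_le_max _ _) hr).trans ?_
  rw [mul_max_of_nonneg _ _ hr]
  exact max_le_max (coord_le x n) (coord_le y n)

instance : NormedAddCommGroup (C0Sum k E r) :=
  AddGroupNorm.toNormedAddCommGroup
    { toFun := norm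
      map_zero' := by simp [norm_def]
      add_le' := fun x y => norm_le fun n => by
        rw [map_add]
        refine (mul_le_mul_of_nonneg_left (norm_add_le _ _) (pow_nonneg r.2.le n)).trans ?_
        rw [mul_add]
        exact add_le_add (coord_le x n) (coord_le y n)
      neg' := fun x => by simp [norm_def]
      eq_zero_of_map_eq_zero' := fun x hx => ext fun n => by
        have h := coord_le x n
        rw [show ‖x‖ = 0 from hx] at h
        have h2 : ‖coord n x‖ ≤ 0 := by
          by_contra hlt
          exact absurd h (not_le.2 (mul_pos (pow_pos r.2 n) (not_le.1 hlt)))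
        rw [map_zero]
        exact norm_le_zero_iff.1 h2 }

instance : NormedSpace k (C0Sum k E r) where
  norm_smul_le c x := norm_le fun n => by
    rw [map_smul, norm_smul, mul_left_comm]
    exact mul_le_mul_of_nonneg_left (coord_le x n) (norm_nonneg c)

instance [∀ n, IsUltrametricDist (E n)] : IsUltrametricDist (C0Sum k E r) :=
  IsUltrametricDist.isUltrametricDist_of_forall_norm_add_le_max_norm fun x y =>
    norm_add_le_max_aux x y

theorem norm_coord_le (n : ℕ) (x : C0Sum k E r) :
    ‖coord n x‖ ≤ ((r : ℝ) ^ n)⁻¹ * ‖x‖ := by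
  rw [inv_mul_eq_div, le_div_iff₀ (pow_pos r.2 n), mul_comm]
  exact coord_le x n

/-- The projection to the `n`-th summand. -/
def coordB (n : ℕ) : BMap k (C0Sum k E r) (E n) := ⟨coord n, _, norm_coord_le n⟩

@[simp] theorem coordB_apply (n : ℕ) (x : C0Sum k E r) : coordB n x = coord n x := rfl

instance [∀ n, CompleteSpace (E n)] : CompleteSpace (C0Sum k E r) := by
  refine Metric.complete_of_cauchySeq_tendsto fun u hu => ?_
  have hcau : ∀ n, CauchySeq fun j => coord n (u j) := fun n =>
    hu.map (AddMonoidHomClass.uniformContinuous_of_bound (coord n) _ (norm_coord_le n))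
  choose x hx using fun n => cauchySeq_tendsto_of_complete (hcau n)
  have key : ∀ ε > 0, ∃ N, ∀ j ≥ N, ∀ n, (r : ℝ) ^ n * ‖coord n (u j) - x n‖ ≤ ε := by
    intro ε hε
    obtain ⟨N, hN⟩ := Metric.cauchySeq_iff.1 hu ε hε
    refine ⟨N, fun j hj n => ?_⟩
    have hlim : Tendsto (fun i => (r : ℝ) ^ n * ‖coord n (u j) - coord n (u i)‖) atTop
        (𝓝 ((r : ℝ) ^ n * ‖coord n (u j) - x n‖)) :=
      ((tendsto_const_nhds.sub (hx n)).norm).const_mul _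
    refine le_of_tendsto hlim (eventually_atTop.2 ⟨N, fun i hi => ?_⟩)
    rw [← map_sub]
    refine (coord_le _ n).trans ?_
    rw [← dist_eq_norm]
    exact (hN j hj i hi).le
  have hmem : Tendsto (fun n => (r : ℝ) ^ n * ‖x n‖) atTop (𝓝 0) := by
    rw [Metric.tendsto_atTop]
    intro ε hε
    obtain ⟨N, hN⟩ := key (ε / 2) (half_pos hε)
    obtain ⟨M, hM⟩ := Metric.tendsto_atTop.1 (u N).tendsto (ε / 2) (half_pos hε)
    refine ⟨M, fun n hn => ?_⟩
    have h1 := hN N le_rfl n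
    have h2 := hM n hn
    have hr : (0 : ℝ) ≤ (r : ℝ) ^ n := pow_nonneg r.2.le n
    rw [dist_zero_right, Real.norm_of_nonneg (by positivity)] at h2 ⊢
    have h3 : ‖x n‖ ≤ ‖coord n (u N)‖ + ‖coord n (u N) - x n‖ := by
      have := norm_sub_le (coord n (u N)) (coord n (u N) - x n)
      rwa [sub_sub_cancel] at this
    have h4 := mul_le_mul_of_nonneg_left h3 hr
    rw [mul_add] at h4
    linarith
  refine ⟨ofSeq x hmem, Metric.tendsto_atTop.2 fun ε hε => ?_⟩
  obtain ⟨N, hN⟩ := key (ε / 2) (half_pos hε)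
  refine ⟨N, fun j hj => ?_⟩
  rw [dist_eq_norm]
  refine (norm_le fun n => ?_).trans_lt (half_lt_self hε)
  rw [map_sub, coord_ofSeq]
  exact hN j hj n

theorem tendsto_single (n : ℕ) (a : E n) :
    Tendsto (fun m => (r : ℝ) ^ m * ‖(Pi.single n a : ∀ m, E m) m‖) atTop (𝓝 0) :=
  tendsto_const_nhds.congr' (eventually_atTop.2 ⟨n + 1, fun m hm => by
    dsimp only
    rw [Pi.single_eq_of_ne (by omega), norm_zero, mul_zero]⟩)

theorem norm_single_le (n : ℕ) (a : E n) :
    ‖ofSeq (k := k) (Pi.single n a) (tendsto_single (r := r) n a)‖ ≤ (r : ℝ) ^ n * ‖a‖ :=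
  norm_le fun m => by
    rw [coord_ofSeq]
    rcases eq_or_ne m n with rfl | h
    · rw [Pi.single_eq_same]
    · rw [Pi.single_eq_of_ne h, norm_zero, mul_zero]
      exact mul_nonneg (pow_nonneg r.2.le n) (norm_nonneg a)

/-- The inclusion of the `n`-th summand. -/
def incl (n : ℕ) : BMap k (E n) (C0Sum k E r) :=
  ⟨{ toFun := fun a => ofSeq (Pi.single n a) (tendsto_single n a)
     map_add' := fun a b => ext fun m => by
       rw [map_add, coord_ofSeq, coord_ofSeq, coord_ofSeq, Pi.single_add, Pi.add_apply]
     map_smul' := fun c a => ext fun m => by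
       rw [map_smul, coord_ofSeq, coord_ofSeq, Pi.single_smul, Pi.smul_apply, RingHom.id_apply] },
    (r : ℝ) ^ n, norm_single_le n⟩

theorem coord_incl (n m : ℕ) (a : E n) :
    coord m (incl n a : C0Sum k E r) = (Pi.single n a : ∀ m, E m) m := rfl

@[simp] theorem coord_incl_same (n : ℕ) (a : E n) :
    coord n (incl n a : C0Sum k E r) = a := Pi.single_eq_same n a

theorem coord_incl_of_ne {n m : ℕ} (h : m ≠ n) (a : E n) :
    coord m (incl n a : C0Sum k E r) = 0 := Pi.single_eq_of_ne h a

theorem incl_normLE (n : ℕ) :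
    (incl n : BMap k (E n) (C0Sum k E r)).NormLE ((r : ℝ) ^ n) := norm_single_le n

section lift

variable {G : Type*} [NormedAddCommGroup G] [NormedSpace k G] [CompleteSpace G]
  [IsUltrametricDist G]

theorem summable_lift (f : ∀ n, E n →ₗ[k] G) {C : ℝ}
    (hf : ∀ n a, ‖f n a‖ ≤ C * ((r : ℝ) ^ n * ‖a‖)) (x : C0Sum k E r) :
    Summable fun n => f n (coord n x) := by
  have : NonarchimedeanAddGroup G := IsUltrametricDist.nonarchimedeanAddGroup
  refine NonarchimedeanAddGroup.summable_of_tendsto_cofinite_zero ?_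
  rw [Nat.cofinite_eq_atTop]
  refine squeeze_zero_norm (fun n => hf n _) ?_
  simpa using x.tendsto.const_mul C

theorem norm_tsum_le (f : ∀ n, E n →ₗ[k] G) {C : ℝ} (hC : 0 ≤ C)
    (hf : ∀ n a, ‖f n a‖ ≤ C * ((r : ℝ) ^ n * ‖a‖)) (x : C0Sum k E r) :
    ‖∑' n, f n (coord n x)‖ ≤ C * ‖x‖ := by
  refine le_of_tendsto (summable_lift f hf x).hasSum.norm (Eventually.of_forall fun s => ?_)
  refine IsUltrametricDist.norm_sum_le_of_forall_le_of_nonneg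
    (mul_nonneg hC (norm_nonneg x)) fun n _ => (hf n _).trans ?_
  exact mul_le_mul_of_nonneg_left (coord_le x n) hC

/-- The universal property of the contracting coproduct: a uniformly bounded family of maps
`fₙ` induces the map `x ↦ ∑ₙ fₙ(xₙ)`. -/
def lift (f : ∀ n, E n →ₗ[k] G)
    (hf : ∃ C : ℝ, 0 ≤ C ∧ ∀ n a, ‖f n a‖ ≤ C * ((r : ℝ) ^ n * ‖a‖)) : BMap k (C0Sum k E r) G :=
  ⟨{ toFun := fun x => ∑' n, f n (coord n x)
     map_add' := fun x y => by
       obtain ⟨C, -, hC⟩ := hf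
       simp only [map_add]
       exact (summable_lift f hC x).tsum_add (summable_lift f hC y)
     map_smul' := fun c x => by
       obtain ⟨C, -, hC⟩ := hf
       simp only [map_smul, RingHom.id_apply]
       exact (summable_lift f hC x).tsum_const_smul c },
    by
      obtain ⟨C, hC0, hC⟩ := hf
      exact ⟨C, norm_tsum_le f hC0 hC⟩⟩

theorem lift_apply (f : ∀ n, E n →ₗ[k] G) (hf) (x : C0Sum k E r) :
    lift f hf x = ∑' n, f n (coord n x) := rfl

@[simp] theorem lift_incl (f : ∀ n, E n →ₗ[k] G) (hf) (n : ℕ) (a : E n) :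
    lift (r := r) f hf (incl n a) = f n a := by
  rw [lift_apply, tsum_eq_single n, coord_incl_same]
  intro m hm
  rw [coord_incl_of_ne hm, map_zero]

theorem lift_normLE (f : ∀ n, E n →ₗ[k] G) (hf) {C : ℝ} (hC : 0 ≤ C)
    (h : ∀ n a, ‖f n a‖ ≤ C * ((r : ℝ) ^ n * ‖a‖)) : (lift (r := r) f hf).NormLE C :=
  norm_tsum_le f hC h

end lift

theorem hasSum_incl [∀ n, IsUltrametricDist (E n)] [∀ n, CompleteSpace (E n)]
    (x : C0Sum k E r) : HasSum (fun n => incl (k := k) (r := r) n (coord n x)) x := by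
  have h : ∀ n (a : E n), ‖(incl n : BMap k (E n) (C0Sum k E r)).lin a‖ ≤
      1 * ((r : ℝ) ^ n * ‖a‖) := fun n a => by rw [one_mul]; exact incl_normLE n a
  have hs := summable_lift (fun n => (incl n : BMap k (E n) (C0Sum k E r)).lin) h x
  refine hs.hasSum_iff.2 (ext (k := k) (r := r) fun m => ?_)
  have h2 := (hs.hasSum.map (coordB (k := k) (E := E) (r := r) m) (coordB m).continuous).tsum_eq
  rw [coordB_apply] at h2
  rw [← h2, tsum_eq_single m]
  · exact coord_incl_same (k := k) (r := r) m _
  · intro n hn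
    exact coord_incl_of_ne (k := k) (r := r) hn.symm _

/-- Two bounded maps that agree on every summand are equal. -/
theorem hom_ext [∀ n, IsUltrametricDist (E n)] [∀ n, CompleteSpace (E n)] {G : Type*}
    [NormedAddCommGroup G] [NormedSpace k G] {f g : BMap k (C0Sum k E r) G}
    (h : ∀ n a, f (incl n a) = g (incl n a)) : f = g := by
  refine DFunLike.ext _ _ fun x => ?_
  have hf := (hasSum_incl x).map f f.continuous
  have hg := (hasSum_incl x).map g g.continuous
  have he : (f ∘ fun n => incl n (coord n x)) = g ∘ fun n => incl n (coord n x) :=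
    funext fun n => h n _
  rw [he] at hf
  exact hf.unique hg

section lift₂

set_option linter.unusedSectionVars false

variable {F : ℕ → Type w} [∀ n, NormedAddCommGroup (F n)] [∀ n, NormedSpace k (F n)]
  {s : {s : ℝ // 0 < s}}
  {G : Type*} [NormedAddCommGroup G] [NormedSpace k G] [CompleteSpace G] [IsUltrametricDist G]

theorem lift₂_aux_nonneg (n : ℕ) (a : E n) : 0 ≤ (r : ℝ) ^ n * ‖a‖ :=
  mul_nonneg (pow_nonneg r.2.le n) (norm_nonneg a)

theorem lift₂_aux_bound {f : ∀ n m, BMap k (CTensor k (E n) (F m)) G}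
    (hf : ∀ n m, (f n m).NormLE ((r : ℝ) ^ n * (s : ℝ) ^ m)) (n m : ℕ) (a : E n) (b : F m) :
    ‖((f n m).lin ∘ₗ CTensor.tmul a) b‖ ≤ ((r : ℝ) ^ n * ‖a‖) * ((s : ℝ) ^ m * ‖b‖) := by
  refine (hf n m _).trans ?_
  rw [mul_mul_mul_comm]
  exact mul_le_mul_of_nonneg_left (CTensor.norm_tmul_le a b)
    (mul_nonneg (pow_nonneg r.2.le n) (pow_nonneg s.2.le m))

/-- The bilinear map `(a, y) ↦ ∑ₘ fₙₘ(a ⊗ yₘ)`. -/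
def lift₂Aux (f : ∀ n m, BMap k (CTensor k (E n) (F m)) G)
    (hf : ∀ n m, (f n m).NormLE ((r : ℝ) ^ n * (s : ℝ) ^ m)) (n : ℕ) :
    E n →ₗ[k] C0Sum k F s →ₗ[k] G :=
  LinearMap.mk₂ k
    (fun a y => lift (r := s) (fun m => (f n m).lin ∘ₗ CTensor.tmul a)
      ⟨_, lift₂_aux_nonneg n a, fun m b => lift₂_aux_bound hf n m a b⟩ y)
    (fun a a' y => by
      simp only [lift_apply]
      rw [← (summable_lift _ (fun m b => lift₂_aux_bound hf n m a b) y).tsum_add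
        (summable_lift _ (fun m b => lift₂_aux_bound hf n m a' b) y)]
      simp)
    (fun c a y => by
      simp only [lift_apply]
      rw [← (summable_lift _ (fun m b => lift₂_aux_bound hf n m a b) y).tsum_const_smul]
      simp)
    (fun a y y' => map_add _ y y') (fun c a y => map_smul _ c y)

theorem norm_lift₂Aux_le (f : ∀ n m, BMap k (CTensor k (E n) (F m)) G)
    (hf : ∀ n m, (f n m).NormLE ((r : ℝ) ^ n * (s : ℝ) ^ m)) (y : C0Sum k F s) (n : ℕ)
    (a : E n) : ‖(lift₂Aux f hf n).flip y a‖ ≤ ‖y‖ * ((r : ℝ) ^ n * ‖a‖) := by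
  rw [mul_comm]
  exact norm_tsum_le _ (lift₂_aux_nonneg n a) (fun m b => lift₂_aux_bound hf n m a b) y

/-- The bilinear map `(x, y) ↦ ∑ₙ ∑ₘ fₙₘ(xₙ ⊗ yₘ)`. -/
def lift₂Bil (f : ∀ n m, BMap k (CTensor k (E n) (F m)) G)
    (hf : ∀ n m, (f n m).NormLE ((r : ℝ) ^ n * (s : ℝ) ^ m)) :
    C0Sum k E r →ₗ[k] C0Sum k F s →ₗ[k] G :=
  LinearMap.mk₂ k (fun x y => lift (r := r) (fun n => (lift₂Aux f hf n).flip y)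
      ⟨_, norm_nonneg y, norm_lift₂Aux_le f hf y⟩ x)
    (fun x x' y => map_add _ x x') (fun c x y => map_smul _ c x)
    (fun x y y' => by
      simp only [lift_apply]
      rw [← (summable_lift _ (norm_lift₂Aux_le f hf y) x).tsum_add
        (summable_lift _ (norm_lift₂Aux_le f hf y') x)]
      simp)
    (fun c x y => by
      simp only [lift_apply]
      rw [← (summable_lift _ (norm_lift₂Aux_le f hf y) x).tsum_const_smul]
      simp)

theorem norm_lift₂Bil_le (f : ∀ n m, BMap k (CTensor k (E n) (F m)) G)
    (hf : ∀ n m, (f n m).NormLE ((r : ℝ) ^ n * (s : ℝ) ^ m)) (x : C0Sum k E r)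
    (y : C0Sum k F s) : ‖lift₂Bil f hf x y‖ ≤ 1 * (‖x‖ * ‖y‖) := by
  rw [one_mul, mul_comm]
  exact norm_tsum_le _ (norm_nonneg y) (norm_lift₂Aux_le f hf y) x

/-- The map `∐ Eₙ ⊗ ∐ Fₘ → G` induced by a family of maps `Eₙ ⊗ Fₘ → G` of norm at most
`r ^ n * s ^ m`: on `x ⊗ y` it is `∑ₙ ∑ₘ fₙₘ(xₙ ⊗ yₘ)`. -/
def lift₂ (f : ∀ n m, BMap k (CTensor k (E n) (F m)) G)
    (hf : ∀ n m, (f n m).NormLE ((r : ℝ) ^ n * (s : ℝ) ^ m)) :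
    BMap k (CTensor k (C0Sum k E r) (C0Sum k F s)) G :=
  CTensor.lift (lift₂Bil f hf) ⟨1, norm_lift₂Bil_le f hf⟩

@[simp] theorem lift₂_tmul_incl (f : ∀ n m, BMap k (CTensor k (E n) (F m)) G)
    (hf : ∀ n m, (f n m).NormLE ((r : ℝ) ^ n * (s : ℝ) ^ m)) (n m : ℕ) (a : E n) (b : F m) :
    lift₂ f hf (CTensor.tmul (incl n a) (incl m b)) = f n m (CTensor.tmul a b) :=
  (CTensor.lift_tmul _ _ _ _).trans
    ((lift_incl (r := r) (fun n => (lift₂Aux f hf n).flip (incl m b))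
      ⟨_, norm_nonneg _, norm_lift₂Aux_le f hf (incl m b)⟩ n a).trans
      (lift_incl (r := s) (fun m => (f n m).lin ∘ₗ CTensor.tmul a)
        ⟨_, lift₂_aux_nonneg n a, fun m b => lift₂_aux_bound hf n m a b⟩ m b))

theorem lift₂_normLE (f : ∀ n m, BMap k (CTensor k (E n) (F m)) G)
    (hf : ∀ n m, (f n m).NormLE ((r : ℝ) ^ n * (s : ℝ) ^ m)) : (lift₂ f hf).NormLE 1 :=
  CTensor.lift_normLE _ _ zero_le_one (norm_lift₂Bil_le f hf)

end lift₂

end C0Sum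

/-! ### Completed tensor powers -/

/-- A non-Archimedean Banach space over `k`, bundled (used only for the recursion that defines
the tensor powers). -/
structure Ban (k : Type u) [NormedField k] where
  /-- the underlying space -/
  carrier : Type v
  [group : NormedAddCommGroup carrier]
  [space : NormedSpace k carrier]
  [ultra : IsUltrametricDist carrier]
  [complete : CompleteSpace carrier]

instance (k : Type u) [NormedField k] : CoeSort (Ban.{u, v} k) (Type v) := ⟨Ban.carrier⟩

instance (k : Type u) [NormedField k] (B : Ban.{u, v} k) : NormedAddCommGroup B := B.group
instance (k : Type u) [NormedField k] (B : Ban.{u, v} k) : NormedSpace k B := B.space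
instance (k : Type u) [NormedField k] (B : Ban.{u, v} k) : IsUltrametricDist B := B.ultra
instance (k : Type u) [NormedField k] (B : Ban.{u, v} k) : CompleteSpace B := B.complete

instance (k : Type u) [NormedField k] [IsUltrametricDist k] :
    IsUltrametricDist (ULift.{v} k) :=
  IsUltrametricDist.isUltrametricDist_of_forall_norm_add_le_max_norm fun x y =>
    IsUltrametricDist.norm_add_le_max x.down y.down

section tensor

variable (k : Type u) [NormedField k] [IsUltrametricDist k] [CompleteSpace k]
  (V : Type v) [NormedAddCommGroup V] [NormedSpace k V]

/-- The completed tensor powers `V^⊗0 = k`, `V^⊗(n+1) = V^⊗n ⊗ V`. -/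
def tpow : ℕ → Ban.{u, max u v} k
  | 0 => ⟨ULift.{v} k⟩
  | n + 1 => ⟨CTensor k (tpow n) V⟩

variable {V}

/-- `V^⊗0 = k`. -/
def tpowZero : BMap k (tpow k V 0) k :=
  ⟨(ULift.moduleEquiv : ULift.{v} k ≃ₗ[k] k).toLinearMap, 1, fun x => by
    rw [one_mul]; exact le_of_eq rfl⟩

/-- `k = V^⊗0`. -/
def tpowZeroInv : BMap k k (tpow k V 0) :=
  ⟨(ULift.moduleEquiv : ULift.{v} k ≃ₗ[k] k).symm.toLinearMap, 1, fun x => by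
    rw [one_mul]; exact le_of_eq rfl⟩

/-- The identity `V^⊗(n+1) = V^⊗n ⊗ V`. -/
def tpowSucc (n : ℕ) : BMap k (tpow k V (n + 1)) (CTensor k (tpow k V n) V) :=
  BMap.id k (CTensor k (tpow k V n) V)

/-- The identity `V^⊗n ⊗ V = V^⊗(n+1)`. -/
def tpowSuccInv (n : ℕ) : BMap k (CTensor k (tpow k V n) V) (tpow k V (n + 1)) :=
  BMap.id k (CTensor k (tpow k V n) V)

variable {k}

theorem tpowZero_normLE : (tpowZero k : BMap k (tpow k V 0) k).NormLE 1 := fun x => by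
  rw [one_mul]; exact le_of_eq rfl

theorem tpowSucc_normLE (n : ℕ) : (tpowSucc k n : BMap k (tpow k V (n + 1)) _).NormLE 1 :=
  BMap.id_normLE (k := k) (E := CTensor k (tpow k V n) V)

theorem tpowSuccInv_normLE (n : ℕ) :
    (tpowSuccInv k n : BMap k _ (tpow k V (n + 1))).NormLE 1 :=
  BMap.id_normLE (k := k) (E := CTensor k (tpow k V n) V)

@[simp] theorem tpowSucc_tpowSuccInv (n : ℕ) (z : CTensor k (tpow k V n) V) :
    tpowSucc k n (tpowSuccInv k n z) = z := rfl

@[simp] theorem tpowSuccInv_tpowSucc (n : ℕ) (z : tpow k V (n + 1)) :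
    tpowSuccInv k n (tpowSucc k n z) = z := rfl

@[simp] theorem tpowZero_tpowZeroInv (a : k) :
    tpowZero k (tpowZeroInv k a : tpow k V 0) = a := rfl

@[simp] theorem tpowZeroInv_tpowZero (x : tpow k V 0) :
    tpowZeroInv k (tpowZero k x) = x := rfl

/-- Right multiplication by scalars, `E ⊗ V^⊗0 → E`. -/
def rightUnit (E : Type*) [NormedAddCommGroup E] [NormedSpace k E] [CompleteSpace E]
    [IsUltrametricDist E] : BMap k (CTensor k E (tpow k V 0)) E :=
  CTensor.smulMap.comp <| CTensor.swap.comp <| CTensor.map (BMap.id k E) (tpowZero k)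

theorem rightUnit_normLE (E : Type*) [NormedAddCommGroup E] [NormedSpace k E] [CompleteSpace E]
    [IsUltrametricDist E] : (rightUnit (V := V) E : BMap k _ E).NormLE 1 :=
  BMap.NormLE.comp_one
    (CTensor.lift_normLE _ _ zero_le_one fun a b => by simp [norm_smul])
    (CTensor.swap_normLE.comp_one (CTensor.map_normLE_one BMap.id_normLE tpowZero_normLE))

/-- The concatenation isomorphism `V^⊗n ⊗ V^⊗m → V^⊗(n+m)`. -/
def concat (n : ℕ) : ∀ m, BMap k (CTensor k (tpow k V n) (tpow k V m)) (tpow k V (n + m))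
  | 0 => rightUnit (tpow k V n)
  | m + 1 => (tpowSuccInv k (n + m)).comp <|
      (CTensor.map (concat n m) (BMap.id k V)).comp <|
      CTensor.assocInv.comp <| CTensor.map (BMap.id k (tpow k V n)) (tpowSucc k m)

theorem concat_normLE (n : ℕ) : ∀ m,
    (concat n m : BMap k (CTensor k (tpow k V n) (tpow k V m)) _).NormLE 1
  | 0 => rightUnit_normLE _
  | m + 1 => (tpowSuccInv_normLE (n + m)).comp_one <|
      (CTensor.map_normLE_one (concat_normLE n m) BMap.id_normLE).comp_one <|
      CTensor.assocInv_normLE.comp_one <|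
      CTensor.map_normLE_one BMap.id_normLE (tpowSucc_normLE m)

/-! ### Pre-braidings and the tensor bialgebra -/

/-- The braid (hexagon) equation
`(c ⊗ Id)(Id ⊗ c)(c ⊗ Id) = (Id ⊗ c)(c ⊗ Id)(Id ⊗ c)` on `V ⊗ V ⊗ V`. -/
def IsPreBraiding (c : BMap k (CTensor k V V) (CTensor k V V)) : Prop :=
  let c₁ : BMap k (CTensor k (CTensor k V V) V) (CTensor k (CTensor k V V) V) :=
    CTensor.map c (BMap.id k V)
  let c₂ : BMap k (CTensor k (CTensor k V V) V) (CTensor k (CTensor k V V) V) :=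
    CTensor.assocInv.comp ((CTensor.map (BMap.id k V) c).comp CTensor.assoc)
  c₁.comp (c₂.comp c₁) = c₂.comp (c₁.comp c₂)

variable (c : BMap k (CTensor k V V) (CTensor k V V))

/-- The induced map `V^⊗n ⊗ V → V ⊗ V^⊗n`, which moves the last factor past the first `n`. -/
def braidOne : ∀ n, BMap k (CTensor k (tpow k V n) V) (CTensor k V (tpow k V n))
  | 0 => CTensor.swap
  | n + 1 =>
      (CTensor.map (BMap.id k V) (tpowSuccInv k n)).comp <|
      CTensor.assoc.comp <|
      (CTensor.map (braidOne n) (BMap.id k V)).comp <|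
      CTensor.assocInv.comp <|
      (CTensor.map (BMap.id k (tpow k V n)) c).comp <|
      CTensor.assoc.comp <|
      CTensor.map (tpowSucc k n) (BMap.id k V)

/-- The induced map `c_{n,m} : V^⊗n ⊗ V^⊗m → V^⊗m ⊗ V^⊗n`. -/
def braidPow (n : ℕ) : ∀ m,
    BMap k (CTensor k (tpow k V n) (tpow k V m)) (CTensor k (tpow k V m) (tpow k V n))
  | 0 => CTensor.swap
  | m + 1 =>
      (CTensor.map (tpowSuccInv k m) (BMap.id k (tpow k V n))).comp <|
      CTensor.assocInv.comp <|
      (CTensor.map (BMap.id k (tpow k V m)) (braidOne c n)).comp <|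
      CTensor.assoc.comp <|
      (CTensor.map (braidPow n m) (BMap.id k V)).comp <|
      CTensor.assocInv.comp <|
      CTensor.map (BMap.id k (tpow k V n)) (tpowSucc k m)

variable {c}

theorem braidOne_normLE (hc : c.NormLE 1) : ∀ n, (braidOne c n).NormLE 1
  | 0 => CTensor.swap_normLE
  | n + 1 =>
      (CTensor.map_normLE_one BMap.id_normLE (tpowSuccInv_normLE n)).comp_one <|
      CTensor.assoc_normLE.comp_one <|
      (CTensor.map_normLE_one (braidOne_normLE hc n) BMap.id_normLE).comp_one <|
      CTensor.assocInv_normLE.comp_one <|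
      (CTensor.map_normLE_one BMap.id_normLE hc).comp_one <|
      CTensor.assoc_normLE.comp_one <|
      CTensor.map_normLE_one (tpowSucc_normLE n) BMap.id_normLE

theorem braidPow_normLE (hc : c.NormLE 1) (n : ℕ) : ∀ m, (braidPow c n m).NormLE 1
  | 0 => CTensor.swap_normLE
  | m + 1 =>
      (CTensor.map_normLE_one (tpowSuccInv_normLE m) BMap.id_normLE).comp_one <|
      CTensor.assocInv_normLE.comp_one <|
      (CTensor.map_normLE_one BMap.id_normLE (braidOne_normLE hc n)).comp_one <|
      CTensor.assoc_normLE.comp_one <|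
      (CTensor.map_normLE_one (braidPow_normLE hc n m) BMap.id_normLE).comp_one <|
      CTensor.assocInv_normLE.comp_one <|
      CTensor.map_normLE_one BMap.id_normLE (tpowSucc_normLE m)

variable (k V) in
/-- The Banach tensor algebra `T_r(V)`: the contracting coproduct of the spaces `V^⊗n` with norm
scaled by `r ^ n`, that is, of the tensor powers of `V` with norm scaled by `r`. -/
abbrev TAlg (r : {r : ℝ // 0 < r}) : Type (max u v) := C0Sum k (fun n => tpow k V n) r

namespace TAlg

variable {r s : {r : ℝ // 0 < r}}

/-- The multiplication of `T_r(V)`, by concatenation. -/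
def mul : BMap k (CTensor k (TAlg k V r) (TAlg k V r)) (TAlg k V r) :=
  C0Sum.lift₂ (fun n m => (C0Sum.incl (n + m)).comp (concat n m)) fun n m => by
    rw [← pow_add, ← mul_one ((r : ℝ) ^ (n + m))]
    exact BMap.NormLE.comp (pow_nonneg r.2.le _) (C0Sum.incl_normLE _) (concat_normLE n m)

theorem mul_normLE :
    (mul : BMap k (CTensor k (TAlg k V r) (TAlg k V r)) (TAlg k V r)).NormLE 1 :=
  C0Sum.lift₂_normLE _ _

/-- The unit of `T_r(V)`. -/
def one : TAlg k V r := C0Sum.incl 0 (tpowZeroInv k 1)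

/-- The counit of `T_r(V)`: the projection to `V^⊗0 = k`. -/
def counit : BMap k (TAlg k V r) k := (tpowZero k).comp (C0Sum.coordB 0)

/-- The inclusion `V → T_r(V)` in degree one. -/
def inclV : BMap k V (TAlg k V r) :=
  (C0Sum.incl 1).comp <| (tpowSuccInv k 0).comp
    ⟨CTensor.tmul (tpowZeroInv k 1), _, fun v => CTensor.norm_tmul_le _ v⟩

theorem norm_inclV_le (v : V) : ‖(inclV v : TAlg k V r)‖ ≤ (r : ℝ) * ‖v‖ := by
  refine (C0Sum.incl_normLE 1 _).trans ?_
  rw [pow_one]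
  refine mul_le_mul_of_nonneg_left ((tpowSuccInv_normLE 0 _).trans ?_) r.2.le
  rw [one_mul]
  refine (CTensor.norm_tmul_le _ v).trans (le_of_eq ?_)
  rw [show ‖(tpowZeroInv k 1 : tpow k V 0)‖ = ‖(1 : k)‖ from rfl, norm_one, one_mul]

theorem norm_one_le : ‖(one : TAlg k V r)‖ ≤ 1 := by
  refine (C0Sum.incl_normLE 0 _).trans ?_
  rw [pow_zero, one_mul, show ‖(tpowZeroInv k 1 : tpow k V 0)‖ = ‖(1 : k)‖ from rfl, norm_one]

/-- The pre-braiding of `T_r(V)` induced by `c`. -/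
def braid (hc : c.NormLE 1) :
    BMap k (CTensor k (TAlg k V r) (TAlg k V r)) (CTensor k (TAlg k V r) (TAlg k V r)) :=
  C0Sum.lift₂ (fun n m => (CTensor.map (C0Sum.incl m) (C0Sum.incl n)).comp (braidPow c n m))
    fun n m => by
      rw [mul_comm, ← mul_one ((r : ℝ) ^ m * (r : ℝ) ^ n)]
      exact BMap.NormLE.comp (mul_nonneg (pow_nonneg r.2.le m) (pow_nonneg r.2.le n))
        (CTensor.map_normLE (pow_nonneg r.2.le m) (pow_nonneg r.2.le n)
          (C0Sum.incl_normLE m) (C0Sum.incl_normLE n)) (braidPow_normLE hc n m)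

theorem braid_normLE (hc : c.NormLE 1) : (braid (r := r) hc).NormLE 1 :=
  C0Sum.lift₂_normLE _ _

/-- The multiplication `(μ ⊗ μ)(Id ⊗ c ⊗ Id)` of the braided tensor square of `T_r(V)`. -/
def mulSq (hc : c.NormLE 1) :
    BMap k (CTensor k (CTensor k (TAlg k V r) (TAlg k V r)) (CTensor k (TAlg k V r) (TAlg k V r)))
      (CTensor k (TAlg k V r) (TAlg k V r)) :=
  (CTensor.map mul mul).comp (CTensor.mid (braid hc))

theorem mulSq_normLE (hc : c.NormLE 1) : (mulSq (r := r) hc).NormLE 1 :=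
  (CTensor.map_normLE_one mul_normLE mul_normLE).comp_one (CTensor.mid_normLE (braid_normLE hc))

theorem norm_comulV_le (v : V) :
    ‖(CTensor.tmul one (inclV v) + CTensor.tmul (inclV v) one :
      CTensor k (TAlg k V r) (TAlg k V r))‖ ≤ (r : ℝ) * ‖v‖ := by
  have h1 : ‖(one : TAlg k V r)‖ * ‖(inclV v : TAlg k V r)‖ ≤ (r : ℝ) * ‖v‖ :=
    (mul_le_of_le_one_left (norm_nonneg _) norm_one_le).trans (norm_inclV_le v)
  refine (IsUltrametricDist.norm_add_le_max _ _).trans (max_le ?_ ?_)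
  · exact (CTensor.norm_tmul_le _ _).trans h1
  · refine (CTensor.norm_tmul_le _ _).trans ?_
    rwa [mul_comm]

/-- The comultiplication on `V`: `v ↦ 1 ⊗ v + v ⊗ 1`. -/
def comulV : BMap k V (CTensor k (TAlg k V r) (TAlg k V r)) :=
  ⟨CTensor.tmul one ∘ₗ inclV.lin + CTensor.tmul.flip one ∘ₗ inclV.lin, r, norm_comulV_le⟩

theorem comulV_apply (v : V) : (comulV v : CTensor k (TAlg k V r) (TAlg k V r)) =
    CTensor.tmul one (inclV v) + CTensor.tmul (inclV v) one := rfl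

theorem comulV_normLE :
    (comulV : BMap k V (CTensor k (TAlg k V r) (TAlg k V r))).NormLE (r : ℝ) := norm_comulV_le

/-- The comultiplication on `V^⊗n`, extended from `V` multiplicatively. -/
def comulPow (r : {r : ℝ // 0 < r}) (hc : c.NormLE 1) :
    ∀ n, BMap k (tpow k V n) (CTensor k (TAlg k V r) (TAlg k V r))
  | 0 => BMap.comp ⟨LinearMap.toSpanSingleton k _ (CTensor.tmul one one),
      ‖(CTensor.tmul one one : CTensor k (TAlg k V r) (TAlg k V r))‖, fun a => by
        rw [LinearMap.toSpanSingleton_apply, norm_smul, mul_comm]⟩ (tpowZero k)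
  | n + 1 => (mulSq hc).comp <| (CTensor.map (comulPow r hc n) comulV).comp (tpowSucc k n)

theorem comulPow_normLE (hc : c.NormLE 1) : ∀ n, (comulPow r hc n).NormLE ((r : ℝ) ^ n)
  | 0 => fun x => by
    rw [pow_zero]
    change ‖tpowZero k x • (CTensor.tmul one one : CTensor k (TAlg k V r) (TAlg k V r))‖ ≤ _
    rw [norm_smul, mul_comm]
    refine mul_le_mul ?_ ((tpowZero_normLE x).trans (le_of_eq (one_mul _))) (norm_nonneg _)
      zero_le_one
    exact (CTensor.norm_tmul_le _ _).trans
      (mul_le_one₀ norm_one_le (norm_nonneg _) norm_one_le)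
  | n + 1 => by
    refine (mulSq_normLE hc).comp_one ?_
    have h := BMap.NormLE.comp (mul_nonneg (pow_nonneg r.2.le n) r.2.le)
      (CTensor.map_normLE (pow_nonneg r.2.le n) r.2.le (comulPow_normLE hc n)
        comulV_normLE) (tpowSucc_normLE n)
    rwa [mul_one, ← pow_succ] at h

/-- The comultiplication of `T_r(V)`: the multiplicative extension, for the braided product of
`T_r(V) ⊗ T_r(V)`, of `v ↦ 1 ⊗ v + v ⊗ 1`. -/
def comul (hc : c.NormLE 1) : BMap k (TAlg k V r) (CTensor k (TAlg k V r) (TAlg k V r)) :=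
  C0Sum.lift (fun n => (comulPow r hc n).lin)
    ⟨1, zero_le_one, fun n a => by rw [one_mul]; exact comulPow_normLE hc n a⟩

/-- The projection of `T_r(V)` onto its homogeneous part of degree `n`. -/
def degProj (n : ℕ) : BMap k (TAlg k V r) (TAlg k V r) := (C0Sum.incl n).comp (C0Sum.coordB n)

end TAlg

end tensor

/-! ### Graded pre-braided Hopf algebras and their quotients -/

/-- The structure maps of an analytically graded pre-braided Banach Hopf algebra. The analytic
grading is recorded by the projections onto the homogeneous parts. The antipode is not listed: it
is the convolution inverse of the identity, so it is determined by the other structure maps, and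
maps that respect these respect it. -/
structure BraidedData (k : Type*) [NormedField k] (A : Type*) [SeminormedAddCommGroup A]
    [NormedSpace k A] where
  /-- the multiplication -/
  mul : BMap k (CTensor k A A) A
  /-- the unit -/
  one : A
  /-- the comultiplication -/
  comul : BMap k A (CTensor k A A)
  /-- the counit -/
  counit : BMap k A k
  /-- the pre-braiding -/
  braid : BMap k (CTensor k A A) (CTensor k A A)
  /-- the projections onto the homogeneous parts -/
  degProj : ℕ → BMap k A A

/-- `f` is a morphism of graded pre-braided Hopf algebras. -/
structure BraidedData.IsHom {k : Type*} [NormedField k] {A A' : Type*} [SeminormedAddCommGroup A]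
    [NormedSpace k A] [SeminormedAddCommGroup A'] [NormedSpace k A']
    (D : BraidedData k A) (D' : BraidedData k A') (f : BMap k A A') : Prop where
  mul : f.comp D.mul = D'.mul.comp (CTensor.map f f)
  one : f D.one = D'.one
  comul : (CTensor.map f f).comp D.comul = D'.comul.comp f
  counit : D'.counit.comp f = D.counit
  braid : (CTensor.map f f).comp D.braid = D'.braid.comp (CTensor.map f f)
  degProj : ∀ n, f.comp (D.degProj n) = (D'.degProj n).comp f

/-- A linear isometric isomorphism as a bounded map. -/
def BMap.ofIso {k : Type*} [NormedField k] {A A' : Type*} [SeminormedAddCommGroup A]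
    [NormedSpace k A] [SeminormedAddCommGroup A'] [NormedSpace k A'] (e : A ≃ₗᵢ[k] A') :
    BMap k A A' :=
  ⟨e.toLinearEquiv.toLinearMap, 1, fun x => by rw [one_mul]; exact (e.norm_map x).le⟩

/-- The projection to the quotient by a subspace, with the quotient norm. -/
def BMap.quot {k : Type*} [NormedField k] {A : Type*} [SeminormedAddCommGroup A]
    [NormedSpace k A] (I : Submodule k A) : BMap k A (A ⧸ I) :=
  ⟨I.mkQ, 1, fun x => by rw [one_mul]; exact Submodule.Quotient.norm_mk_le I x⟩

section nichols

variable {k : Type u} [NormedField k] [IsUltrametricDist k] [CompleteSpace k]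
  {V : Type v} [NormedAddCommGroup V] [NormedSpace k V]
  {c : BMap k (CTensor k V V) (CTensor k V V)} {r s : {r : ℝ // 0 < r}}

/-- The graded pre-braided Hopf algebra `T_r^c(V)`. -/
def tensorData (r : {r : ℝ // 0 < r}) (hc : c.NormLE 1) : BraidedData k (TAlg k V r) where
  mul := TAlg.mul
  one := TAlg.one
  comul := TAlg.comul hc
  counit := TAlg.counit
  braid := TAlg.braid hc
  degProj := TAlg.degProj

/-- `I` is a (not necessarily closed) homogeneous two-sided ideal of `T_r(V)` that is contained in
the part of degree at least two and is a coideal. -/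
structure IsNicholsIdeal (hc : c.NormLE 1) (I : Submodule k (TAlg k V r)) : Prop where
  mul_left : ∀ x, ∀ y ∈ I, TAlg.mul (CTensor.tmul x y) ∈ I
  mul_right : ∀ x ∈ I, ∀ y, TAlg.mul (CTensor.tmul x y) ∈ I
  homogeneous : ∀ x ∈ I, ∀ n, TAlg.degProj n x ∈ I
  degree : ∀ x ∈ I, ∀ n < 2, TAlg.degProj n x = 0
  coideal : ∀ x ∈ I, TAlg.comul hc x ∈
    closure (Submodule.span k {z : CTensor k (TAlg k V r) (TAlg k V r) |
      ∃ a b, (a ∈ I ∨ b ∈ I) ∧ z = CTensor.tmul a b} : Set (CTensor k (TAlg k V r) (TAlg k V r)))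

/-- The sum `I(V_r)` of all homogeneous ideals and coideals in degrees at least two. The Nichols
algebra `𝔅_r^c(V)` is the quotient of `T_r^c(V)` by it. -/
def nicholsIdeal (r : {r : ℝ // 0 < r}) (hc : c.NormLE 1) : Submodule k (TAlg k V r) :=
  sSup {I | IsNicholsIdeal hc I}

/-- The pairing `⟨x ⊗ y, z ⊗ t⟩ = ⟨x, z⟩ ⟨y, t⟩` induced by a pairing. -/
def pairSq {E F : Type*} [SeminormedAddCommGroup E] [NormedSpace k E]
    [SeminormedAddCommGroup F] [NormedSpace k F] (P : BMap k (CTensor k E F) k) :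
    BMap k (CTensor k (CTensor k E E) (CTensor k F F)) k :=
  CTensor.smulMap.comp ((CTensor.map P P).comp (CTensor.mid CTensor.swap))

theorem pairSq_tmul {E F : Type*} [SeminormedAddCommGroup E] [NormedSpace k E]
    [SeminormedAddCommGroup F] [NormedSpace k F] (P : BMap k (CTensor k E F) k)
    (x y : E) (z t : F) :
    pairSq P (CTensor.tmul (CTensor.tmul x y) (CTensor.tmul z t)) =
      P (CTensor.tmul x z) * P (CTensor.tmul y t) := by
  simp [pairSq]

/-- `B` is a non-degenerate symmetric bilinear form on the pre-braided Banach space `(V, c)`: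
it is compatible with `c`, symmetric, and both induced maps `V → V*` are injective. -/
structure IsNondegSymmForm (c : BMap k (CTensor k V V) (CTensor k V V))
    (B : BMap k (CTensor k V V) k) : Prop where
  compat : ∀ x y : CTensor k V V,
    pairSq B (CTensor.tmul (c x) y) = pairSq B (CTensor.tmul x (c y))
  symm : ∀ v w, B (CTensor.tmul v w) = B (CTensor.tmul w v)
  nondeg_left : ∀ v, (∀ w, B (CTensor.tmul v w) = 0) → v = 0
  nondeg_right : ∀ w, (∀ v, B (CTensor.tmul v w) = 0) → w = 0

/-- `P` is a dual pairing of Hopf algebras `T_r^c(V) ⊗ T_s^c(V) → k` that extends the bilinear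
form `B` on `V`. -/
structure IsPairingExtending (hc : c.NormLE 1) (B : BMap k (CTensor k V V) k)
    (P : BMap k (CTensor k (TAlg k V r) (TAlg k V s)) k) : Prop where
  mul_left : ∀ x x' y, P (CTensor.tmul (TAlg.mul (CTensor.tmul x x')) y) =
    pairSq P (CTensor.tmul (CTensor.tmul x x') (TAlg.comul hc y))
  mul_right : ∀ x y y', P (CTensor.tmul x (TAlg.mul (CTensor.tmul y y'))) =
    pairSq P (CTensor.tmul (TAlg.comul hc x) (CTensor.tmul y y'))
  one_left : ∀ y, P (CTensor.tmul TAlg.one y) = TAlg.counit y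
  one_right : ∀ x, P (CTensor.tmul x TAlg.one) = TAlg.counit x
  extend : ∀ v w, P (CTensor.tmul (TAlg.inclV v) (TAlg.inclV w)) = B (CTensor.tmul v w)

/-- The radical in the first variable of a pairing. -/
def radical {E F : Type*} [SeminormedAddCommGroup E] [NormedSpace k E]
    [SeminormedAddCommGroup F] [NormedSpace k F] (P : BMap k (CTensor k E F) k) :
    Submodule k E where
  carrier := {x | ∀ y, P (CTensor.tmul x y) = 0}
  zero_mem' := fun y => by simp
  add_mem' := fun {a b} ha hb y => by
    rw [map_add, LinearMap.add_apply, map_add, ha y, hb y, add_zero]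
  smul_mem' := fun a x hx y => by
    rw [map_smul, LinearMap.smul_apply, map_smul, hx y, smul_zero]

/-- The natural map `T_r^c(V) / I → T_r^c(V) / J` is well defined and is an isomorphism of
analytically graded pre-braided Banach Hopf algebras: both subspaces are closed, all structure
maps of `T_r^c(V)` descend to both quotients, and the identity of `T_r^c(V)` induces an isometric
isomorphism that respects the induced structure maps. -/
def NaturalIso (hc : c.NormLE 1) (I J : Submodule k (TAlg k V r)) : Prop :=
  IsClosed (I : Set (TAlg k V r)) ∧ IsClosed (J : Set (TAlg k V r)) ∧
  ∃ (DI : BraidedData k (TAlg k V r ⧸ I)) (DJ : BraidedData k (TAlg k V r ⧸ J)),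
    (tensorData r hc).IsHom DI (BMap.quot I) ∧ (tensorData r hc).IsHom DJ (BMap.quot J) ∧
    ∃ e : (TAlg k V r ⧸ I) ≃ₗᵢ[k] (TAlg k V r ⧸ J),
      (∀ x, e (I.mkQ x) = J.mkQ x) ∧ DI.IsHom DJ (BMap.ofIso e)

end nichols

end NichNA

end

noncomputable section

namespace NichNA

open scoped TensorProduct Topology
open Filter UniformSpace

universe u v w

/-! ### Shuffles and symmetrizers in a ring with elements satisfying the braid relations -/

section braidRing

variable {R R' : Type*} [Ring R] [Ring R']

/-! Let σ_i be c acting on the tensor factors i and i + 1. The braid equation for c turns these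
operators into a family with the braid relations, and the algebraic half of the proof compares
integer polynomials in them. After concatenation of the two legs, the component of Δ in bidegree (n,
m) is the shuffle operator `shuf σ n m` (`TAlg.mulDeg_comul`) and the induced pre-braiding is `cross
σ n m` (`TAlg.mulDeg_braid`).

Let S be the braided symmetrizer, equal to S_n = `symz σ n` in degree n, and let (x | y) be the
factorwise tensor power of the given form. The pairing is ⟨x, y⟩ = (x | S y). The factorization
S_{n+m} = (S_n ⊗ S_m) · shuf_{n,m} (`IsBraid.symz_add`) is precisely ⟨xx', y⟩ = ⟨x ⊗ x', Δy⟩.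
Compatibility of the form with c makes each σ_i self-adjoint, and S_n does not change when all words
are reversed (`IsBraid.symz_op`), so S is self-adjoint. As the form is symmetric, the pairing is
symmetric, and the second Hopf identity follows from the first. Sums of contractions of an
ultrametric space are contractions, so S has norm at most 1 however many terms it has; the bound rs
on the form then bounds the pairing. Uniqueness holds because the Hopf identities determine the
pairing from its values on V.

The radical is a closed homogeneous ideal and vanishes in degrees 0 and 1, by the counit and by
non-degeneracy. That it is a coideal is the analytic point. The functionals ⟨-, y⟩ separate the
points of T/I, and products of two separating families still separate the points of the completed
tensor product (`CTensor.eq_zero_of_map`, by approximate orthogonalization). Hence Δx dies in T/I ⊗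
T/I for x in the radical I, and the kernel of the projection to that space is the closure of I ⊗ T +
T ⊗ I (`CTensor.mem_closure_of_map_quot`). Conversely, every homogeneous ideal and coideal in
degrees at least two is orthogonal to all y, by induction on the degree of y (`TAlg.le_radical`). So
I(V_r) is equal to the radical, the isomorphism is the identity, and independence of s and of the
form is immediate because I(V_r) involves neither. -/

/-- The relations of the braid monoid on infinitely many strands. -/
structure IsBraid (σ : ℕ → R) : Prop where
  far : ∀ i j, i + 2 ≤ j → σ i * σ j = σ j * σ i
  braid : ∀ i, σ i * σ (i + 1) * σ i = σ (i + 1) * σ i * σ (i + 1)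

/-- `σₐ σₐ₊₁ ⋯ σₐ₊ₗ₋₁`. -/
def cyc (σ : ℕ → R) (a : ℕ) : ℕ → R
  | 0 => 1
  | l + 1 => cyc σ a l * σ (a + l)

/-- The sum of the braids that lift the inverse shuffles of `n` and `m` strands. -/
def shuf (σ : ℕ → R) : ℕ → ℕ → R
  | 0, _ => 1
  | _ + 1, 0 => 1
  -- The last strand either ends the second leg, or is carried left across the m + 1 strands of the
  -- second leg to position n, where it ends the first leg. These are the summands 1 ⊗ v and v ⊗ 1
  -- of Δ(v).
  | n + 1, m + 1 => shuf σ (n + 1) m + cyc σ n (m + 1) * shuf σ n (m + 1)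

/-- `1 + σₙ₋₁ + σₙ₋₁ σₙ₋₂ + ⋯ + σₙ₋₁ ⋯ σ₀`. -/
def ins (σ : ℕ → R) : ℕ → R
  | 0 => 1
  | n + 1 => 1 + σ n * ins σ n

/-- The braided symmetrizer on `n` strands. -/
def symz (σ : ℕ → R) : ℕ → R
  | 0 => 1
  | n + 1 => symz σ n * ins σ n

/-- The braid that moves `n` strands past `m` strands. -/
def cross (σ : ℕ → R) (n : ℕ) : ℕ → R
  | 0 => 1
  | m + 1 => cyc σ m n * cross σ n m

theorem shuf_zero_left (σ : ℕ → R) (m : ℕ) : shuf σ 0 m = 1 := by rw [shuf]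

theorem shuf_zero_right (σ : ℕ → R) (n : ℕ) : shuf σ n 0 = 1 := by cases n <;> rw [shuf]

theorem shuf_succ (σ : ℕ → R) (n m : ℕ) : shuf σ (n + 1) (m + 1) =
    shuf σ (n + 1) m + cyc σ n (m + 1) * shuf σ n (m + 1) := by rw [shuf]

theorem map_cyc (φ : R →+* R') (σ : ℕ → R) (a l : ℕ) : φ (cyc σ a l) = cyc (φ ∘ σ) a l := by
  induction l with
  | zero => simp [cyc]
  | succ l ih => simp [cyc, ih]

theorem map_shuf (φ : R →+* R') (σ : ℕ → R) (n m : ℕ) : φ (shuf σ n m) = shuf (φ ∘ σ) n m := by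
  induction n generalizing m with
  | zero => simp [shuf]
  | succ n ihn =>
    induction m with
    | zero => simp [shuf]
    | succ m ihm => simp [shuf, ihn, ihm, map_cyc]

theorem map_ins (φ : R →+* R') (σ : ℕ → R) (n : ℕ) : φ (ins σ n) = ins (φ ∘ σ) n := by
  induction n with
  | zero => simp [ins]
  | succ n ih => simp [ins, ih]

theorem map_symz (φ : R →+* R') (σ : ℕ → R) (n : ℕ) : φ (symz σ n) = symz (φ ∘ σ) n := by
  induction n with
  | zero => simp [symz]
  | succ n ih => simp [symz, ih, map_ins]

theorem map_cross (φ : R →+* R') (σ : ℕ → R) (n m : ℕ) :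
    φ (cross σ n m) = cross (φ ∘ σ) n m := by
  induction m with
  | zero => simp [cross]
  | succ m ih => simp [cross, ih, map_cyc]

/-! ### Reduction of statements about braid words to the generators -/

theorem cyc_mem {A : Subring R} {σ : ℕ → R} {a l : ℕ}
    (h : ∀ i, a ≤ i → i < a + l → σ i ∈ A) : cyc σ a l ∈ A := by
  induction l with
  | zero => exact one_mem A
  | succ l ih =>
    exact mul_mem (ih fun i h1 h2 => h i h1 (by omega)) (h _ (by omega) (by omega))

theorem shuf_mem {A : Subring R} {σ : ℕ → R} {n m : ℕ}
    (h : ∀ i, i + 1 < n + m → σ i ∈ A) : shuf σ n m ∈ A := by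
  induction n generalizing m with
  | zero => exact (by simp [shuf])
  | succ n ihn =>
    induction m with
    | zero => exact (by simp [shuf])
    | succ m ihm =>
      rw [shuf_succ]
      exact add_mem (ihm fun i hi => h i (by omega))
        (mul_mem (cyc_mem fun i _ hi => h i (by omega)) (ihn fun i hi => h i (by omega)))

theorem ins_mem {A : Subring R} {σ : ℕ → R} {n : ℕ} (h : ∀ i, i < n → σ i ∈ A) :
    ins σ n ∈ A := by
  induction n with
  | zero => exact one_mem A
  | succ n ih =>
    exact add_mem (one_mem A) (mul_mem (h n (by omega)) (ih fun i hi => h i (by omega)))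

theorem symz_mem {A : Subring R} {σ : ℕ → R} {n : ℕ} (h : ∀ i, i + 1 < n → σ i ∈ A) :
    symz σ n ∈ A := by
  induction n with
  | zero => exact one_mem A
  | succ n ih =>
    exact mul_mem (ih fun i hi => h i (by omega)) (ins_mem fun i hi => h i (by omega))

theorem cross_mem {A : Subring R} {σ : ℕ → R} {n m : ℕ}
    (h : ∀ i, i + 1 < n + m → σ i ∈ A) : cross σ n m ∈ A := by
  induction m with
  | zero => exact one_mem A
  | succ m ih =>
    exact mul_mem (cyc_mem fun i _ hi => h i (by omega)) (ih fun i hi => h i (by omega))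

section pair

variable {A : Subring (R × R')} {σ : ℕ → R} {σ' : ℕ → R'}

/-- A relation between an operator and its counterpart that is stable under sums, negatives and
products defines a subring of R × R'. It then holds for corresponding polynomials in σ and σ' as
soon as it holds for the generators. The subrings used below are `intertwine`, `leftAct`, `rightAct`
and `adj`. -/
theorem cyc_pair_mem {a l : ℕ} (h : ∀ i, a ≤ i → i < a + l → (σ i, σ' i) ∈ A) :
    (cyc σ a l, cyc σ' a l) ∈ A := by
  have := cyc_mem (σ := fun i => (σ i, σ' i)) h
  convert this using 1
  exact Prod.ext (map_cyc (RingHom.fst R R') (fun i => (σ i, σ' i)) a l).symm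
    (map_cyc (RingHom.snd R R') (fun i => (σ i, σ' i)) a l).symm

theorem shuf_pair_mem {n m : ℕ} (h : ∀ i, i + 1 < n + m → (σ i, σ' i) ∈ A) :
    (shuf σ n m, shuf σ' n m) ∈ A := by
  have := shuf_mem (σ := fun i => (σ i, σ' i)) h
  convert this using 1
  exact Prod.ext (map_shuf (RingHom.fst R R') (fun i => (σ i, σ' i)) n m).symm
    (map_shuf (RingHom.snd R R') (fun i => (σ i, σ' i)) n m).symm

theorem symz_pair_mem {n : ℕ} (h : ∀ i, i + 1 < n → (σ i, σ' i) ∈ A) :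
    (symz σ n, symz σ' n) ∈ A := by
  have := symz_mem (σ := fun i => (σ i, σ' i)) h
  convert this using 1
  exact Prod.ext (map_symz (RingHom.fst R R') (fun i => (σ i, σ' i)) n).symm
    (map_symz (RingHom.snd R R') (fun i => (σ i, σ' i)) n).symm

theorem cross_pair_mem {n m : ℕ} (h : ∀ i, i + 1 < n + m → (σ i, σ' i) ∈ A) :
    (cross σ n m, cross σ' n m) ∈ A := by
  have := cross_mem (σ := fun i => (σ i, σ' i)) h
  convert this using 1
  exact Prod.ext (map_cross (RingHom.fst R R') (fun i => (σ i, σ' i)) n m).symm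
    (map_cross (RingHom.snd R R') (fun i => (σ i, σ' i)) n m).symm

end pair

/-- The pairs `(f, g)` with `x * f = g * x`. -/
def intertwine (x : R) : Subring (R × R) where
  carrier := {p | x * p.1 = p.2 * x}
  one_mem' := by simp
  zero_mem' := by simp
  mul_mem' {p q} hp hq := by
    simp only [Set.mem_ofPred_eq, Prod.fst_mul, Prod.snd_mul] at *
    rw [← mul_assoc, hp, mul_assoc, hq, mul_assoc]
  add_mem' {p q} hp hq := by
    simp only [Set.mem_ofPred_eq, Prod.fst_add, Prod.snd_add] at *
    rw [mul_add, add_mul, hp, hq]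
  neg_mem' {p} hp := by
    simp only [Set.mem_ofPred_eq, Prod.fst_neg, Prod.snd_neg] at *
    rw [mul_neg, neg_mul, hp]

theorem mem_intertwine {x : R} {p : R × R} : p ∈ intertwine x ↔ x * p.1 = p.2 * x := Iff.rfl

/-! ### Shuffle, symmetrizer and crossing identities from the braid relations -/

namespace IsBraid

variable {σ : ℕ → R} (h : IsBraid σ)

include h

theorem commute_of_far {i j : ℕ} (hij : i + 2 ≤ j ∨ j + 2 ≤ i) : σ i * σ j = σ j * σ i :=
  hij.elim (h.far i j) fun hji => (h.far j i hji).symm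

theorem cyc_comm {a l j : ℕ} (hj : j + 2 ≤ a ∨ a + l + 1 ≤ j) :
    σ j * cyc σ a l = cyc σ a l * σ j :=
  mem_intertwine.1 (cyc_pair_mem (A := intertwine (σ j)) fun i h1 h2 =>
    mem_intertwine.2 (h.commute_of_far (by omega)))

theorem symz_comm {n j : ℕ} (hj : n ≤ j) : σ j * symz σ n = symz σ n * σ j :=
  mem_intertwine.1 (symz_pair_mem (A := intertwine (σ j)) fun i hi =>
    mem_intertwine.2 (h.commute_of_far (by omega)))

theorem cross_comm {n m j : ℕ} (hj : n + m ≤ j) : σ j * cross σ n m = cross σ n m * σ j :=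
  mem_intertwine.1 (cross_pair_mem (A := intertwine (σ j)) fun i hi =>
    mem_intertwine.2 (h.commute_of_far (by omega)))

/-- Sliding a crossing through a strand that passes over it raises its index by one. Factors of the
cycle to the right of the relevant pair commute with σ_{a+i}; the pair itself is one use of the
braid relation; the factors to the left commute with σ_{a+i+1}. -/
theorem cyc_mul {a l i : ℕ} (hi : i + 1 < l) :
    cyc σ a l * σ (a + i) = σ (a + i + 1) * cyc σ a l := by
  induction l with
  | zero => omega
  | succ l ih =>
    rcases Nat.lt_or_ge (i + 1) l with hl | hl
    · rw [cyc, mul_assoc, ← h.far (a + i) (a + l) (by omega), ← mul_assoc, ih hl, mul_assoc]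
    · obtain rfl : l = i + 1 := by omega
      have hc := h.cyc_comm (a := a) (l := i) (j := a + i + 1) (by omega)
      have hb := h.braid (a + i)
      rw [mul_assoc] at hb
      simp only [cyc, ← add_assoc]
      rw [mul_assoc, mul_assoc, hb, ← mul_assoc, ← mul_assoc, ← hc]
      simp only [mul_assoc]

theorem cyc_mul_shuf (n m p : ℕ) :
    cyc σ n (m + p) * shuf (fun i => σ (n + i)) m p =
      shuf (fun i => σ (n + 1 + i)) m p * cyc σ n (m + p) :=
  mem_intertwine.1 (shuf_pair_mem (A := intertwine (cyc σ n (m + p))) fun i hi =>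
    mem_intertwine.2 (by
      simp only
      rw [h.cyc_mul hi, show n + i + 1 = n + 1 + i by omega]))

omit h in
theorem cyc_add (a l l' : ℕ) : cyc σ a (l + l') = cyc σ a l * cyc σ (a + l) l' := by
  induction l' with
  | zero => simp [cyc]
  | succ l' ih => rw [← add_assoc, cyc, ih, cyc, mul_assoc, add_assoc]

omit h in
theorem cyc_shift (n a l : ℕ) : cyc (fun i => σ (n + i)) a l = cyc σ (n + a) l := by
  induction l with
  | zero => rfl
  | succ l ih => rw [cyc, cyc, ih, add_assoc]

omit h in
theorem shuf_one (n : ℕ) : shuf σ n 1 = ins σ n := by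
  induction n with
  | zero => rw [shuf_zero_left, ins]
  | succ n ih => simp [shuf, ins, ih, cyc]

/-- Coassociativity of the shuffle comultiplication. -/
theorem shuf_coassoc (n m p : ℕ) :
    shuf σ n m * shuf σ (n + m) p =
      shuf (fun i => σ (n + i)) m p * shuf σ n (m + p) := by
  induction hN : n + m + p using Nat.strong_induction_on generalizing n m p with
  | _ N ih =>
  subst hN
  match n, m, p with
  | 0, m, p => simp [shuf]
  | n + 1, 0, p => simp [shuf]
  | n + 1, m + 1, 0 => simp [shuf, shuf_zero_right]
  -- Both sides are split according to the leg in which the last strand ends. The third, second and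
  -- first leg correspond to the induction hypotheses `h1`, `h2` and `h3`.
  | n + 1, m + 1, p + 1 =>
    have h1 := ih (n + 1 + (m + 1) + p) (by omega) (n + 1) (m + 1) p rfl
    have h2 := ih (n + 1 + m + (p + 1)) (by omega) (n + 1) m (p + 1) rfl
    have h3 := ih (n + (m + 1) + (p + 1)) (by omega) n (m + 1) (p + 1) rfl
    -- The generators in this shuffle have index at most n + m - 1 and those in the cycle at least n
    -- + m + 1, so all of them are far apart.
    have hcom : ∀ a b, a + b ≤ n + m + 1 → cyc σ (n + 1 + m) (p + 1) * shuf σ a b =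
        shuf σ a b * cyc σ (n + 1 + m) (p + 1) := fun a b hab => by
      refine mem_intertwine.1 (shuf_pair_mem (A := intertwine _) fun i hi =>
        mem_intertwine.2 (h.cyc_comm ?_).symm)
      omega
    have e1 : shuf σ (n + 1 + (m + 1)) (p + 1) =
        shuf σ (n + 1 + (m + 1)) p + cyc σ (n + 1 + m) (p + 1) * shuf σ (n + 1 + m) (p + 1) :=
            shuf_succ σ (n + 1 + m) p
    have e2 : shuf σ (n + 1) (m + 1) =
        shuf σ (n + 1) m + cyc σ n (m + 1) * shuf σ n (m + 1) := shuf_succ σ n m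
    have e3 : shuf σ (n + 1) (m + 1 + (p + 1)) = shuf σ (n + 1) (m + 1 + p) +
        cyc σ n (m + 1 + p + 1) * shuf σ n (m + 1 + (p + 1)) := shuf_succ σ n (m + 1 + p)
    have e4 : shuf (fun i => σ (n + 1 + i)) (m + 1) (p + 1) =
        shuf (fun i => σ (n + 1 + i)) (m + 1) p +
        cyc σ (n + 1 + m) (p + 1) * shuf (fun i => σ (n + 1 + i)) m (p + 1) := by
      rw [← cyc_shift, shuf_succ]
    have e5 : cyc σ n (m + 1 + p + 1) = cyc σ n (m + 1) * cyc σ (n + 1 + m) (p + 1) := by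
      rw [show m + 1 + p + 1 = (m + 1) + (p + 1) by omega, cyc_add,
        show n + (m + 1) = n + 1 + m by omega]
    have e6 := h.cyc_mul_shuf n (m + 1) (p + 1)
    rw [show m + 1 + (p + 1) = m + 1 + p + 1 by omega] at e6
    calc shuf σ (n + 1) (m + 1) * shuf σ (n + 1 + (m + 1)) (p + 1)
        = shuf σ (n + 1) (m + 1) * shuf σ (n + 1 + (m + 1)) p +
          (shuf σ (n + 1) m * cyc σ (n + 1 + m) (p + 1) +
            cyc σ n (m + 1) * (shuf σ n (m + 1) * cyc σ (n + 1 + m) (p + 1))) *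
            shuf σ (n + 1 + m) (p + 1) := by
          rw [e1, mul_add, ← mul_assoc _ (cyc _ _ _), e2]; noncomm_ring
      _ = shuf (fun i => σ (n + 1 + i)) (m + 1) p * shuf σ (n + 1) (m + 1 + p) +
          (cyc σ (n + 1 + m) (p + 1) * (shuf σ (n + 1) m * shuf σ (n + 1 + m) (p + 1)) +
            cyc σ n (m + 1) * cyc σ (n + 1 + m) (p + 1) *
              (shuf σ n (m + 1) * shuf σ (n + (m + 1)) (p + 1))) := by
          rw [h1, ← hcom _ _ (by omega), ← hcom _ _ (by omega),
            show n + (m + 1) = n + 1 + m by omega]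
          noncomm_ring
      _ = _ := by
          rw [h2, h3, ← e5, e4, e3, add_mul, mul_add, mul_add]
          rw [← mul_assoc (cyc σ n (m + 1 + p + 1)), e6, e4, add_mul, add_mul,
            show m + (p + 1) = m + 1 + p by omega]
          noncomm_ring

/-- The symmetrizer on `n + m` strands factors through the comultiplication. -/
theorem symz_add (n m : ℕ) :
    symz σ (n + m) = symz σ n * symz (fun i => σ (n + i)) m * shuf σ n m := by
  induction m with
  | zero => simp [symz, shuf_zero_right]
  | succ m ih =>
    -- Coassociativity with a third leg of length one is the inductive step, because the insertion
    -- operator is the shuffle with a single strand.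
    have := h.shuf_coassoc n m 1
    rw [shuf_one, shuf_one] at this
    rw [← add_assoc, symz, ih, mul_assoc, this, symz]
    simp only [mul_assoc]

/-- The symmetrizer is invariant under reversing the order of products. -/
theorem symz_op (n : ℕ) :
    symz (fun i => MulOpposite.op (σ i)) n = MulOpposite.op (symz σ n) := by
  induction n using Nat.strong_induction_on with
  | _ n ih =>
  match n with
  | 0 => rfl
  | 1 => simp [symz, ins]
  | n + 2 =>
    have h0 := ih n (by omega)
    have h1 := ih (n + 1) (by omega)
    set τ := fun i => MulOpposite.op (σ i) with hτ
    obtain ⟨f, hf⟩ : ∃ f, ins τ n = MulOpposite.op f := ⟨_, (MulOpposite.op_unop _).symm⟩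
    -- Unfolding two levels isolates one σ_n between copies of `ins σ n`. The reversed word has the
    -- same shape, so only the second summand has to be compared.
    have e : symz σ (n + 2) =
        symz σ (n + 1) + symz σ n * ins σ n * (σ n * ins σ n) := by
      rw [symz, ins, symz]; noncomm_ring
    have e' : symz τ (n + 2) =
        symz τ (n + 1) + symz τ n * ins τ n * (τ n * ins τ n) := by
      rw [symz, ins, symz]; noncomm_ring
    -- Here f is `ins σ n` with its words reversed. The case n + 1 of the induction says that
    -- inserting on the left by f or on the right by `ins σ n` gives the same symmetrizer. Since σ_n
    -- commutes with `symz σ n`, this can be applied on both sides of σ_n.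
    have h2 : f * symz σ n = symz σ n * ins σ n := by
      rw [symz, h0, hf, ← MulOpposite.op_mul, symz] at h1
      exact MulOpposite.op_injective h1
    rw [e', e, h1, h0, hf, hτ, ← MulOpposite.op_mul, ← MulOpposite.op_mul, ← MulOpposite.op_mul,
      ← MulOpposite.op_add]
    congr 2
    calc f * σ n * (f * symz σ n) = f * (σ n * symz σ n) * ins σ n := by
          rw [h2]; simp only [mul_assoc]
      _ = f * symz σ n * (σ n * ins σ n) := by
          rw [h.symz_comm le_rfl]; simp only [mul_assoc]
      _ = _ := by rw [h2]

/-- The definition of the crossing peels a strand off the right group; this is the recursion that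
peels one off the left group. The strand moves rightwards, so its word is a cycle in reversed order.
Comparing both recursions gives `cross_op`. -/
theorem cross_succ_left (n m : ℕ) : cross σ (n + 1) m =
    cross σ n m * MulOpposite.unop (cyc (fun i => MulOpposite.op (σ i)) n m) := by
  induction m with
  | zero => simp [cross, cyc]
  | succ m ih =>
    rw [cross, cross, ih, cyc, cyc, MulOpposite.unop_mul, MulOpposite.unop_op, mul_assoc,
      ← mul_assoc (σ _), add_comm m n, h.cross_comm le_rfl]
    simp only [mul_assoc]

omit h in
theorem cross_zero_left (m : ℕ) : cross σ 0 m = 1 := by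
  induction m with
  | zero => rfl
  | succ m ih => simp [cross, cyc, ih]

/-- Reversing the order of products turns the crossing of `n` and `m` strands into the crossing
of `m` and `n` strands. -/
theorem cross_op (n m : ℕ) :
    cross (fun i => MulOpposite.op (σ i)) n m = MulOpposite.op (cross σ m n) := by
  induction m with
  | zero => simp [cross, cross_zero_left]
  | succ m ih => rw [cross, ih, h.cross_succ_left, MulOpposite.op_mul, MulOpposite.op_unop]

theorem cross_mul_left {n m i : ℕ} (hi : i + 1 < n) :
    cross σ n m * σ i = σ (m + i) * cross σ n m := by
  induction m with
  | zero => simp [cross]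
  | succ m ih =>
    rw [cross, mul_assoc, ih, ← mul_assoc, h.cyc_mul hi, mul_assoc, add_right_comm]

theorem cross_mul_right {n m i : ℕ} (hi : i + 1 < m) :
    cross σ n m * σ (n + i) = σ i * cross σ n m := by
  induction m with
  | zero => omega
  | succ m ih =>
    rcases Nat.lt_or_ge (i + 1) m with hm | hm
    · rw [cross, mul_assoc, ih hm, ← mul_assoc, ← mul_assoc, h.cyc_comm (by omega)]
    · obtain rfl : m = i + 1 := by omega
      have h1 : σ i * cyc σ (i + 1) n = cyc σ i (n + 1) := by
        rw [add_comm n 1, cyc_add]; simp [cyc]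
      -- The long cycle raises the index of every generator of the short one, so `cyc_mul` extends
      -- from generators to the whole cycle.
      have h2 : cyc σ (i + 1) n * cyc σ i (n + 1) = cyc σ i (n + 1) * cyc σ i n := by
        have := cyc_pair_mem (A := intertwine (cyc σ i (n + 1))) (a := 0) (l := n)
          (σ := fun j => σ (i + j)) (σ' := fun j => σ (i + 1 + j)) fun j _ hj => by
            refine mem_intertwine.2 ?_
            simp only
            rw [h.cyc_mul (by omega), add_right_comm]
        rw [cyc_shift, cyc_shift] at this
        exact (mem_intertwine.1 this).symm
      rw [cross, cross, mul_assoc, mul_assoc, ← h.cross_comm (by omega), ← mul_assoc (cyc σ i n),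
        add_comm n i, ← cyc, ← mul_assoc, h2, ← h1]
      simp only [mul_assoc]

theorem symz_commute (n m : ℕ) : symz σ n * symz (fun i => σ (n + i)) m =
    symz (fun i => σ (n + i)) m * symz σ n :=
  mem_intertwine.1 (symz_pair_mem (A := intertwine (symz σ n)) fun i hi =>
    mem_intertwine.2 (h.symz_comm (by omega)).symm)

/-- The crossing is natural with respect to the symmetrizers. -/
theorem cross_mul_symz (n m : ℕ) :
    cross σ n m * (symz σ n * symz (fun i => σ (n + i)) m) =
      symz σ m * symz (fun i => σ (m + i)) n * cross σ n m := by
  have h1 := mem_intertwine.1 (symz_pair_mem (A := intertwine (cross σ n m))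
    (σ := σ) (σ' := fun i => σ (m + i)) (n := n) fun i hi =>
      mem_intertwine.2 (h.cross_mul_left (by omega)))
  have h2 := mem_intertwine.1 (symz_pair_mem (A := intertwine (cross σ n m))
    (σ := fun i => σ (n + i)) (σ' := σ) (n := m) fun i hi =>
      mem_intertwine.2 (h.cross_mul_right (by omega)))
  simp only at h1 h2
  rw [← mul_assoc, h1, mul_assoc, h2, ← mul_assoc, ← h.symz_commute]

end IsBraid

end braidRing

/-! ### Non-Archimedean functional analysis -/

section separation

variable {k : Type*} [NormedField k]

/-- Only finitely many rows exceed ε, and each row has finite support, so only finitely many entries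
exceed ε. In a complete ultrametric group this already gives unconditional summability. -/
theorem tendsto_cofinite_prod_of_le {G : Type*} [SeminormedAddCommGroup G]
    {g : ℕ × ℕ → G} {M : ℕ → ℝ} {s : ℕ → ℕ} (hM : Tendsto M atTop (𝓝 0))
    (hg : ∀ p, ‖g p‖ ≤ M p.1) (hs : ∀ p, s p.1 ≤ p.2 → g p = 0) :
    Tendsto g cofinite (𝓝 0) := by
  rw [Metric.tendsto_nhds]
  intro ε hε
  obtain ⟨N, hN⟩ := eventually_atTop.1 ((Metric.tendsto_nhds.1 hM) ε hε)
  refine Set.Finite.subset (s := ⋃ n ∈ Finset.range N, {n} ×ˢ (Finset.range (s n) : Set ℕ))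
    (Set.Finite.biUnion (Finset.finite_toSet _) fun n _ =>
      (Set.finite_singleton n).prod (Finset.finite_toSet _)) ?_
  rintro ⟨n, i⟩ hp
  replace hp : ¬ dist (g (n, i)) 0 < ε := hp
  have h1 : n < N := by
    by_contra hn
    refine hp ?_
    rw [dist_zero_right]
    refine (hg _).trans_lt ?_
    have := hN n (not_lt.1 hn)
    rw [Real.dist_eq, sub_zero] at this
    exact (le_abs_self _).trans_lt this
  have h2 : i < s n := by
    by_contra hi
    refine hp ?_
    rw [hs (n, i) (not_lt.1 hi), dist_self]
    exact hε
  simp [h1, h2]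

theorem summable_prod_of_le {G : Type*} [NormedAddCommGroup G] [CompleteSpace G]
    [IsUltrametricDist G] {g : ℕ × ℕ → G} {M : ℕ → ℝ} {s : ℕ → ℕ} (hM : Tendsto M atTop (𝓝 0))
    (hg : ∀ p, ‖g p‖ ≤ M p.1) (hs : ∀ p, s p.1 ≤ p.2 → g p = 0) : Summable g := by
  have : NonarchimedeanAddGroup G := IsUltrametricDist.nonarchimedeanAddGroup
  exact NonarchimedeanAddGroup.summable_of_tendsto_cofinite_zero
    (tendsto_cofinite_prod_of_le hM hg hs)

theorem PTensor.exists_sum_of_mem_sums {E F : Type*} [SeminormedAddCommGroup E] [NormedSpace k E]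
    [SeminormedAddCommGroup F] [NormedSpace k F] {M : ℝ} {z : PTensor k E F}
    (hz : z ∈ sums k E F M) : ∃ (n : ℕ) (a : ℕ → E) (b : ℕ → F),
      (∀ i < n, ‖a i‖ * ‖b i‖ ≤ M) ∧ z = ∑ i ∈ Finset.range n, mk (a i) (b i) := by
  induction hz using AddSubmonoid.closure_induction with
  | mem z hz =>
    obtain ⟨a, b, hab, rfl⟩ := hz
    exact ⟨1, fun _ => a, fun _ => b, fun _ _ => hab, by simp⟩
  | zero => exact ⟨0, fun _ => 0, fun _ => 0, by simp, by simp⟩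
  | add x y _ _ hx hy =>
    obtain ⟨n, a, b, hab, rfl⟩ := hx
    obtain ⟨m, a', b', hab', rfl⟩ := hy
    refine ⟨n + m, fun i => if i < n then a i else a' (i - n),
      fun i => if i < n then b i else b' (i - n), fun i hi => ?_, ?_⟩
    · by_cases h : i < n
      · simpa [h] using hab i h
      · simpa [h] using hab' (i - n) (by omega)
    · rw [Finset.sum_range_add]
      congr 1
      · exact Finset.sum_congr rfl fun i hi => by simp [Finset.mem_range.1 hi]
      · exact Finset.sum_congr rfl fun i hi => by simp

/-- Every element of the completed tensor product is a convergent series of pure tensors. -/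
theorem CTensor.exists_hasSum {E F : Type*} [SeminormedAddCommGroup E] [NormedSpace k E]
    [SeminormedAddCommGroup F] [NormedSpace k F] (z : CTensor k E F) :
    ∃ (a : ℕ → E) (b : ℕ → F), Tendsto (fun j => ‖a j‖ * ‖b j‖) atTop (𝓝 0) ∧
      HasSum (fun j => (tmul (a j) (b j) : CTensor k E F)) z := by
  have hd : ∀ n : ℕ, ∃ u : PTensor k E F, ‖z - ofAlg u‖ < (1 / 2 : ℝ) ^ n := fun n => by
    obtain ⟨u, hu⟩ := denseRange_ofAlg.exists_dist_lt z (ε := (1 / 2 : ℝ) ^ n) (by positivity)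
    exact ⟨u, by rwa [dist_eq_norm] at hu⟩
  choose u hu using hd
  -- Two consecutive approximations differ by less than (1/2)^n + (1/2)^(n+1), hence by less than
  -- twice (1/2)^n. The strict inequality is what permits a representation by tensors of that size.
  have hw : ∀ n : ℕ, u (n + 1) - u n ∈ PTensor.sums k E F (2 * (1 / 2 : ℝ) ^ n) := fun n => by
    refine PTensor.mem_sums_of_lt ?_
    rw [← PTensor.norm_def, ← norm_ofAlg, map_sub,
      show (ofAlg (u (n + 1)) - ofAlg (u n) : CTensor k E F) =
        (z - ofAlg (u n)) - (z - ofAlg (u (n + 1))) by abel]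
    have h1 := hu n
    have h2 := hu (n + 1)
    have h3 : (1 / 2 : ℝ) ^ (n + 1) < (1 / 2 : ℝ) ^ n := by
      rw [pow_succ]; have : (0 : ℝ) < (1 / 2) ^ n := by positivity
      linarith
    refine (norm_sub_le _ _).trans_lt ?_
    linarith
  obtain ⟨M₀, hM0, hM⟩ := PTensor.exists_mem_sums (u 0)
  let w : ℕ → PTensor k E F := fun n => n.rec (u 0) fun n _ => u (n + 1) - u n
  let M : ℕ → ℝ := fun n => n.rec M₀ fun n _ => 2 * (1 / 2 : ℝ) ^ n
  have hMt : Tendsto M atTop (𝓝 0) := by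
    rw [← tendsto_add_atTop_iff_nat 1]
    have := (tendsto_pow_atTop_nhds_zero_of_lt_one (r := (1 / 2 : ℝ)) (by norm_num)
      (by norm_num)).const_mul 2
    rwa [mul_zero] at this
  have hM0' : ∀ n, 0 ≤ M n := fun n => by cases n with
    | zero => exact hM0
    | succ n => change (0 : ℝ) ≤ 2 * (1 / 2) ^ n; positivity
  have hwM : ∀ n, w n ∈ PTensor.sums k E F (M n) := fun n => by
    cases n with
    | zero => exact hM
    | succ n => exact hw n
  choose s a b hab hsum using fun n => PTensor.exists_sum_of_mem_sums (hwM n)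
  -- The representation of the n-th difference uses only the first `s n` entries. The rest of the
  -- row is set to zero so that the rows form one double series.
  let A : ℕ × ℕ → E := fun p => if p.2 < s p.1 then a p.1 p.2 else 0
  have hA : ∀ p, ‖A p‖ * ‖b p.1 p.2‖ ≤ M p.1 := fun p => by
    by_cases h : p.2 < s p.1
    · simpa [A, h] using hab p.1 p.2 h
    · simpa [A, h] using hM0' p.1
  have hA0 : ∀ p, s p.1 ≤ p.2 → A p = 0 := fun p hp => by simp [A, not_lt.2 hp]
  have hT : Summable fun p : ℕ × ℕ => (tmul (A p) (b p.1 p.2) : CTensor k E F) :=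
    summable_prod_of_le hMt (fun p => (norm_tmul_le _ _).trans (hA p)) (s := s) fun p hp => by
      rw [hA0 p hp]; simp
  have hfib : ∀ n, HasSum (fun i => (tmul (A (n, i)) (b n i) : CTensor k E F)) (ofAlg (w n)) := by
    intro n
    have : ofAlg (w n) = ∑ i ∈ Finset.range (s n), (tmul (A (n, i)) (b n i) : CTensor k E F) := by
      rw [hsum n, map_sum]
      refine Finset.sum_congr rfl fun i hi => ?_
      simp only [A, Finset.mem_range.1 hi, if_true]
      rfl
    rw [this]
    refine hasSum_sum_of_ne_finset_zero fun i hi => ?_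
    rw [hA0 (n, i) (by simpa using hi)]; simp
  have hz : HasSum (fun p : ℕ × ℕ => (tmul (A p) (b p.1 p.2) : CTensor k E F)) z := by
    have h1 := hT.hasSum.prod_fiberwise hfib
    convert hT.hasSum
    refine tendsto_nhds_unique ?_ h1.tendsto_sum_nat
    have h2 : ∀ n, ∑ i ∈ Finset.range (n + 1), (ofAlg (w i) : CTensor k E F) = ofAlg (u n) := by
      intro n
      induction n with
      | zero => simp [w]
      | succ n ih => rw [Finset.sum_range_succ, ih, ← map_add]; simp [w]
    rw [← tendsto_add_atTop_iff_nat 1]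
    simp only [h2]
    rw [tendsto_iff_norm_sub_tendsto_zero]
    refine squeeze_zero (fun _ => norm_nonneg _) (fun n => ?_)
      (tendsto_pow_atTop_nhds_zero_of_lt_one (r := (1 / 2 : ℝ)) (by norm_num) (by norm_num))
    rw [norm_sub_rev]
    exact (hu n).le
  obtain ⟨ε⟩ : Nonempty (ℕ ≃ ℕ × ℕ) := ⟨Nat.pairEquiv.symm⟩
  refine ⟨fun j => A (ε j), fun j => b (ε j).1 (ε j).2, ?_, ?_⟩
  · have h1 : Tendsto (fun p : ℕ × ℕ => ‖A p‖ * ‖b p.1 p.2‖) cofinite (𝓝 0) :=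
      tendsto_cofinite_prod_of_le hMt (fun p => by
        rw [Real.norm_of_nonneg (by positivity)]; exact hA p) (s := s) fun p hp => by
        rw [hA0 p hp, norm_zero, zero_mul]
    rw [← Nat.cofinite_eq_atTop]
    exact h1.comp ε.injective.tendsto_cofinite
  · exact ε.hasSum_iff.2 hz

/-- If x lies outside D, its positive distance δ to D bounds the coefficient of x in d + l x by ‖d +
l x‖ / δ. So D × k embeds antilipschitz and has complete image. No element of norm different from 0
and 1 is needed in k, so the trivial valuation is covered. -/
theorem isComplete_sup_span [CompleteSpace k] {E : Type*} [NormedAddCommGroup E] [NormedSpace k E]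
    {D : Submodule k E} (hD : IsComplete (D : Set E)) (x : E) :
    IsComplete ((D ⊔ k ∙ x : Submodule k E) : Set E) := by
  by_cases hx : x ∈ D
  · rwa [sup_eq_left.2 ((Submodule.span_singleton_le_iff_mem x D).2 hx)]
  have hcl : IsClosed (D : Set E) := hD.isClosed
  have hδ : 0 < Metric.infDist x (D : Set E) :=
    (hcl.notMem_iff_infDist_pos ⟨0, D.zero_mem⟩).1 hx
  set δ := Metric.infDist x (D : Set E)
  have : CompleteSpace D := completeSpace_coe_iff_isComplete.2 hD
  have hbd : ∀ (d : D) (l : k), ‖l‖ * δ ≤ ‖(d : E) + l • x‖ := fun d l => by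
    by_cases hl : l = 0
    · simp [hl]
    have h1 : δ ≤ dist x (-(l⁻¹ • (d : E))) :=
      Metric.infDist_le_dist_of_mem (D.neg_mem (D.smul_mem _ d.2))
    calc ‖l‖ * δ ≤ ‖l‖ * ‖x + l⁻¹ • (d : E)‖ := by
          rw [dist_eq_norm, sub_neg_eq_add] at h1; gcongr
      _ = _ := by rw [← norm_smul, smul_add, smul_smul, mul_inv_cancel₀ hl, one_smul, add_comm]
  let f : D × k →ₗ[k] E := D.subtype.coprod (LinearMap.toSpanSingleton k E x)
  have hf : ∀ p : D × k, f p = (p.1 : E) + p.2 • x := fun p => by simp [f]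
  have hrange : Set.range f = ((D ⊔ k ∙ x : Submodule k E) : Set E) := by
    rw [← LinearMap.coe_range, LinearMap.range_coprod, Submodule.range_subtype,
      LinearMap.range_toSpanSingleton]
  have hδ' : 0 ≤ δ⁻¹ := by positivity
  have hanti : AntilipschitzWith (Real.toNNReal (1 + δ⁻¹ * (‖x‖ + 1))) f := by
    refine AddMonoidHomClass.antilipschitz_of_bound f fun p => ?_
    rw [Real.coe_toNNReal _ (by positivity), hf]
    have h1 : ‖p.2‖ ≤ δ⁻¹ * ‖(p.1 : E) + p.2 • x‖ := by
      rw [inv_mul_eq_div, le_div_iff₀ hδ]; exact hbd _ _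
    have h2 : ‖(p.1 : E)‖ ≤ ‖(p.1 : E) + p.2 • x‖ + ‖p.2‖ * ‖x‖ := by
      have := norm_sub_le ((p.1 : E) + p.2 • x) (p.2 • x)
      rwa [add_sub_cancel_right, norm_smul] at this
    have h3 := mul_le_mul_of_nonneg_right h1 (norm_nonneg x)
    have h4 := norm_nonneg ((p.1 : E) + p.2 • x)
    have h5 := mul_nonneg hδ' h4
    have h6 := mul_nonneg h5 (norm_nonneg x)
    rw [Prod.norm_def]
    refine max_le ?_ ?_
    · change ‖(p.1 : E)‖ ≤ _
      nlinarith
    · nlinarith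
  have huc : UniformContinuous f := by
    refine AddMonoidHomClass.uniformContinuous_of_bound f (1 + ‖x‖) fun p => ?_
    rw [hf]
    refine (norm_add_le _ _).trans ?_
    rw [norm_smul, add_mul, one_mul, mul_comm ‖x‖]
    exact add_le_add (norm_fst_le p) (mul_le_mul_of_nonneg_right (norm_snd_le p) (norm_nonneg x))
  rw [← hrange]
  exact hanti.isComplete_range huc

theorem isComplete_span_image [CompleteSpace k] {E : Type*} [NormedAddCommGroup E]
    [NormedSpace k E] (a : ℕ → E) (n : ℕ) :
    IsComplete (Submodule.span k (a '' Set.Iio n) : Set E) := by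
  induction n with
  | zero => simpa using (isCompact_singleton (x := (0 : E))).isComplete
  | succ n ih =>
    have : Set.Iio (n + 1) = insert n (Set.Iio n) := by ext; simp
    rw [this, Set.image_insert_eq, Submodule.span_insert, sup_comm]
    exact isComplete_sup_span ih _

/-- The distance from x to D need not be attained, so exact orthogonality to D is out of reach. A d
in D within the factor C of the distance gives e = x - d. For x in D the witness is e = 0. -/
theorem exists_almost_orthogonal [CompleteSpace k] {E : Type*} [NormedAddCommGroup E]
    [NormedSpace k E] {D : Submodule k E} (hD : IsClosed (D : Set E)) (x : E) {C : ℝ}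
    (hC : 1 < C) : ∃ e : E, x - e ∈ D ∧ ∀ d ∈ D, ‖e‖ ≤ C * ‖e + d‖ := by
  by_cases hx : x ∈ D
  · exact ⟨0, by simpa, fun d _ => by simp; positivity⟩
  have hδ : 0 < Metric.infDist x (D : Set E) :=
    (hD.notMem_iff_infDist_pos ⟨0, D.zero_mem⟩).1 hx
  obtain ⟨d, hd, hxd⟩ := (Metric.infDist_lt_iff (r := C * Metric.infDist x (D : Set E))
    ⟨0, D.zero_mem⟩).1 (by nlinarith)
  refine ⟨x - d, by simpa using hd, fun d' hd' => ?_⟩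
  rw [dist_eq_norm] at hxd
  refine hxd.le.trans (mul_le_mul_of_nonneg_left ?_ (by positivity))
  have := Metric.infDist_le_dist_of_mem (x := x) (D.sub_mem hd hd')
  rwa [dist_eq_norm, show x - (d - d') = x - d + d' by abel] at this

/-- Gram–Schmidt orthogonalization in a non-Archimedean normed space, up to the factor `2`. -/
theorem exists_orthogonalization [CompleteSpace k] {E : Type*} [NormedAddCommGroup E]
    [NormedSpace k E] [IsUltrametricDist E] (a : ℕ → E) :
    ∃ (e : ℕ → E) (α : ℕ → ℕ → k),
      (∀ j, a j = ∑ i ∈ Finset.range (j + 1), α j i • e i) ∧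
      ∀ (n : ℕ) (l : ℕ → k), ∀ i < n, ‖l i • e i‖ ≤ 2 * ‖∑ i ∈ Finset.range n, l i • e i‖ := by
  -- The n-th vector is orthogonalized up to the factor K(n+1) / K(n) > 1. These factors telescope,
  -- so the constant for the first n vectors is K(n), which never exceeds 2.
  let K : ℕ → ℝ := fun n => 2 - (1 / 2) ^ n
  have hp : ∀ n : ℕ, (0 : ℝ) < (1 / 2) ^ n ∧ ((1 : ℝ) / 2) ^ n ≤ 1 := fun n =>
    ⟨by positivity, pow_le_one₀ (by norm_num) (by norm_num)⟩
  have hK1 : ∀ n, 1 ≤ K n := fun n => by have := hp n; simp only [K]; linarith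
  have hK2 : ∀ n, K n ≤ 2 := fun n => by have := hp n; simp only [K]; linarith
  have hKs : ∀ n, K n < K (n + 1) := fun n => by
    have := hp n; simp only [K, pow_succ]; linarith
  choose e he1 he2 using fun n => exists_almost_orthogonal (k := k)
    (isComplete_span_image a n).isClosed (a n) (C := K (n + 1) / K n)
    ((one_lt_div (by linarith [hK1 n])).2 (hKs n))
  have hspan : ∀ n, Submodule.span k (e '' Set.Iio n) = Submodule.span k (a '' Set.Iio n) := by
    intro n
    induction n with
    | zero => simp
    | succ n ih =>
      have hI : Set.Iio (n + 1) = insert n (Set.Iio n) := by ext; simp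
      rw [hI, Set.image_insert_eq, Set.image_insert_eq, Submodule.span_insert,
        Submodule.span_insert, ih]
      have h1 := he1 n
      refine le_antisymm (sup_le ?_ le_sup_right) (sup_le ?_ le_sup_right)
      · rw [Submodule.span_singleton_le_iff_mem, ← sub_sub_cancel (a n) (e n)]
        exact sub_mem (Submodule.mem_sup_left (Submodule.mem_span_singleton_self _))
          (Submodule.mem_sup_right h1)
      · rw [Submodule.span_singleton_le_iff_mem, ← sub_add_cancel (a n) (e n)]
        exact add_mem (Submodule.mem_sup_right h1)
          (Submodule.mem_sup_left (Submodule.mem_span_singleton_self _))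
  have hmem : ∀ n (l : ℕ → k), ∑ i ∈ Finset.range n, l i • e i ∈
      Submodule.span k (a '' Set.Iio n) := fun n l => by
    rw [← hspan]
    exact sum_mem fun i hi => Submodule.smul_mem _ _
      (Submodule.subset_span ⟨i, by simpa using hi, rfl⟩)
  have hco : ∀ j, ∃ α : ℕ → k, a j = ∑ i ∈ Finset.range (j + 1), α i • e i := fun j => by
    have : a j ∈ Submodule.span k (e '' (Finset.range (j + 1) : Set ℕ)) := by
      rw [Finset.coe_range, hspan]
      exact Submodule.subset_span ⟨j, by simp, rfl⟩
    obtain ⟨α, hα⟩ := (Submodule.mem_span_image_finset_iff_exists_fun' k).1 this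
    exact ⟨α, hα.symm⟩
  choose α hα using hco
  refine ⟨e, α, hα, ?_⟩
  have key : ∀ (n : ℕ) (l : ℕ → k), ∀ i < n,
      ‖l i • e i‖ ≤ K n * ‖∑ i ∈ Finset.range n, l i • e i‖ := by
    intro n l
    induction n with
    | zero => intro i hi; omega
    | succ n ih =>
      intro i hi
      set x' := ∑ i ∈ Finset.range n, l i • e i with hx'
      have hC1 : 1 ≤ K (n + 1) / K n := (one_le_div (by linarith [hK1 n])).2 (hKs n).le
      -- Dividing by the last coefficient reduces this to the almost orthogonality of e_n to the
      -- span of its predecessors. The partial sum x' is then controlled by the ultrametric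
      -- inequality.
      have hlast : ‖l n • e n‖ ≤ K (n + 1) / K n * ‖x' + l n • e n‖ := by
        by_cases hl : l n = 0
        · simp only [hl, zero_smul, norm_zero]
          have := norm_nonneg (x' + 0)
          positivity
        have h1 := he2 n ((l n)⁻¹ • x') (Submodule.smul_mem _ _ (hmem n l))
        have h2 := mul_le_mul_of_nonneg_left h1 (norm_nonneg (l n))
        rw [norm_smul]
        refine h2.trans (le_of_eq ?_)
        rw [mul_left_comm, ← norm_smul, smul_add, smul_smul, mul_inv_cancel₀ hl, one_smul,
          add_comm x']
      have hx'n : ‖x'‖ ≤ K (n + 1) / K n * ‖x' + l n • e n‖ := by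
        have h1 := IsUltrametricDist.norm_add_le_max (x' + l n • e n) (-(l n • e n))
        rw [add_neg_cancel_right, norm_neg] at h1
        refine h1.trans (max_le ?_ hlast)
        exact le_mul_of_one_le_left (norm_nonneg _) hC1
      have hKn : K (n + 1) / K n ≤ K (n + 1) :=
        div_le_self (by linarith [hK1 (n + 1)]) (hK1 n)
      rw [Finset.sum_range_succ]
      rcases Nat.lt_succ_iff_lt_or_eq.1 hi with h | rfl
      · refine (ih i h).trans ?_
        refine (mul_le_mul_of_nonneg_left hx'n (by linarith [hK1 n])).trans (le_of_eq ?_)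
        rw [← mul_assoc, mul_div_cancel₀ _ (by linarith [hK1 n])]
      · exact hlast.trans (mul_le_mul_of_nonneg_right hKn (norm_nonneg _))
  exact fun n l i hi => (key n l i hi).trans
    (mul_le_mul_of_nonneg_right (hK2 n) (norm_nonneg _))

/-- Interchange of summation in a triangular double series. It rewrites a series of tensors in terms
of an almost orthogonal system, where every row is finite but the columns are infinite. -/
theorem hasSum_of_triangular {F G : Type*} [NormedAddCommGroup F] [NormedSpace k F]
    [NormedAddCommGroup G] [NormedSpace k G] [CompleteSpace G] [IsUltrametricDist G]
    {θ : ℕ → BMap k F G} {β : ℕ → ℕ → F} {f : ℕ → F} {M : ℕ → ℝ} {x : G}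
    (hM : Tendsto M atTop (𝓝 0)) (hb : ∀ j i, ‖θ i (β j i)‖ ≤ M j)
    (h0 : ∀ j i, j < i → β j i = 0) (hf : ∀ i, HasSum (fun j => β j i) (f i))
    (hx : HasSum (fun j => ∑ i ∈ Finset.range (j + 1), θ i (β j i)) x) :
    HasSum (fun i => θ i (f i)) x := by
  have hs : Summable fun p : ℕ × ℕ => θ p.2 (β p.1 p.2) :=
    summable_prod_of_le hM (fun p => hb p.1 p.2) (s := fun j => j + 1) fun p hp => by
      rw [h0 _ _ hp, map_zero]
  have h1 := hs.hasSum.prod_fiberwise fun j => hasSum_sum_of_ne_finset_zero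
    (s := Finset.range (j + 1)) fun i hi => by
      rw [h0 j i (by simpa using hi), map_zero]
  rw [hx.unique h1]
  exact ((Equiv.prodComm ℕ ℕ).hasSum_iff.2 hs.hasSum).prod_fiberwise fun i =>
    (hf i).map (θ i) (θ i).continuous

/-- The contraction of the second tensor factor with a bounded functional. -/
def CTensor.contract (E : Type*) {F : Type*} [NormedAddCommGroup E] [NormedSpace k E]
    [CompleteSpace E] [IsUltrametricDist E] [SeminormedAddCommGroup F] [NormedSpace k F]
    (ψ : BMap k F k) : BMap k (CTensor k E F) E :=
  lift ((LinearMap.lsmul k E).flip.compl₂ ψ.lin) (by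
    obtain ⟨C, -, hC⟩ := ψ.exists_normLE
    refine ⟨C, fun a b => ?_⟩
    rw [LinearMap.compl₂_apply, LinearMap.flip_apply, LinearMap.lsmul_apply, norm_smul]
    refine (mul_le_mul_of_nonneg_right (hC b) (norm_nonneg a)).trans (le_of_eq (by ring)))

@[simp] theorem CTensor.contract_tmul {E F : Type*} [NormedAddCommGroup E] [NormedSpace k E]
    [CompleteSpace E] [IsUltrametricDist E] [SeminormedAddCommGroup F] [NormedSpace k F]
    (ψ : BMap k F k) (x : E) (y : F) : contract E ψ (tmul x y) = ψ y • x := lift_tmul _ _ x y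

/-- The contractions with a family of functionals that separates the points of `F` separate the
points of `E ⊗ F`. -/
theorem CTensor.eq_zero_of_contract [CompleteSpace k] {E F ι : Type*}
    [NormedAddCommGroup E] [NormedSpace k E] [CompleteSpace E] [IsUltrametricDist E]
    [NormedAddCommGroup F] [NormedSpace k F] [CompleteSpace F] [IsUltrametricDist F]
    {ψ : ι → BMap k F k} (hψ : ∀ y, (∀ i, ψ i y = 0) → y = 0) {z : CTensor k E F}
    (hz : ∀ i, contract E (ψ i) z = 0) : z = 0 := by
  -- The plan is to rewrite z = ∑ a_j ⊗ b_j as ∑ e_i ⊗ f_i with almost orthogonal e_i. A contraction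
  -- of z is then ∑ ψ(f_i) e_i, and its vanishing kills every term separately. No extension theorem
  -- for functionals is involved.
  obtain ⟨a, b, hab, hs⟩ := exists_hasSum z
  obtain ⟨e, α, hα, ho⟩ := exists_orthogonalization (k := k) a
  classical
  -- Some e_i can be zero, and their coefficients are arbitrary. Discarding these makes ‖α' j i‖ ≤ 2
  -- ‖a_j‖ / ‖e_i‖ usable, and this is what makes the column sums f_i converge.
  let α' : ℕ → ℕ → k := fun j i => if i ≤ j ∧ e i ≠ 0 then α j i else 0
  have ha : ∀ j, a j = ∑ i ∈ Finset.range (j + 1), α' j i • e i := fun j => by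
    rw [hα j]
    refine Finset.sum_congr rfl fun i hi => ?_
    by_cases h : e i = 0
    · simp [h]
    · simp [α', h, Nat.lt_succ_iff.1 (Finset.mem_range.1 hi)]
  have hbound : ∀ j i, ‖α' j i‖ * ‖e i‖ ≤ 2 * ‖a j‖ := fun j i => by
    by_cases h : i ≤ j
    · rw [← norm_smul, ha j]
      exact ho (j + 1) (α' j) i (by omega)
    · simp [α', h]
  have hab2 : Tendsto (fun j => 2 * (‖a j‖ * ‖b j‖)) atTop (𝓝 0) := by
    simpa using hab.const_mul 2
  have h0 : ∀ j i, j < i → α' j i • b j = 0 := fun j i hij => by simp [α', not_le.2 hij]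
  have hf : ∀ i, Summable fun j => α' j i • b j := fun i => by
    have : NonarchimedeanAddGroup F := IsUltrametricDist.nonarchimedeanAddGroup
    refine NonarchimedeanAddGroup.summable_of_tendsto_cofinite_zero ?_
    rw [Nat.cofinite_eq_atTop]
    refine squeeze_zero_norm (fun j => ?_) (by simpa using hab2.mul_const ‖e i‖⁻¹)
    by_cases h : e i = 0
    · simp [α', h]
    · rw [norm_smul, ← div_eq_mul_inv, le_div_iff₀ (norm_pos_iff.2 h)]
      have := mul_le_mul_of_nonneg_right (hbound j i) (norm_nonneg (b j))
      linarith
  set f : ℕ → F := fun i => ∑' j, α' j i • b j with hfdef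
  have hf0 : ∀ i, f i = 0 := fun i => by
    by_cases h : e i = 0
    · simp [hfdef, α', h]
    refine hψ _ fun t => ?_
    obtain ⟨C, hC0, hC⟩ := (ψ t).exists_normLE
    have hsum : HasSum (fun i => (⟨(LinearMap.toSpanSingleton k E (e i)) ∘ₗ (ψ t).lin,
        C * ‖e i‖, fun y => by
          rw [LinearMap.comp_apply, LinearMap.toSpanSingleton_apply, norm_smul]
          exact (mul_le_mul_of_nonneg_right (hC y) (norm_nonneg _)).trans
            (le_of_eq (by ring))⟩ : BMap k F E) (f i)) 0 := by
      refine hasSum_of_triangular (M := fun j => C * (2 * (‖a j‖ * ‖b j‖))) (by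
        simpa using hab2.const_mul C) (fun j i => ?_) h0 (fun i => (hf i).hasSum) ?_
      · rw [BMap.mk_apply, LinearMap.comp_apply, LinearMap.toSpanSingleton_apply, norm_smul]
        refine (mul_le_mul_of_nonneg_right (hC _) (norm_nonneg _)).trans ?_
        rw [norm_smul]
        have := mul_le_mul_of_nonneg_right (hbound j i) (norm_nonneg (b j))
        have := mul_le_mul_of_nonneg_left this hC0
        linarith
      · have := hs.map (contract E (ψ t)) (contract E (ψ t)).continuous
        rw [hz t] at this
        convert this using 2 with j
        rw [Function.comp_apply, contract_tmul, ha j, Finset.smul_sum]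
        refine Finset.sum_congr rfl fun i _ => ?_
        rw [BMap.mk_apply, LinearMap.comp_apply, LinearMap.toSpanSingleton_apply, BMap.coe_lin,
          map_smul, smul_smul, smul_eq_mul, mul_comm]
    -- Almost orthogonality bounds each fixed term by twice the later partial sums, and those tend
    -- to zero.
    have hlim : Tendsto (fun n => 2 * ‖∑ i ∈ Finset.range n, ψ t (f i) • e i‖) atTop (𝓝 0) := by
      simpa using hsum.tendsto_sum_nat.norm.const_mul 2
    have hle : ‖ψ t (f i) • e i‖ ≤ 0 := ge_of_tendsto hlim
      (eventually_atTop.2 ⟨i + 1, fun n hn => ho n (fun i => ψ t (f i)) i (by omega)⟩)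
    exact (smul_eq_zero.1 (norm_le_zero_iff.1 hle)).resolve_right h
  have hsum : HasSum (fun i => (⟨tmul (e i), ‖e i‖, norm_tmul_le (e i)⟩ :
      BMap k F (CTensor k E F)) (f i)) z := by
    refine hasSum_of_triangular hab2 (fun j i => ?_) h0 (fun i => (hf i).hasSum) ?_
    · refine (norm_tmul_le _ _).trans ?_
      rw [norm_smul]
      have := mul_le_mul_of_nonneg_right (hbound j i) (norm_nonneg (b j))
      linarith
    · convert hs using 2 with j
      rw [ha j, map_sum, LinearMap.sum_apply]
      exact Finset.sum_congr rfl fun i _ => by simp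
  refine hsum.unique ?_
  simp only [hf0, map_zero]
  exact hasSum_zero

/-- Products of functionals from two separating families separate the points of `E ⊗ F`. -/
theorem CTensor.eq_zero_of_map [CompleteSpace k] [IsUltrametricDist k] {E F ι κ : Type*}
    [NormedAddCommGroup E] [NormedSpace k E] [CompleteSpace E] [IsUltrametricDist E]
    [NormedAddCommGroup F] [NormedSpace k F] [CompleteSpace F] [IsUltrametricDist F]
    {φ : κ → BMap k E k} (hφ : ∀ x, (∀ i, φ i x = 0) → x = 0)
    {ψ : ι → BMap k F k} (hψ : ∀ y, (∀ i, ψ i y = 0) → y = 0) {z : CTensor k E F}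
    (hz : ∀ i j, smulMap (map (φ i) (ψ j) z) = 0) : z = 0 := by
  refine eq_zero_of_contract hψ fun j => hφ _ fun i => ?_
  rw [← hz i j]
  have : (φ i).comp (contract E (ψ j)) = smulMap.comp (map (φ i) (ψ j)) :=
    hom_ext fun x y => by simp [mul_comm]
  exact congrArg (fun f : BMap k (CTensor k E F) k => f z) this

end separation

/-! ### Quotients -/

section quotient

variable {k : Type*} [NormedField k] {E F G : Type*}
  [SeminormedAddCommGroup E] [NormedSpace k E]
  [SeminormedAddCommGroup F] [NormedSpace k F]
  {I : Submodule k E} {J : Submodule k F}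

theorem BMap.quot_surjective (I : Submodule k E) : Function.Surjective (BMap.quot I) :=
  I.mkQ_surjective

theorem BMap.quot_eq_zero {x : E} : BMap.quot I x = 0 ↔ x ∈ I :=
  Submodule.Quotient.mk_eq_zero I

theorem BMap.exists_quot_lt (x : E ⧸ I) {ε : ℝ} (hε : 0 < ε) :
    ∃ a, BMap.quot I a = x ∧ ‖a‖ < ‖x‖ + ε :=
  Submodule.Quotient.norm_mk_lt x hε

instance Submodule.Quotient.isUltrametricDist [IsUltrametricDist E] :
    IsUltrametricDist (E ⧸ I) := by
  refine IsUltrametricDist.isUltrametricDist_of_forall_norm_add_le_max_norm fun x y => ?_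
  refine le_of_forall_pos_le_add fun ε hε => ?_
  obtain ⟨a, rfl, ha⟩ := BMap.exists_quot_lt x hε
  obtain ⟨b, rfl, hb⟩ := BMap.exists_quot_lt y hε
  rw [← map_add, ← max_add_add_right]
  exact (Submodule.Quotient.norm_mk_le I (a + b)).trans
    ((IsUltrametricDist.norm_add_le_max a b).trans (max_le_max ha.le hb.le))

theorem exists_mul_quot_lt (x : E ⧸ I) (y : F ⧸ J) {M : ℝ} (h : ‖x‖ * ‖y‖ < M) :
    ∃ a b, BMap.quot I a = x ∧ BMap.quot J b = y ∧ ‖a‖ * ‖b‖ < M := by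
  have hc : Tendsto (fun ε : ℝ => (‖x‖ + ε) * (‖y‖ + ε)) (𝓝[>] 0) (𝓝 (‖x‖ * ‖y‖)) := by
    have : ContinuousAt (fun ε : ℝ => (‖x‖ + ε) * (‖y‖ + ε)) 0 := by fun_prop
    have h2 := this.tendsto
    simp only [add_zero] at h2
    exact h2.mono_left nhdsWithin_le_nhds
  obtain ⟨ε, hε, hε0⟩ := ((hc.eventually_lt_const h).and self_mem_nhdsWithin).exists
  obtain ⟨a, rfl, ha⟩ := BMap.exists_quot_lt x hε0
  obtain ⟨b, rfl, hb⟩ := BMap.exists_quot_lt y hε0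
  exact ⟨a, b, rfl, rfl, (mul_le_mul ha.le hb.le (norm_nonneg _)
    ((norm_nonneg a).trans ha.le)).trans_lt hε⟩

variable (I J) in
/-- The projection of the algebraic tensor product onto that of the quotients. -/
def PTensor.quotMap : PTensor k E F →ₗ[k] PTensor k (E ⧸ I) (F ⧸ J) :=
  TensorProduct.map I.mkQ J.mkQ

theorem PTensor.quotMap_mk (a : E) (b : F) :
    quotMap I J (mk a b) = mk (BMap.quot I a) (BMap.quot J b) :=
  TensorProduct.map_tmul _ _ a b

theorem CTensor.map_quot_ofAlg (u : PTensor k E F) :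
    map (BMap.quot I) (BMap.quot J) (ofAlg u) = ofAlg (PTensor.quotMap I J u) := by
  induction u using TensorProduct.induction_on with
  | zero => exact (map_zero _).trans (map_zero _).symm
  | tmul x y => exact map_tmul _ _ x y
  | add x y hx hy =>
    have h1 : (ofAlg (k := k) (x + y : PTensor k E F)) = ofAlg x + ofAlg y := map_add _ _ _
    have h2 : PTensor.quotMap I J (x + y) = PTensor.quotMap I J x + PTensor.quotMap I J y :=
      map_add _ _ _
    exact (congrArg _ h1).trans ((map_add _ _ _).trans ((congrArg₂ _ hx hy).trans
      ((map_add _ _ _).symm.trans (congrArg _ h2.symm))))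

theorem PTensor.exists_lift_sums {M M' : ℝ} (h : M < M') {w : PTensor k (E ⧸ I) (F ⧸ J)}
    (hw : w ∈ sums k (E ⧸ I) (F ⧸ J) M) : ∃ u ∈ sums k E F M', quotMap I J u = w := by
  induction hw using AddSubmonoid.closure_induction with
  | mem w hw =>
    obtain ⟨x, y, hxy, rfl⟩ := hw
    obtain ⟨a, b, rfl, rfl, hab⟩ := exists_mul_quot_lt x y (hxy.trans_lt h)
    exact ⟨mk a b, AddSubmonoid.subset_closure ⟨a, b, hab.le, rfl⟩, quotMap_mk a b⟩
  | zero => exact ⟨0, zero_mem _, map_zero _⟩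
  | add x y _ _ hx hy =>
    obtain ⟨u, hu, rfl⟩ := hx
    obtain ⟨v, hv, rfl⟩ := hy
    exact ⟨u + v, add_mem hu hv, map_add _ _ _⟩

variable (I J) in
/-- The span of the pure tensors with a factor in `I` or in `J`. -/
def CTensor.idealSpan : Submodule k (CTensor k E F) :=
  Submodule.span k {z | ∃ a b, (a ∈ I ∨ b ∈ J) ∧ z = tmul a b}

/-- Right exactness of the algebraic tensor product describes the kernel before completion. The
completed statement is deduced from this one by approximation. -/
theorem PTensor.ofAlg_mem_idealSpan {u : PTensor k E F} (hu : quotMap I J u = 0) :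
    CTensor.ofAlg u ∈ CTensor.idealSpan I J := by
  have hker := TensorProduct.map_ker (LinearMap.exact_subtype_mkQ I) I.mkQ_surjective
    (LinearMap.exact_subtype_mkQ J) J.mkQ_surjective
  have hle : LinearMap.ker (TensorProduct.map I.mkQ J.mkQ) ≤
      (CTensor.idealSpan I J).comap (CTensor.ofAlg : PTensor k E F →ₗ[k] CTensor k E F) := by
    rw [hker]
    refine sup_le ?_ ?_ <;> rintro _ ⟨t, rfl⟩
    · induction t using TensorProduct.induction_on with
      | zero => exact (map_zero (LinearMap.lTensor E J.subtype)).symm ▸ zero_mem _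
      | tmul x y => exact Submodule.subset_span ⟨x, y, Or.inr y.2, rfl⟩
      | add x y hx hy =>
        exact (map_add (LinearMap.lTensor E J.subtype) x y).symm ▸ add_mem hx hy
    · induction t using TensorProduct.induction_on with
      | zero => exact (map_zero (LinearMap.rTensor F I.subtype)).symm ▸ zero_mem _
      | tmul x y => exact Submodule.subset_span ⟨x, y, Or.inl x.2, rfl⟩
      | add x y hx hy =>
        exact (map_add (LinearMap.rTensor F I.subtype) x y).symm ▸ add_mem hx hy
  exact hle hu

/-- The kernel of `E ⊗ F → E / I ⊗ F / J` is the closure of `I ⊗ F + E ⊗ J`. -/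
theorem CTensor.mem_closure_of_map_quot {z : CTensor k E F}
    (hz : map (BMap.quot I) (BMap.quot J) z = 0) :
    z ∈ closure (idealSpan I J : Set (CTensor k E F)) := by
  rw [Metric.mem_closure_iff]
  intro ε hε
  obtain ⟨u, hu⟩ := denseRange_ofAlg.exists_dist_lt z (ε := ε / 4) (by positivity)
  rw [dist_eq_norm] at hu
  have h1 : ‖PTensor.quotMap I J u‖ < ε / 3 := by
    rw [← norm_ofAlg, ← map_quot_ofAlg, ← norm_neg, ← zero_sub, ← hz, ← map_sub]
    have := map_normLE_one (f := BMap.quot I) (g := BMap.quot J)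
      (fun x => by rw [one_mul]; exact Submodule.Quotient.norm_mk_le I x)
      (fun x => by rw [one_mul]; exact Submodule.Quotient.norm_mk_le J x) (z - ofAlg u)
    linarith
  -- The approximation u need not lie in the algebraic kernel, but its image is small because that
  -- of z is zero. Subtracting a small lift v of this image moves u into the kernel at little cost.
  obtain ⟨v, hv, hvu⟩ := PTensor.exists_lift_sums (show ε / 3 < ε / 2 by linarith)
    (PTensor.mem_sums_of_lt h1)
  refine ⟨ofAlg (u - v), PTensor.ofAlg_mem_idealSpan (by rw [map_sub, hvu, sub_self]), ?_⟩
  have h2 : ‖(ofAlg v : CTensor k E F)‖ ≤ ε / 2 := by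
    rw [norm_ofAlg]; exact PTensor.pnorm_le (by positivity) hv
  rw [dist_eq_norm, map_sub, show z - (ofAlg u - ofAlg v) = (z - ofAlg u) + ofAlg v by abel]
  refine (norm_add_le _ _).trans_lt ?_
  linarith

theorem CTensor.idealSpan_closure_le {G : Type*} [NormedAddCommGroup G] [NormedSpace k G]
    {f : BMap k (CTensor k E F) G} (hf : ∀ a b, a ∈ I ∨ b ∈ J → f (tmul a b) = 0)
    {z : CTensor k E F} (hz : z ∈ closure (idealSpan I J : Set (CTensor k E F))) : f z = 0 := by
  refine closure_minimal (t := {z | f z = 0}) ?_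
    (isClosed_eq f.continuous continuous_const) hz
  intro w hw
  have : idealSpan I J ≤ LinearMap.ker f.lin := by
    refine Submodule.span_le.2 ?_
    rintro _ ⟨a, b, hab, rfl⟩
    exact hf a b hab
  exact this hw

/-- A bounded map that vanishes on `I` descends to the quotient by `I`. -/
def BMap.descend [SeminormedAddCommGroup G] [NormedSpace k G] (f : BMap k E G)
    (hf : ∀ x ∈ I, f x = 0) : BMap k (E ⧸ I) G :=
  ⟨I.liftQ f.lin hf, by
    obtain ⟨C, hC0, hC⟩ := f.exists_normLE
    refine ⟨C, fun x => le_of_forall_pos_le_add fun ε hε => ?_⟩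
    obtain ⟨a, rfl, ha⟩ := BMap.exists_quot_lt x (ε := ε / (C + 1)) (by positivity)
    refine (hC a).trans ((mul_le_mul_of_nonneg_left ha.le hC0).trans ?_)
    rw [mul_add]
    gcongr
    rw [mul_div_assoc', div_le_iff₀ (by positivity)]
    nlinarith⟩

/-- A bounded map on `E ⊗ F` that vanishes on `I ⊗ F` and on `E ⊗ J` descends to the tensor
product of the quotients. -/
def CTensor.descend [NormedAddCommGroup G] [NormedSpace k G] [CompleteSpace G]
    [IsUltrametricDist G] (f : BMap k (CTensor k E F) G)
    (hf : ∀ a b, a ∈ I ∨ b ∈ J → f (tmul a b) = 0) : BMap k (CTensor k (E ⧸ I) (F ⧸ J)) G :=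
  lift (I.liftQ (J.liftQ (tmul.compr₂ f.lin).flip (fun b hb => LinearMap.ext fun a =>
      hf a b (Or.inr hb))).flip fun a ha => by
    refine LinearMap.ext fun y => ?_
    obtain ⟨b, rfl⟩ := J.mkQ_surjective y
    exact hf a b (Or.inl ha)) (by
    obtain ⟨C, hC0, hC⟩ := f.exists_normLE
    refine ⟨C, fun x y => le_of_forall_pos_le_add fun ε hε => ?_⟩
    have hε' : 0 < ε / (C + 1) := by positivity
    obtain ⟨a, b, rfl, rfl, hab⟩ := exists_mul_quot_lt x y (lt_add_of_pos_right _ hε')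
    refine (hC (tmul a b)).trans ?_
    refine (mul_le_mul_of_nonneg_left ((norm_tmul_le a b).trans hab.le) hC0).trans ?_
    rw [mul_add]
    gcongr
    rw [mul_div_assoc', div_le_iff₀ (by positivity)]
    nlinarith)

theorem CTensor.descend_tmul [NormedAddCommGroup G] [NormedSpace k G] [CompleteSpace G]
    [IsUltrametricDist G] (f : BMap k (CTensor k E F) G)
    (hf : ∀ a b, a ∈ I ∨ b ∈ J → f (tmul a b) = 0) (a : E) (b : F) :
    descend f hf (tmul (BMap.quot I a) (BMap.quot J b)) = f (tmul a b) :=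
  lift_tmul _ _ _ _

theorem CTensor.descend_comp [NormedAddCommGroup G] [NormedSpace k G] [CompleteSpace G]
    [IsUltrametricDist G] (f : BMap k (CTensor k E F) G)
    (hf : ∀ a b, a ∈ I ∨ b ∈ J → f (tmul a b) = 0) :
    (descend f hf).comp (map (BMap.quot I) (BMap.quot J)) = f :=
  hom_ext fun a b => by rw [BMap.comp_apply, map_tmul, descend_tmul]

end quotient

section zero

variable {k : Type*} [NormedField k] {E G : Type*} [SeminormedAddCommGroup E] [NormedSpace k E]
  [SeminormedAddCommGroup G] [NormedSpace k G]

instance : Zero (BMap k E G) := ⟨⟨0, 0, fun x => by simp⟩⟩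

@[simp] theorem BMap.zero_apply (x : E) : (0 : BMap k E G) x = 0 := rfl

end zero

/-! ### Contractive endomorphisms -/

section contractive

variable (k : Type*) [NormedField k]

/-- The ring of endomorphisms of norm at most `1` of a non-Archimedean space. -/
def End1 (E : Type*) [SeminormedAddCommGroup E] [NormedSpace k E] [IsUltrametricDist E] :
    Subring (Module.End k E) where
  carrier := {f | ∀ x, ‖f x‖ ≤ ‖x‖}
  one_mem' := fun x => le_rfl
  zero_mem' := fun x => by simp
  mul_mem' {f g} hf hg x := (hf (g x)).trans (hg x)
  add_mem' {f g} hf hg x :=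
    (IsUltrametricDist.norm_add_le_max _ _).trans (max_le (hf x) (hg x))
  neg_mem' {f} hf x := by rw [LinearMap.neg_apply, norm_neg]; exact hf x

variable {k} {E F G : Type*} [SeminormedAddCommGroup E] [NormedSpace k E] [IsUltrametricDist E]
  [SeminormedAddCommGroup F] [NormedSpace k F] [IsUltrametricDist F]
  [SeminormedAddCommGroup G] [NormedSpace k G]

namespace End1

/-- A contractive endomorphism as a bounded map. -/
def toB (f : End1 k E) : BMap k E E := ⟨f.1, 1, fun x => by rw [one_mul]; exact f.2 x⟩

@[simp] theorem toB_apply (f : End1 k E) (x : E) : toB f x = f.1 x := rfl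

theorem toB_normLE (f : End1 k E) : (toB f).NormLE 1 := fun x => by
  rw [one_mul]; exact f.2 x

/-- A bounded map of norm at most `1` as a contractive endomorphism. -/
def ofB (f : BMap k E E) (hf : f.NormLE 1) : End1 k E :=
  ⟨f.lin, fun x => by simpa using hf x⟩

@[simp] theorem ofB_apply (f : BMap k E E) (hf : f.NormLE 1) (x : E) : (ofB f hf).1 x = f x := rfl

theorem ext {f g : End1 k E} (h : toB f = toB g) : f = g :=
  Subtype.ext (congrArg BMap.lin h)

@[simp] theorem mul_apply (f g : End1 k E) (x : E) : (f * g).1 x = f.1 (g.1 x) := rfl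

@[simp] theorem add_apply (f g : End1 k E) (x : E) : (f + g).1 x = f.1 x + g.1 x := rfl

@[simp] theorem one_apply (x : E) : (1 : End1 k E).1 x = x := rfl

end End1

/-- `x ⊗ ·` as a bounded map. -/
def CTensor.tmulL (F : Type*) [SeminormedAddCommGroup F] [NormedSpace k F] (x : E) :
    BMap k F (CTensor k E F) := ⟨tmul x, ‖x‖, norm_tmul_le x⟩

/-- `· ⊗ y` as a bounded map. -/
def CTensor.tmulR (E : Type*) [SeminormedAddCommGroup E] [NormedSpace k E] (y : F) :
    BMap k E (CTensor k E F) :=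
  ⟨tmul.flip y, ‖y‖, fun x => by rw [mul_comm]; exact norm_tmul_le x y⟩

end contractive

/-! ### Identities between tensor maps, and c acting on the last two of several factors -/

section tensorLemmas

variable {k : Type*} [NormedField k] {E F G H W V : Type*}
  [SeminormedAddCommGroup E] [NormedSpace k E] [SeminormedAddCommGroup F] [NormedSpace k F]
  [NormedAddCommGroup G] [NormedSpace k G] [SeminormedAddCommGroup H] [NormedSpace k H]
  [SeminormedAddCommGroup W] [NormedSpace k W] [SeminormedAddCommGroup V] [NormedSpace k V]

namespace CTensor

@[simp] theorem tmulL_apply (x : E) (y : F) : tmulL (k := k) F x y = tmul x y := rfl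

@[simp] theorem tmulR_apply (x : E) (y : F) : tmulR (k := k) E y x = tmul x y := rfl

theorem assocInv_tmul_left (x : E) (z : CTensor k F H) :
    assocInv (tmul x z) = assocInvAux x z := lift_tmul _ _ _ _

theorem hom_ext_apply {f g : BMap k (CTensor k E F) G}
    (h : ∀ x y, f (tmul x y) = g (tmul x y)) (z : CTensor k E F) : f z = g z := by
  rw [hom_ext h]

theorem hom_ext₃ {f g : BMap k (CTensor k (CTensor k E F) H) G}
    (h : ∀ x y z, f (tmul (tmul x y) z) = g (tmul (tmul x y) z)) : f = g :=
  hom_ext fun t z => hom_ext_apply (f := f.comp (tmulR _ z)) (g := g.comp (tmulR _ z))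
    (fun x y => h x y z) t

theorem mid_tmul {E' F' G' : Type*} [SeminormedAddCommGroup E'] [NormedSpace k E']
    [SeminormedAddCommGroup F'] [NormedSpace k F'] [SeminormedAddCommGroup G'] [NormedSpace k G']
    (f : BMap k (CTensor k F E') (CTensor k F' G')) (x : E) (y : F) (z : E') (t : H) :
    mid f (tmul (tmul x y) (tmul z t) : CTensor k (CTensor k E F) (CTensor k E' H)) =
      map (tmulL F' x) (tmulR G' t) (f (tmul y z)) := by
  simp only [mid, BMap.comp_apply, assoc_tmul, map_tmul, BMap.id_apply, assocInv_tmul]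
  exact hom_ext_apply (f := assocInv.comp ((tmulL _ x).comp (assoc.comp (tmulR _ t))))
    (g := map (tmulL F' x) (tmulR G' t)) (fun p q => by simp) _

theorem map_comp {E' F' E'' F'' : Type*} [SeminormedAddCommGroup E'] [NormedSpace k E']
    [SeminormedAddCommGroup F'] [NormedSpace k F'] [SeminormedAddCommGroup E'']
    [NormedSpace k E''] [SeminormedAddCommGroup F''] [NormedSpace k F'']
    (f : BMap k E E') (g : BMap k F F') (f' : BMap k E' E'') (g' : BMap k F' F'')
    (z : CTensor k E F) : map f' g' (map f g z) = map (f'.comp f) (g'.comp g) z :=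
  hom_ext_apply (f := (map f' g').comp (map f g)) (fun x y => by simp) z

/-- The operator `Id ⊗ c` on `(W ⊗ V) ⊗ V`. -/
def lastTwo (W : Type*) [SeminormedAddCommGroup W] [NormedSpace k W]
    (c : BMap k (CTensor k V V) (CTensor k V V)) :
    BMap k (CTensor k (CTensor k W V) V) (CTensor k (CTensor k W V) V) :=
  assocInv.comp ((map (BMap.id k W) c).comp assoc)

@[simp] theorem lastTwo_tmul (c : BMap k (CTensor k V V) (CTensor k V V)) (x : W) (v w : V) :
    lastTwo W c (tmul (tmul x v) w) = assocInvAux x (c (tmul v w)) := by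
  simp [lastTwo, assocInv_tmul_left]

theorem lastTwo_normLE {c : BMap k (CTensor k V V) (CTensor k V V)} (hc : c.NormLE 1) :
    (lastTwo W c).NormLE 1 :=
  assocInv_normLE.comp_one ((map_normLE_one BMap.id_normLE hc).comp_one assoc_normLE)

theorem lastTwo_assocInvAux (c : BMap k (CTensor k V V) (CTensor k V V)) (x : W)
    (z : CTensor k V V) : lastTwo W c (assocInvAux x z) = assocInvAux x (c z) :=
  hom_ext_apply (f := (lastTwo W c).comp (assocInvAux x)) (g := (assocInvAux x).comp c)
    (fun v w => by simp) z

theorem lastTwo_map (c : BMap k (CTensor k V V) (CTensor k V V)) (f : BMap k W W)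
    (z : CTensor k (CTensor k W V) V) :
    lastTwo W c (map (map f (BMap.id k V)) (BMap.id k V) z) =
      map (map f (BMap.id k V)) (BMap.id k V) (lastTwo W c z) := by
  have : (lastTwo W c).comp (map (map f (BMap.id k V)) (BMap.id k V)) =
      (map (map f (BMap.id k V)) (BMap.id k V)).comp (lastTwo W c) := by
    refine hom_ext₃ fun x v w => ?_
    simp only [BMap.comp_apply, map_tmul, lastTwo_tmul, BMap.id_apply]
    exact hom_ext_apply (f := assocInvAux (f x))
      (g := (map (map f (BMap.id k V)) (BMap.id k V)).comp (assocInvAux x)) (fun p q => by simp) _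
  exact congrArg (fun g : BMap k _ _ => g z) this

/-- Both operators leave the W factor alone. For fixed x in W the map `j x` inserts x on the left of
V ⊗ V ⊗ V and carries `map c Id` and `lastTwo V c` to the operators `a` and `b`. The images of these
maps have dense span. -/
theorem lastTwo_braid {c : BMap k (CTensor k V V) (CTensor k V V)}
    (hb : (map c (BMap.id k V)).comp ((lastTwo V c).comp (map c (BMap.id k V))) =
      (lastTwo V c).comp ((map c (BMap.id k V)).comp (lastTwo V c)))
    (z : CTensor k (CTensor k (CTensor k W V) V) V) :
    map (lastTwo W c) (BMap.id k V) (lastTwo (CTensor k W V) c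
      (map (lastTwo W c) (BMap.id k V) z)) =
    lastTwo (CTensor k W V) c (map (lastTwo W c) (BMap.id k V) (lastTwo (CTensor k W V) c z)) := by
  set a := map (lastTwo W c) (BMap.id k V)
  set b := lastTwo (CTensor k W V) c
  let j : W → BMap k (CTensor k (CTensor k V V) V) (CTensor k (CTensor k (CTensor k W V) V) V) :=
    fun x => map (assocInvAux x) (BMap.id k V)
  have ha : ∀ x z, a (j x z) = j x (map c (BMap.id k V) z) := fun x z => by
    simp only [a, j, map_comp]
    congr 2
    exact hom_ext fun v w => by
      rw [BMap.comp_apply, BMap.comp_apply, lastTwo_assocInvAux]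
  have hb' : ∀ x z, b (j x z) = j x (lastTwo V c z) := fun x z => by
    have : b.comp (j x) = (j x).comp (lastTwo V c) := by
      refine hom_ext₃ fun p q t => ?_
      simp only [BMap.comp_apply, j, b, map_tmul, lastTwo_tmul, assocInvAux_tmul, BMap.id_apply]
      exact hom_ext_apply (f := assocInvAux (tmul x p))
        (g := (map (assocInvAux x) (BMap.id k V)).comp (assocInvAux p)) (fun p q => by simp) _
    exact congrArg (fun g : BMap k _ _ => g z) this
  have key : ∀ x z, a (b (a (j x z))) = b (a (b (j x z))) := fun x z => by
    rw [ha, hb', ha, hb', ha, hb']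
    exact congrArg (fun g : BMap k _ _ => j x (g z)) hb
  have : a.comp (b.comp a) = b.comp (a.comp b) := by
    refine hom_ext₃ fun t v w => ?_
    exact hom_ext_apply (f := (a.comp (b.comp a)).comp ((tmulR _ w).comp (tmulR _ v)))
      (g := (b.comp (a.comp b)).comp ((tmulR _ w).comp (tmulR _ v)))
      (fun x u => by
        have := key x (tmul (tmul u v) w)
        simp only [j, map_tmul, assocInvAux_tmul, BMap.id_apply] at this
        exact this) t
  exact congrArg (fun g : BMap k _ _ => g z) this

/-- `f ↦ f ⊗ Id` on contractive endomorphisms. -/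
def mapRight (W V : Type*) [SeminormedAddCommGroup W] [NormedSpace k W] [IsUltrametricDist W]
    [SeminormedAddCommGroup V] [NormedSpace k V] : End1 k W →+* End1 k (CTensor k W V) where
  toFun f := End1.ofB (map (End1.toB f) (BMap.id k V))
    (map_normLE_one (End1.toB_normLE f) BMap.id_normLE)
  map_one' := End1.ext (hom_ext fun x y => by simp)
  map_zero' := End1.ext (hom_ext fun x y => by simp)
  map_mul' f g := End1.ext (hom_ext fun x y => by simp)
  map_add' f g := End1.ext (hom_ext fun x y => by simp)

@[simp] theorem mapRight_tmul [IsUltrametricDist W] (f : End1 k W) (x : W) (v : V) :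
    (mapRight W V f).1 (tmul x v) = tmul (f.1 x) v := map_tmul _ _ _ _

end CTensor

end tensorLemmas

/-! ### The braid operators on the tensor powers -/

section braidOps

variable {k : Type u} [NormedField k] [IsUltrametricDist k] [CompleteSpace k]
  {V : Type v} [NormedAddCommGroup V] [NormedSpace k V]
  {c : BMap k (CTensor k V V) (CTensor k V V)}

/-- The identification of `f ⊗ Id` on `V^⊗N ⊗ V` with an operator on `V^⊗(N+1)`. -/
def snocHom (N : ℕ) : End1 k (tpow k V N) →+* End1 k (tpow k V (N + 1)) :=
  CTensor.mapRight (tpow k V N) V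

/-- The operator `c` acting on the last two factors of `V^⊗(N+2)`. -/
def lastOp (hc : c.NormLE 1) (N : ℕ) : End1 k (tpow k V (N + 2)) :=
  show End1 k (CTensor k (CTensor k (tpow k V N) V) V) from
    End1.ofB (CTensor.lastTwo (tpow k V N) c) (CTensor.lastTwo_normLE hc)

/-- The operator `c` acting on the tensor factors `i` and `i + 1` of `V^⊗N`, counted from `0`; it
is zero if there are no such factors. -/
def sig (hc : c.NormLE 1) : ∀ N : ℕ, ℕ → End1 k (tpow k V N)
  | 0, _ => 0
  | 1, _ => 0
  | N + 2, i => if i = N then lastOp hc N else snocHom (N + 1) (sig hc (N + 1) i)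

theorem sig_last (hc : c.NormLE 1) (N : ℕ) : sig hc (N + 2) N = lastOp hc N := by
  rw [sig, if_pos rfl]

theorem sig_of_ne (hc : c.NormLE 1) {N i : ℕ} (h : i + 1 ≠ N) :
    sig hc (N + 1) i = snocHom N (sig hc N i) := by
  match N with
  | 0 => exact (map_zero (snocHom 0)).symm
  | N + 1 => rw [sig, if_neg (by omega)]

/-- The value zero out of range keeps the braid relations true for all indices: each relation with
an out-of-range factor reads 0 = 0. So every degree carries a family indexed by all of ℕ, and these
families combine into one on T_r(V). -/
theorem sig_eq_zero (hc : c.NormLE 1) {N i : ℕ} (h : N ≤ i + 1) : sig hc N i = 0 := by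
  induction N with
  | zero => rfl
  | succ N ih => rw [sig_of_ne hc (by omega), ih (by omega), map_zero]

theorem lastOp_comm (hc : c.NormLE 1) {N : ℕ} (f : End1 k (tpow k V N)) :
    snocHom (N + 1) (snocHom N f) * lastOp hc N = lastOp hc N * snocHom (N + 1) (snocHom N f) :=
  Subtype.ext (LinearMap.ext fun z => (CTensor.lastTwo_map c (End1.toB f) z).symm)

theorem lastOp_braid (hc : c.NormLE 1) (hb : IsPreBraiding c) (N : ℕ) :
    snocHom (N + 2) (lastOp hc N) * lastOp hc (N + 1) * snocHom (N + 2) (lastOp hc N) =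
      lastOp hc (N + 1) * snocHom (N + 2) (lastOp hc N) * lastOp hc (N + 1) :=
  Subtype.ext (LinearMap.ext fun z => CTensor.lastTwo_braid hb z)

theorem sig_isBraid (hc : c.NormLE 1) (hb : IsPreBraiding c) (N : ℕ) : IsBraid (sig hc N) := by
  induction N with
  | zero => exact ⟨fun _ _ _ => rfl, fun _ => rfl⟩
  | succ N ih =>
    refine ⟨fun i j hij => ?_, fun i => ?_⟩
    · by_cases hj : j + 1 = N
      · obtain ⟨M, rfl⟩ : ∃ M, N = M + 3 := ⟨N - 3, by omega⟩
        obtain rfl : j = M + 2 := by omega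
        rw [sig_last, sig_of_ne hc (by omega), sig_of_ne hc (by omega), lastOp_comm]
      · by_cases hi : i + 1 = N
        · rw [sig_eq_zero hc (i := j) (by omega), mul_zero, zero_mul]
        · rw [sig_of_ne hc hj, sig_of_ne hc hi, ← map_mul, ih.far i j hij, map_mul]
    · by_cases hi : i + 2 = N
      · subst hi
        rw [sig_last, sig_of_ne hc (by omega), sig_last, lastOp_braid hc hb]
      · by_cases hi : i + 1 = N
        · rw [sig_eq_zero hc (i := i + 1) (by omega)]; simp
        · rw [sig_of_ne hc hi, sig_of_ne hc (by omega), ← map_mul, ← map_mul, ih.braid,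
            map_mul, map_mul]

/-- A pure tensor in `V^⊗(n+1) = V^⊗n ⊗ V`. -/
def snoc {n : ℕ} (a : tpow k V n) (v : V) : tpow k V (n + 1) :=
  tpowSuccInv k n (CTensor.tmul a v)

theorem snocHom_snoc {n : ℕ} (f : End1 k (tpow k V n)) (a : tpow k V n) (v : V) :
    (snocHom n f).1 (snoc a v) = snoc (f.1 a) v := CTensor.mapRight_tmul f a v

theorem tpow_hom_ext {n : ℕ} {G : Type*} [NormedAddCommGroup G] [NormedSpace k G]
    {f g : BMap k (tpow k V (n + 1)) G} (h : ∀ a v, f (snoc a v) = g (snoc a v))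
    (x : tpow k V (n + 1)) : f x = g x :=
  CTensor.hom_ext_apply (f := f.comp (tpowSuccInv k n)) (g := g.comp (tpowSuccInv k n)) h
    (tpowSucc k n x)

/-- `x ⊗ ·` for `x ∈ V^⊗n`, from `V ⊗ V` to `V^⊗(n+2)`. -/
def snoc₂ {n : ℕ} (a : tpow k V n) : BMap k (CTensor k V V) (tpow k V (n + 2)) :=
  (tpowSuccInv k (n + 1)).comp ((CTensor.map (tpowSuccInv k n) (BMap.id k V)).comp
    (CTensor.assocInvAux a))

theorem snoc₂_tmul {n : ℕ} (a : tpow k V n) (v w : V) :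
    snoc₂ a (CTensor.tmul v w) = snoc (snoc a v) w := by
  simp [snoc₂, snoc]

theorem lastOp_snoc₂ (hc : c.NormLE 1) {n : ℕ} (a : tpow k V n) (z : CTensor k V V) :
    (lastOp hc n).1 (snoc₂ a z) = snoc₂ a (c z) := by
  have h : ∀ z, snoc₂ a z = (CTensor.assocInvAux a z : CTensor k (CTensor k (tpow k V n) V) V) :=
    CTensor.hom_ext_apply (f := snoc₂ a) (g := CTensor.assocInvAux a) fun v w => by
      rw [snoc₂_tmul]
      exact (CTensor.assocInvAux_tmul _ _ _).symm
  rw [h, h]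
  exact CTensor.lastTwo_assocInvAux c a z

end braidOps

/-! ### The tensor algebra -/

namespace TAlg

section algebra

variable {k : Type u} [NormedField k] [IsUltrametricDist k] [CompleteSpace k]
  {V : Type v} [NormedAddCommGroup V] [NormedSpace k V]
  {c : BMap k (CTensor k V V) (CTensor k V V)} {r : {r : ℝ // 0 < r}}

/-- The inclusion of `V^⊗n`. -/
abbrev inc (r : {r : ℝ // 0 < r}) (n : ℕ) : BMap k (tpow k V n) (TAlg k V r) :=
  C0Sum.incl (E := fun n => tpow k V n) n

/-- The product of two elements. -/
def m (x y : TAlg k V r) : TAlg k V r := mul (CTensor.tmul x y)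

/-- Left multiplication. -/
def mL (x : TAlg k V r) : BMap k (TAlg k V r) (TAlg k V r) := mul.comp (CTensor.tmulL _ x)

/-- Right multiplication. -/
def mR (y : TAlg k V r) : BMap k (TAlg k V r) (TAlg k V r) := mul.comp (CTensor.tmulR _ y)

@[simp] theorem mL_apply (x y : TAlg k V r) : mL x y = m x y := rfl

@[simp] theorem mR_apply (x y : TAlg k V r) : mR y x = m x y := rfl

@[simp] theorem mul_tmul (x y : TAlg k V r) : mul (CTensor.tmul x y) = m x y := rfl

@[simp] theorem m_zero (x : TAlg k V r) : m x 0 = 0 := map_zero (mL x)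

@[simp] theorem zero_m (x : TAlg k V r) : m 0 x = 0 := map_zero (mR x)

theorem m_smul (a : k) (x y : TAlg k V r) : m x (a • y) = a • m x y := map_smul (mL x) a y

theorem smul_m (a : k) (x y : TAlg k V r) : m (a • x) y = a • m x y := map_smul (mR y) a x

theorem m_add (x y z : TAlg k V r) : m x (y + z) = m x y + m x z := map_add (mL x) y z

theorem add_m (x y z : TAlg k V r) : m (x + y) z = m x z + m y z := map_add (mR z) x y

theorem m_neg (x y : TAlg k V r) : m x (-y) = -m x y := map_neg (mL x) y

theorem neg_m (x y : TAlg k V r) : m (-x) y = -m x y := map_neg (mR y) x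

theorem m_inc {n l : ℕ} (a : tpow k V n) (b : tpow k V l) :
    m (inc r n a) (inc r l b) = inc r (n + l) (concat n l (CTensor.tmul a b)) := by
  rw [m, mul, C0Sum.lift₂_tmul_incl]
  rfl

theorem concat_zero {n : ℕ} (a : tpow k V n) (b : tpow k V 0) :
    concat n 0 (CTensor.tmul a b) = tpowZero k b • a := by
  simp [concat, rightUnit]

theorem concat_snoc {n l : ℕ} (a : tpow k V n) (b : tpow k V l) (v : V) :
    concat n (l + 1) (CTensor.tmul a (snoc b v)) = snoc (concat n l (CTensor.tmul a b)) v := by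
  simp [concat, snoc]

theorem inclV_eq (v : V) : (inclV v : TAlg k V r) = inc r 1 (snoc (tpowZeroInv k 1) v) := rfl

theorem inc_zero (a : tpow k V 0) : inc r 0 a = tpowZero k a • (one : TAlg k V r) := by
  rw [one, ← map_smul, ← map_smul, smul_eq_mul, mul_one, tpowZeroInv_tpowZero]

theorem inc_snoc {n : ℕ} (a : tpow k V n) (v : V) :
    inc r (n + 1) (snoc a v) = m (inc r n a) (inclV v) := by
  rw [inclV_eq, m_inc, concat_snoc, concat_zero, tpowZero_tpowZeroInv, one_smul]

theorem hom_ext_inc {G : Type*} [NormedAddCommGroup G] [NormedSpace k G]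
    {f g : BMap k (TAlg k V r) G} (h : ∀ n a, f (inc r n a) = g (inc r n a)) (x : TAlg k V r) :
    f x = g x := by
  rw [C0Sum.hom_ext h]

/-- Induction on the degree for two bounded maps on the homogeneous elements of `T_r(V)`. -/
theorem inc_ext_rec {G : Type*} [NormedAddCommGroup G] [NormedSpace k G]
    {f g : BMap k (TAlg k V r) G} (h1 : f one = g one)
    (hs : ∀ n, (∀ a, f (inc r n a) = g (inc r n a)) → ∀ a v,
      f (m (inc r n a) (inclV v)) = g (m (inc r n a) (inclV v))) (n : ℕ) (a : tpow k V n) :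
    f (inc r n a) = g (inc r n a) := by
  induction n with
  | zero => rw [inc_zero, map_smul, map_smul, h1]
  | succ n ih =>
    exact tpow_hom_ext (f := f.comp (inc r (n + 1))) (g := g.comp (inc r (n + 1)))
      (fun a v => by simpa [inc_snoc] using hs n ih a v) a

theorem hom_ext_rec {G : Type*} [NormedAddCommGroup G] [NormedSpace k G]
    {f g : BMap k (TAlg k V r) G} (h1 : f one = g one)
    (hs : ∀ n, (∀ a, f (inc r n a) = g (inc r n a)) → ∀ a v,
      f (m (inc r n a) (inclV v)) = g (m (inc r n a) (inclV v))) (x : TAlg k V r) : f x = g x :=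
  hom_ext_inc (inc_ext_rec h1 hs) x

theorem hom_ext_inc₂ {s : {r : ℝ // 0 < r}} {G : Type*} [NormedAddCommGroup G] [NormedSpace k G]
    {f g : BMap k (CTensor k (TAlg k V r) (TAlg k V s)) G}
    (h : ∀ n a l b, f (CTensor.tmul (inc r n a) (inc s l b)) =
      g (CTensor.tmul (inc r n a) (inc s l b))) (z : CTensor k (TAlg k V r) (TAlg k V s)) :
    f z = g z :=
  CTensor.hom_ext_apply (fun x y =>
    hom_ext_inc (f := f.comp (CTensor.tmulR _ y)) (g := g.comp (CTensor.tmulR _ y)) (fun n a =>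
      hom_ext_inc (f := f.comp (CTensor.tmulL _ (inc r n a)))
        (g := g.comp (CTensor.tmulL _ (inc r n a))) (fun l b => h n a l b) y) x) z

/-- Associativity with a last factor from V. This case is enough here, since homogeneous elements
are built by appending one vector at a time and all later inductions follow that recursion. -/
theorem m_assocV (x y : TAlg k V r) (v : V) : m x (m y (inclV v)) = m (m x y) (inclV v) := by
  refine hom_ext_inc₂ (f := mul.comp (CTensor.map (BMap.id k _) (mR (inclV v))))
    (g := (mR (inclV v)).comp mul) (fun n a l b => ?_) (CTensor.tmul x y) |> fun h => by simpa
        using h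
  simp only [BMap.comp_apply, CTensor.map_tmul, mR_apply, mul_tmul, BMap.id_apply]
  rw [← inc_snoc, m_inc, m_inc, concat_snoc, ← inc_snoc]
  rfl

theorem m_one (x : TAlg k V r) : m x one = x :=
  hom_ext_inc (f := mR one) (g := BMap.id k _) (fun n a => by
    rw [mR_apply, one, m_inc, concat_zero, tpowZero_tpowZeroInv, one_smul]; rfl) x

theorem one_m (x : TAlg k V r) : m one x = x :=
  hom_ext_rec (f := mL one) (g := BMap.id k _) (m_one _) (fun n ih a v => by
    have := ih a
    simp only [mL_apply, BMap.id_apply] at this ⊢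
    rw [m_assocV, this]) x

/-! ### Homogeneous elements -/

/-- The homogeneous elements of degree `n`. -/
def Deg (k : Type u) [NormedField k] [IsUltrametricDist k] [CompleteSpace k]
    (V : Type v) [NormedAddCommGroup V] [NormedSpace k V] (r : {r : ℝ // 0 < r}) (n : ℕ) :
    Submodule k (TAlg k V r) := LinearMap.range (inc r n).lin

theorem inc_mem_deg {n : ℕ} (a : tpow k V n) : inc r n a ∈ Deg k V r n := ⟨a, rfl⟩

theorem one_mem_deg : one ∈ Deg k V r 0 := ⟨_, rfl⟩

theorem inclV_mem_deg (v : V) : inclV v ∈ Deg k V r 1 := ⟨_, rfl⟩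

theorem m_mem_deg {n l : ℕ} {x y : TAlg k V r} (hx : x ∈ Deg k V r n) (hy : y ∈ Deg k V r l) :
    m x y ∈ Deg k V r (n + l) := by
  obtain ⟨a, rfl⟩ := hx
  obtain ⟨b, rfl⟩ := hy
  exact ⟨_, (m_inc a b).symm⟩

theorem degProj_of_mem {n : ℕ} {x : TAlg k V r} (hx : x ∈ Deg k V r n) (l : ℕ) :
    degProj l x = if l = n then x else 0 := by
  obtain ⟨a, rfl⟩ := hx
  split_ifs with h
  · subst h
    exact congrArg (inc r l) (C0Sum.coord_incl_same (E := fun n => tpow k V n) l a)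
  · exact (congrArg (inc r l) (C0Sum.coord_incl_of_ne (E := fun n => tpow k V n) h a)).trans
      (map_zero _)

theorem degProj_mem (n : ℕ) (x : TAlg k V r) : degProj n x ∈ Deg k V r n := ⟨_, rfl⟩

theorem degProj_inc (l n : ℕ) (a : tpow k V n) :
    degProj l (inc r n a) = if l = n then inc r n a else 0 := degProj_of_mem (inc_mem_deg a) l

/-- A property of homogeneous elements can be checked by induction on the degree. -/
theorem deg_ext_rec {G : Type*} [NormedAddCommGroup G] [NormedSpace k G]
    {f g : BMap k (TAlg k V r) G} {n : ℕ}
    (h : ∀ n' x v, n = n' + 1 → x ∈ Deg k V r n' → f (m x (inclV v)) = g (m x (inclV v)))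
    (h0 : n = 0 → f one = g one) {x : TAlg k V r} (hx : x ∈ Deg k V r n) : f x = g x := by
  obtain ⟨a, rfl⟩ := hx
  cases n with
  | zero =>
    change f (inc r 0 a) = g (inc r 0 a)
    rw [inc_zero, map_smul, map_smul, h0 rfl]
  | succ n =>
    refine tpow_hom_ext (f := f.comp (inc r (n + 1))) (g := g.comp (inc r (n + 1)))
      (fun a v => ?_) a
    simpa [inc_snoc] using h n (inc r n a) v rfl (inc_mem_deg a)

theorem degProj_m {n l : ℕ} (x : TAlg k V r) {y : TAlg k V r} (hy : y ∈ Deg k V r l) :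
    degProj (n + l) (m x y) = m (degProj n x) y :=
  hom_ext_inc (f := (degProj (n + l)).comp (mR y)) (g := (mR y).comp (degProj n))
    (fun j a => by
      simp only [BMap.comp_apply, mR_apply, degProj_inc,
        degProj_of_mem (m_mem_deg (inc_mem_deg (r := r) a) hy)]
      by_cases h : n = j
      · simp [h]
      · simp [h]) x

theorem degProj_m_eq_zero {n l : ℕ} (x : TAlg k V r) {y : TAlg k V r} (hy : y ∈ Deg k V r l)
    (h : n < l) : degProj n (m x y) = 0 :=
  hom_ext_inc (f := (degProj n).comp (mR y)) (g := 0)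
    (fun j a => by
      simp only [BMap.comp_apply, mR_apply,
        degProj_of_mem (m_mem_deg (inc_mem_deg (r := r) a) hy)]
      rw [if_neg (by omega)]; rfl) x

/-! ### The braid operators on the tensor algebra -/

/-- Contractivity with one constant for all degrees is what lets a degreewise family act on the
completed sum. Being a ring of contractions, `End1` also contains all integer polynomials in the
σ_i. -/
theorem diag_bound (f : ∀ n, End1 k (tpow k V n)) (n : ℕ) (a : tpow k V n) :
    ‖((inc r n).lin ∘ₗ (f n).1) a‖ ≤ 1 * ((r : ℝ) ^ n * ‖a‖) := by
  rw [one_mul]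
  exact (C0Sum.incl_normLE (E := fun n => tpow k V n) n _).trans
    (mul_le_mul_of_nonneg_left ((f n).2 a) (pow_nonneg r.2.le n))

/-- The operator on `T_r(V)` with given contractive homogeneous components. -/
def diagFun (r : {r : ℝ // 0 < r}) (f : ∀ n, End1 k (tpow k V n)) : End1 k (TAlg k V r) :=
  End1.ofB (C0Sum.lift (fun n => (inc r n).lin ∘ₗ (f n).1) ⟨1, zero_le_one, diag_bound f⟩)
    (C0Sum.lift_normLE _ _ zero_le_one (diag_bound f))

theorem diagFun_inc (f : ∀ n, End1 k (tpow k V n)) {n : ℕ} (a : tpow k V n) :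
    (diagFun r f).1 (inc r n a) = inc r n ((f n).1 a) :=
  C0Sum.lift_incl (r := r) (fun n => (inc r n).lin ∘ₗ (f n).1)
    ⟨1, zero_le_one, diag_bound f⟩ n a

theorem end_ext {f g : End1 k (TAlg k V r)}
    (h : ∀ n (a : tpow k V n), f.1 (inc r n a) = g.1 (inc r n a)) : f = g :=
  End1.ext (DFunLike.ext _ _ (hom_ext_inc h))

/-- A family of contractive operators on the tensor powers acts on `T_r(V)`. -/
def diag (r : {r : ℝ // 0 < r}) : (∀ n, End1 k (tpow k V n)) →+* End1 k (TAlg k V r) where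
  toFun := diagFun r
  map_one' := end_ext fun n a => diagFun_inc _ a
  map_zero' := end_ext fun n a => (diagFun_inc _ a).trans (map_zero (inc r n))
  map_mul' f g := end_ext fun n a => by
    rw [diagFun_inc, End1.mul_apply, diagFun_inc, diagFun_inc]; rfl
  map_add' f g := end_ext fun n a => by
    rw [diagFun_inc, End1.add_apply, diagFun_inc, diagFun_inc, ← map_add]; rfl

theorem diag_inc (f : ∀ n, End1 k (tpow k V n)) {n : ℕ} (a : tpow k V n) :
    (diag r f).1 (inc r n a) = inc r n ((f n).1 a) := diagFun_inc f a

theorem diag_mem_deg (f : ∀ n, End1 k (tpow k V n)) {n : ℕ} {x : TAlg k V r}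
    (hx : x ∈ Deg k V r n) : (diag r f).1 x ∈ Deg k V r n := by
  obtain ⟨a, rfl⟩ := hx
  exact ⟨_, (diag_inc f a).symm⟩

/-- The operator `c` acting on the tensor factors `i` and `i + 1` of all elements of `T_r(V)`. -/
def sg (r : {r : ℝ // 0 < r}) (hc : c.NormLE 1) (i : ℕ) : End1 k (TAlg k V r) :=
  diag r fun n => sig hc n i

theorem sg_mem_deg (hc : c.NormLE 1) (i : ℕ) {n : ℕ} {x : TAlg k V r}
    (hx : x ∈ Deg k V r n) : (sg r hc i).1 x ∈ Deg k V r n := diag_mem_deg _ hx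

theorem sg_isBraid (hc : c.NormLE 1) (hb : IsPreBraiding c) : IsBraid (sg r hc) where
  far i j hij := by
    rw [sg, sg, ← map_mul, ← map_mul]
    exact congrArg _ (funext fun n => (sig_isBraid hc hb n).far i j hij)
  braid i := by
    rw [sg, sg, ← map_mul, ← map_mul, ← map_mul, ← map_mul]
    exact congrArg _ (funext fun n => (sig_isBraid hc hb n).braid i)

theorem sg_eq_zero (hc : c.NormLE 1) {n i : ℕ} (h : n ≤ i + 1) {x : TAlg k V r}
    (hx : x ∈ Deg k V r n) : (sg r hc i).1 x = 0 := by
  obtain ⟨a, rfl⟩ := hx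
  refine (diag_inc _ a).trans ?_
  rw [sig_eq_zero hc h]
  exact map_zero (inc r n)

theorem sg_mV (hc : c.NormLE 1) {n i : ℕ} (h : i + 1 ≠ n) {x : TAlg k V r}
    (hx : x ∈ Deg k V r n) (v : V) :
    (sg r hc i).1 (m x (inclV v)) = m ((sg r hc i).1 x) (inclV v) := by
  obtain ⟨a, rfl⟩ := hx
  change (sg r hc i).1 (m (inc r n a) (inclV v)) = m ((sg r hc i).1 (inc r n a)) (inclV v)
  rw [← inc_snoc, sg, diag_inc, sig_of_ne hc h, snocHom_snoc, inc_snoc, diag_inc]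

/-- `w ⊗ v ↦ x w v`. -/
def app (x : TAlg k V r) : BMap k (CTensor k V V) (TAlg k V r) :=
  mul.comp (CTensor.map ((mL x).comp inclV) inclV)

theorem app_tmul (x : TAlg k V r) (w v : V) :
    app x (CTensor.tmul w v) = m (m x (inclV w)) (inclV v) := by
  simp [app]

theorem app_m (x y : TAlg k V r) (z : CTensor k V V) : app (m x y) z = m x (app y z) :=
  CTensor.hom_ext_apply (f := app (m x y)) (g := (mL x).comp (app y)) (fun w v => by
    rw [BMap.comp_apply, app_tmul, app_tmul, mL_apply, m_assocV, m_assocV]) z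

theorem sg_app (hc : c.NormLE 1) {n : ℕ} {x : TAlg k V r} (hx : x ∈ Deg k V r n)
    (z : CTensor k V V) : (sg r hc n).1 (app x z) = app x (c z) := by
  obtain ⟨a, rfl⟩ := hx
  have h : ∀ z, app (inc r n a) z = inc r (n + 2) (snoc₂ a z) :=
    CTensor.hom_ext_apply (f := app (inc r n a)) (g := (inc r (n + 2)).comp (snoc₂ a))
      fun w v => by rw [BMap.comp_apply, snoc₂_tmul, app_tmul, inc_snoc, inc_snoc]
  change (sg r hc n).1 (app (inc r n a) z) = app (inc r n a) (c z)
  rw [h, h, sg, diag_inc, sig_last, lastOp_snoc₂]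

theorem sg_m_left (hc : c.NormLE 1) {n i : ℕ} (hi : i + 1 < n) {x : TAlg k V r}
    (hx : x ∈ Deg k V r n) (y : TAlg k V r) :
    (sg r hc i).1 (m x y) = m ((sg r hc i).1 x) y :=
  hom_ext_rec (f := (End1.toB (sg r hc i)).comp (mL x)) (g := mL ((sg r hc i).1 x))
    (by simp [m_one]) (fun l ih a v => by
      have := ih a
      simp only [mL_apply, BMap.comp_apply, End1.toB_apply] at this ⊢
      rw [m_assocV, m_assocV, ← this,
        sg_mV hc (n := n + l) (by omega) (m_mem_deg hx (inc_mem_deg a))]) y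

/-- Multiplying by x on the left shifts the index by the degree n. Trailing vectors that the
operator does not touch are removed by induction. When it acts on the last two vectors of y, these
are removed together and `sg_app` applies on both sides. -/
theorem sg_m_right (hc : c.NormLE 1) {n l i : ℕ} (hi : i + 1 < l) {x y : TAlg k V r}
    (hx : x ∈ Deg k V r n) (hy : y ∈ Deg k V r l) :
    (sg r hc (n + i)).1 (m x y) = m x ((sg r hc i).1 y) := by
  induction l generalizing y with
  | zero => omega
  | succ l ih =>
    refine deg_ext_rec (f := (End1.toB (sg r hc (n + i))).comp (mL x))
      (g := (mL x).comp (End1.toB (sg r hc i))) (fun l' y v hl hy' => ?_) (by omega) hy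
    obtain rfl : l' = l := by omega
    simp only [mL_apply, BMap.comp_apply, End1.toB_apply]
    rcases Nat.lt_or_ge (i + 1) l' with h | h
    · rw [sg_mV hc (by omega) hy', m_assocV, m_assocV, ← ih h hy',
        sg_mV hc (n := n + l') (by omega) (m_mem_deg hx hy')]
    · obtain rfl : l' = i + 1 := by omega
      refine deg_ext_rec (f := (End1.toB (sg r hc (n + i))).comp ((mL x).comp (mR (inclV v))))
        (g := (mL x).comp ((End1.toB (sg r hc i)).comp (mR (inclV v))))
        (fun l'' y w hl hz => ?_) (by omega) hy'
      obtain rfl : l'' = i := by omega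
      simp only [mL_apply, mR_apply, BMap.comp_apply, End1.toB_apply]
      rw [← app_tmul, sg_app hc hz, ← app_m, ← app_m, sg_app hc (m_mem_deg hx hz)]

/-- The pairs `(f, g)` with `g (x y) = f x y` for `x` of degree `n`. -/
def leftAct (k : Type u) [NormedField k] [IsUltrametricDist k] [CompleteSpace k]
    (V : Type v) [NormedAddCommGroup V] [NormedSpace k V] (r : {r : ℝ // 0 < r}) (n : ℕ) :
    Subring (End1 k (TAlg k V r) × End1 k (TAlg k V r)) where
  -- Preservation of degree is part of the condition, since otherwise the set would not be closed
  -- under composition.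
  carrier := {p | ∀ x ∈ Deg k V r n, p.1.1 x ∈ Deg k V r n ∧ ∀ y, p.2.1 (m x y) = m (p.1.1 x) y}
  one_mem' := fun x hx => ⟨hx, fun y => rfl⟩
  zero_mem' := fun x hx => ⟨zero_mem _, fun y => (zero_m y).symm⟩
  mul_mem' {p q} hp hq x hx := ⟨(hp _ (hq x hx).1).1, fun y => by
    change p.2.1 (q.2.1 (m x y)) = m (p.1.1 (q.1.1 x)) y
    rw [(hq x hx).2, (hp _ (hq x hx).1).2]⟩
  add_mem' {p q} hp hq x hx := ⟨add_mem (hp x hx).1 (hq x hx).1, fun y => by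
    change p.2.1 (m x y) + q.2.1 (m x y) = m (p.1.1 x + q.1.1 x) y
    rw [(hp x hx).2, (hq x hx).2, add_m]⟩
  neg_mem' {p} hp x hx := ⟨neg_mem (hp x hx).1, fun y => by
    change -p.2.1 (m x y) = m (-p.1.1 x) y
    rw [(hp x hx).2, neg_m]⟩

/-- The pairs `(f, g)` with `g (x y) = x f y` for `x` of degree `n` and `y` of degree `l`. -/
def rightAct (k : Type u) [NormedField k] [IsUltrametricDist k] [CompleteSpace k]
    (V : Type v) [NormedAddCommGroup V] [NormedSpace k V] (r : {r : ℝ // 0 < r}) (n l : ℕ) :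
    Subring (End1 k (TAlg k V r) × End1 k (TAlg k V r)) where
  carrier := {p | ∀ y ∈ Deg k V r l, p.1.1 y ∈ Deg k V r l ∧
    ∀ x ∈ Deg k V r n, p.2.1 (m x y) = m x (p.1.1 y)}
  one_mem' := fun x hx => ⟨hx, fun y _ => rfl⟩
  zero_mem' := fun x hx => ⟨zero_mem _, fun y _ => (m_zero y).symm⟩
  mul_mem' {p q} hp hq y hy := ⟨(hp _ (hq y hy).1).1, fun x hx => by
    change p.2.1 (q.2.1 (m x y)) = m x (p.1.1 (q.1.1 y))
    rw [(hq y hy).2 x hx, (hp _ (hq y hy).1).2 x hx]⟩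
  add_mem' {p q} hp hq y hy := ⟨add_mem (hp y hy).1 (hq y hy).1, fun x hx => by
    change p.2.1 (m x y) + q.2.1 (m x y) = m x (p.1.1 y + q.1.1 y)
    rw [(hp y hy).2 x hx, (hq y hy).2 x hx, m_add]⟩
  neg_mem' {p} hp y hy := ⟨neg_mem (hp y hy).1, fun x hx => by
    change -p.2.1 (m x y) = m x (-p.1.1 y)
    rw [(hp y hy).2 x hx, m_neg]⟩

theorem sg_mem_leftAct (hc : c.NormLE 1) {n i : ℕ} (hi : i + 1 < n) :
    (sg r hc i, sg r hc i) ∈ leftAct k V r n := fun _ hx =>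
  ⟨sg_mem_deg hc i hx, fun y => sg_m_left hc hi hx y⟩

theorem sg_mem_rightAct (hc : c.NormLE 1) {n l i : ℕ} (hi : i + 1 < l) :
    (sg r hc i, sg r hc (n + i)) ∈ rightAct k V r n l := fun _ hy =>
  ⟨sg_mem_deg hc i hy, fun _ hx => sg_m_right hc hi hx hy⟩

end algebra

end TAlg

/-! ### The comultiplication and the pre-braiding through the braid operators -/

namespace TAlg

section coalgebra

variable {k : Type u} [NormedField k] [IsUltrametricDist k] [CompleteSpace k]
  {V : Type v} [NormedAddCommGroup V] [NormedSpace k V]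
  {c : BMap k (CTensor k V V) (CTensor k V V)} {r : {r : ℝ // 0 < r}}

theorem braidOne_snoc {n : ℕ} (b : tpow k V n) (w v : V) :
    braidOne c (n + 1) (CTensor.tmul (snoc b w) v) =
      CTensor.map (BMap.id k V) (tpowSuccInv k n) (CTensor.assoc
        (CTensor.map (braidOne c n) (BMap.id k V)
          (CTensor.assocInvAux b (c (CTensor.tmul w v))))) := by
  simp [braidOne, snoc, CTensor.assocInv_tmul_left]

theorem braidPow_snoc {n l : ℕ} (a : tpow k V n) (b : tpow k V l) (v : V) :
    braidPow c n (l + 1) (CTensor.tmul a (snoc b v)) =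
      CTensor.map (tpowSuccInv k l) (BMap.id k (tpow k V n)) (CTensor.assocInv
        (CTensor.map (BMap.id k (tpow k V l)) (braidOne c n) (CTensor.assoc
          (CTensor.tmul (braidPow c n l (CTensor.tmul a b)) v)))) := by
  simp [braidPow, snoc]

theorem braidPow_zero {n : ℕ} (a : tpow k V n) (b : tpow k V 0) :
    braidPow c n 0 (CTensor.tmul a b) = CTensor.tmul b a := by
  simp [braidPow]

theorem braid_inc (hc : c.NormLE 1) {n l : ℕ} (a : tpow k V n) (b : tpow k V l) :
    braid hc (CTensor.tmul (inc r n a) (inc r l b)) =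
      CTensor.map (inc r l) (inc r n) (braidPow c n l (CTensor.tmul a b)) := by
  rw [braid, C0Sum.lift₂_tmul_incl]
  rfl

theorem braid_one (hc : c.NormLE 1) (y : TAlg k V r) :
    braid hc (CTensor.tmul y one) = CTensor.tmul one y :=
  hom_ext_inc (f := (braid hc).comp (CTensor.tmulR _ one)) (g := CTensor.tmulL _ one)
    (fun n a => by
      simp only [BMap.comp_apply, CTensor.tmulR_apply, CTensor.tmulL_apply]
      refine (braid_inc hc a (tpowZeroInv k 1)).trans ?_
      rw [braidPow_zero, CTensor.map_tmul]
      rfl) y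

theorem braid_inclV (hc : c.NormLE 1) {n : ℕ} (b : tpow k V n) (v : V) :
    braid hc (CTensor.tmul (inc r n b) (inclV v)) =
      CTensor.map inclV (inc r n) (braidOne c n (CTensor.tmul b v)) := by
  rw [inclV_eq, braid_inc, braidPow_snoc, braidPow_zero, CTensor.assoc_tmul, CTensor.map_tmul,
    CTensor.assocInv_tmul_left]
  exact CTensor.hom_ext_apply
    (f := (CTensor.map (inc r 1) (inc r n)).comp ((CTensor.map (tpowSuccInv k 0)
      (BMap.id k (tpow k V n))).comp (CTensor.assocInvAux (tpowZeroInv k 1))))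
    (g := CTensor.map inclV (inc r n)) (fun w a => by
      simp only [BMap.comp_apply, CTensor.assocInvAux_tmul, CTensor.map_tmul, BMap.id_apply]
      rfl) _

theorem mulSq_tmul (hc : c.NormLE 1) (x y z t : TAlg k V r) :
    mulSq hc (CTensor.tmul (CTensor.tmul x y) (CTensor.tmul z t)) =
      CTensor.map (mL x) (mR t) (braid hc (CTensor.tmul y z)) := by
  rw [mulSq, BMap.comp_apply, CTensor.mid_tmul, CTensor.map_comp]
  rfl

/-- The product of the homogeneous components of degrees `n` and `l`. -/
def mulDeg (n l : ℕ) : BMap k (CTensor k (TAlg k V r) (TAlg k V r)) (TAlg k V r) :=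
  mul.comp (CTensor.map (degProj n) (degProj l))

theorem mulDeg_tmul (n l : ℕ) (x y : TAlg k V r) :
    mulDeg n l (CTensor.tmul x y) = m (degProj n x) (degProj l y) := by simp [mulDeg]

theorem mulDeg_of_mem {n l a b : ℕ} {x y : TAlg k V r} (hx : x ∈ Deg k V r a)
    (hy : y ∈ Deg k V r b) :
    mulDeg n l (CTensor.tmul x y) = if n = a ∧ l = b then m x y else 0 := by
  rw [mulDeg_tmul, degProj_of_mem hx, degProj_of_mem hy]
  by_cases h1 : n = a <;> by_cases h2 : l = b <;> simp [h1, h2]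

/-- In (x ⊗ y)(1 ⊗ v) the factor y passes 1 trivially, so v is appended to the second leg. Bidegrees
are read off after concatenation, which turns components of tensors into operators on T_r(V). -/
theorem mulDeg_mulSq_one_inclV (hc : c.NormLE 1) (n l : ℕ)
    (z : CTensor k (TAlg k V r) (TAlg k V r)) (v : V) :
    mulDeg n (l + 1) (mulSq hc (CTensor.tmul z (CTensor.tmul one (inclV v)))) =
      m (mulDeg n l z) (inclV v) :=
  CTensor.hom_ext_apply
    (f := (mulDeg n (l + 1)).comp ((mulSq hc).comp (CTensor.tmulR _ (CTensor.tmul one (inclV v)))))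
    (g := (mR (inclV v)).comp (mulDeg n l)) (fun x y => by
      simp only [BMap.comp_apply, CTensor.tmulR_apply, mR_apply]
      rw [mulSq_tmul, braid_one, CTensor.map_tmul, mL_apply, mR_apply, m_one, mulDeg_tmul,
          mulDeg_tmul,
        degProj_m y (inclV_mem_deg v), m_assocV]) z

theorem mulDeg_zero_mulSq_one_inclV (hc : c.NormLE 1) (n : ℕ)
    (z : CTensor k (TAlg k V r) (TAlg k V r)) (v : V) :
    mulDeg n 0 (mulSq hc (CTensor.tmul z (CTensor.tmul one (inclV v)))) = 0 :=
  CTensor.hom_ext_apply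
    (f := (mulDeg n 0).comp ((mulSq hc).comp (CTensor.tmulR _ (CTensor.tmul one (inclV v)))))
    (g := 0) (fun x y => by
      simp only [BMap.comp_apply, CTensor.tmulR_apply]
      rw [mulSq_tmul, braid_one, CTensor.map_tmul, mL_apply, mR_apply, m_one, mulDeg_tmul,
        degProj_m_eq_zero y (inclV_mem_deg v) zero_lt_one, m_zero]
      rfl) z

/-- `v ⊗ b ↦ x v b`. -/
def splice (x : TAlg k V r) (n : ℕ) : BMap k (CTensor k V (tpow k V n)) (TAlg k V r) :=
  mul.comp (CTensor.map ((mL x).comp inclV) (inc r n))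

theorem splice_tmul (x : TAlg k V r) {n : ℕ} (v : V) (b : tpow k V n) :
    splice x n (CTensor.tmul v b) = m (m x (inclV v)) (inc r n b) := by simp [splice]

theorem splice_snoc (x : TAlg k V r) {n : ℕ} (z : CTensor k V (tpow k V n)) (v : V) :
    splice x (n + 1) (CTensor.map (BMap.id k V) (tpowSuccInv k n)
      (CTensor.assoc (CTensor.tmul z v))) = m (splice x n z) (inclV v) :=
  CTensor.hom_ext_apply
    (f := (splice x (n + 1)).comp ((CTensor.map (BMap.id k V) (tpowSuccInv k n)).comp
      (CTensor.assoc.comp (CTensor.tmulR _ v))))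
    (g := (mR (inclV v)).comp (splice x n)) (fun w b => by
      simp only [BMap.comp_apply, CTensor.tmulR_apply, CTensor.assoc_tmul, CTensor.map_tmul,
        BMap.id_apply, mR_apply]
      rw [splice_tmul, splice_tmul, ← m_assocV, ← inc_snoc]
      rfl) z

theorem cyc_mV (hc : c.NormLE 1) {n a l : ℕ} (h : a + l < n) {x : TAlg k V r}
    (hx : x ∈ Deg k V r n) (v : V) :
    (cyc (sg r hc) a l).1 (m x (inclV v)) = m ((cyc (sg r hc) a l).1 x) (inclV v) :=
  ((cyc_pair_mem (A := leftAct k V r n) fun i _ hi => sg_mem_leftAct hc (by omega)) x hx).2 _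

/-- Moving v to the left past the l factors of y is the cycle σ_n ⋯ σ_{n+l-1}, whose rightmost
factor acts first. The element x in front places the starting index at n. Each inductive step
applies c once at the end and passes to one factor less. -/
theorem splice_braidOne (hc : c.NormLE 1) {n : ℕ} {x : TAlg k V r} (hx : x ∈ Deg k V r n)
    {l : ℕ} (y : tpow k V l) (v : V) : splice x l (braidOne c l (CTensor.tmul y v)) =
      (cyc (sg r hc) n l).1 (m (m x (inc r l y)) (inclV v)) := by
  induction l generalizing v with
  | zero =>
    rw [braidOne, CTensor.swap_tmul, splice_tmul, inc_zero, m_smul, m_one, m_smul, m_one, smul_m]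
    rfl
  | succ l ih =>
    refine tpow_hom_ext
      (f := (splice x (l + 1)).comp ((braidOne c (l + 1)).comp (CTensor.tmulR _ v)))
      (g := (End1.toB (cyc (sg r hc) n (l + 1))).comp ((mR (inclV v)).comp
        ((mL x).comp (inc r (l + 1))))) (fun y w => ?_) y
    simp only [BMap.comp_apply, CTensor.tmulR_apply, End1.toB_apply, mR_apply, mL_apply]
    rw [braidOne_snoc, inc_snoc, m_assocV, ← app_tmul, cyc, End1.mul_apply,
      sg_app hc (m_mem_deg hx (inc_mem_deg y))]
    refine CTensor.hom_ext_apply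
      (f := (splice x (l + 1)).comp ((CTensor.map (BMap.id k V) (tpowSuccInv k l)).comp
        (CTensor.assoc.comp ((CTensor.map (braidOne c l) (BMap.id k V)).comp
          (CTensor.assocInvAux y)))))
      (g := (End1.toB (cyc (sg r hc) n l)).comp (app (m x (inc r l y)))) (fun w v => ?_) _
    simp only [BMap.comp_apply, CTensor.assocInvAux_tmul, CTensor.map_tmul, BMap.id_apply,
      End1.toB_apply]
    rw [splice_snoc, ih, app_tmul, cyc_mV hc (n := n + l + 1) (by omega)
      (m_mem_deg (m_mem_deg hx (inc_mem_deg y)) (inclV_mem_deg w))]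

/-- In (x ⊗ y)(v ⊗ 1) the vector v has to cross y before it joins the first leg; the crossing
contributes the cycle. -/
theorem mulDeg_mulSq_inclV_one (hc : c.NormLE 1) (n l : ℕ)
    (z : CTensor k (TAlg k V r) (TAlg k V r)) (v : V) :
    mulDeg (n + 1) l (mulSq hc (CTensor.tmul z (CTensor.tmul (inclV v) one))) =
      (cyc (sg r hc) n l).1 (m (mulDeg n l z) (inclV v)) :=
  hom_ext_inc₂
    (f := (mulDeg (n + 1) l).comp ((mulSq hc).comp (CTensor.tmulR _ (CTensor.tmul (inclV v) one))))
    (g := (End1.toB (cyc (sg r hc) n l)).comp ((mR (inclV v)).comp (mulDeg n l))) (fun i a j b => by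
      simp only [BMap.comp_apply, CTensor.tmulR_apply, mR_apply, End1.toB_apply]
      rw [mulSq_tmul, braid_inclV, mulDeg_of_mem (inc_mem_deg a) (inc_mem_deg b), CTensor.map_comp]
      have key : ∀ z, mulDeg (n + 1) l (CTensor.map ((mL (inc r i a)).comp inclV)
          ((mR one).comp (inc r j)) z) =
          if n = i ∧ l = j then splice (inc r i a) j z else 0 := fun z => by
        refine (CTensor.hom_ext_apply (f := (mulDeg (n + 1) l).comp (CTensor.map
          ((mL (inc r i a)).comp inclV) ((mR one).comp (inc r j))))
          (g := if n = i ∧ l = j then splice (inc r i a) j else 0)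
          (fun w d => ?_) z).trans (by split_ifs <;> rfl)
        rw [BMap.comp_apply, CTensor.map_tmul, BMap.comp_apply, BMap.comp_apply, mL_apply,
          mR_apply, m_one,
          mulDeg_of_mem (m_mem_deg (inc_mem_deg a) (inclV_mem_deg w)) (inc_mem_deg d)]
        simp only [add_left_inj]
        split_ifs
        · rw [splice_tmul]
        · rfl
      rw [key]
      split_ifs with h
      · obtain ⟨rfl, rfl⟩ := h
        exact splice_braidOne hc (inc_mem_deg a) b v
      · rw [zero_m, map_zero]) z

theorem mulDeg_zero_mulSq_inclV_one (hc : c.NormLE 1) (l : ℕ)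
    (z : CTensor k (TAlg k V r) (TAlg k V r)) (v : V) :
    mulDeg 0 l (mulSq hc (CTensor.tmul z (CTensor.tmul (inclV v) one))) = 0 :=
  hom_ext_inc₂
    (f := (mulDeg 0 l).comp ((mulSq hc).comp (CTensor.tmulR _ (CTensor.tmul (inclV v) one))))
    (g := 0) (fun i a j b => by
      simp only [BMap.comp_apply, CTensor.tmulR_apply]
      rw [mulSq_tmul, braid_inclV, CTensor.map_comp]
      refine CTensor.hom_ext_apply (f := (mulDeg 0 l).comp (CTensor.map
          ((mL (inc r i a)).comp inclV) ((mR one).comp (inc r j))))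
          (g := 0) (fun w d => ?_) _
      rw [BMap.comp_apply, CTensor.map_tmul, BMap.comp_apply, BMap.comp_apply, mL_apply,
          mR_apply, m_one,
          mulDeg_of_mem (m_mem_deg (inc_mem_deg a) (inclV_mem_deg w)) (inc_mem_deg d),
          if_neg (by omega)]
      rfl) z

theorem comul_inc (hc : c.NormLE 1) {n : ℕ} (a : tpow k V n) :
    comul hc (inc r n a) = comulPow r hc n a :=
  C0Sum.lift_incl (r := r) (fun n => (comulPow r hc n).lin)
    ⟨1, zero_le_one, fun n a => by rw [one_mul]; exact comulPow_normLE hc n a⟩ n a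

theorem comul_mV (hc : c.NormLE 1) {n : ℕ} {x : TAlg k V r} (hx : x ∈ Deg k V r n) (v : V) :
    comul hc (m x (inclV v)) = mulSq hc (CTensor.tmul (comul hc x) (comulV v)) := by
  obtain ⟨a, rfl⟩ := hx
  change comul hc (m (inc r n a) (inclV v)) =
    mulSq hc (CTensor.tmul (comul hc (inc r n a)) (comulV v))
  rw [← inc_snoc, comul_inc, comul_inc]
  simp [comulPow, snoc]

theorem comul_one (hc : c.NormLE 1) :
    comul hc (one : TAlg k V r) = CTensor.tmul one one := by
  refine (comul_inc hc (tpowZeroInv k 1)).trans ?_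
  change (1 : k) • (CTensor.tmul one one : CTensor k (TAlg k V r) (TAlg k V r)) = _
  rw [one_smul]

theorem shuf_mV (hc : c.NormLE 1) {n l N : ℕ} (h : n + l ≤ N) {x : TAlg k V r}
    (hx : x ∈ Deg k V r N) (v : V) :
    (shuf (sg r hc) n l).1 (m x (inclV v)) = m ((shuf (sg r hc) n l).1 x) (inclV v) :=
  ((shuf_pair_mem (A := leftAct k V r N) fun i hi => sg_mem_leftAct hc (by omega)) x hx).2 _

/-- The bihomogeneous components of the comultiplication. -/
theorem mulDeg_comul (hc : c.NormLE 1) (n l : ℕ) {N : ℕ} {x : TAlg k V r} (hx : x ∈ Deg k V r N) :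
    mulDeg n l (comul hc x) = if n + l = N then (shuf (sg r hc) n l).1 x else 0 := by
  induction N generalizing n l x with
  | zero =>
    refine (deg_ext_rec (f := (mulDeg n l).comp (comul hc)) (g := if n + l = 0 then
      End1.toB (shuf (sg r hc) n l) else 0) (by omega) (fun _ => ?_)
      hx).trans (by split_ifs <;> rfl)
    rw [BMap.comp_apply, comul_one, mulDeg_of_mem one_mem_deg one_mem_deg, m_one]
    by_cases h : n + l = 0
    · obtain ⟨rfl, rfl⟩ : n = 0 ∧ l = 0 := by omega
      simp [shuf_zero_left]
    · rw [if_neg (by omega), if_neg h]; rfl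
  | succ N ih =>
    refine (deg_ext_rec (f := (mulDeg n l).comp (comul hc)) (g := if n + l = N + 1 then
      End1.toB (shuf (sg r hc) n l) else 0)
      (fun N' x v hN hz => ?_) (by omega) hx).trans (by split_ifs <;> rfl)
    obtain rfl : N' = N := by omega
    have hg : (if n + l = N' + 1 then End1.toB (shuf (sg r hc) n l) else
        0 : BMap k (TAlg k V r) (TAlg k V r)) (m x (inclV v)) =
        if n + l = N' + 1 then (shuf (sg r hc) n l).1 (m x (inclV v)) else 0 := by
      split_ifs <;> rfl
    -- Multiplicativity of Δ together with Δ(v) = 1 ⊗ v + v ⊗ 1 reproduces the recursion that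
    -- defines `shuf`. When one leg is empty only one of the two summands contributes.
    rw [hg, BMap.comp_apply, comul_mV hc hz, comulV_apply, map_add, map_add, map_add]
    match n, l with
    | 0, 0 => rw [mulDeg_zero_mulSq_one_inclV, mulDeg_zero_mulSq_inclV_one]; simp
    | 0, l + 1 =>
      rw [mulDeg_zero_mulSq_inclV_one, mulDeg_mulSq_one_inclV, ih _ _ hz, shuf_zero_left,
        shuf_zero_left, add_zero]
      by_cases h : 0 + l = N'
      · simp [h, show 0 + (l + 1) = N' + 1 by omega]
      · rw [if_neg h, if_neg (by omega), zero_m]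
    | n + 1, 0 =>
      rw [mulDeg_mulSq_inclV_one, mulDeg_zero_mulSq_one_inclV, ih _ _ hz, shuf_zero_right,
        shuf_zero_right, zero_add]
      by_cases h : n + 0 = N'
      · rw [if_pos h, if_pos (by omega)]; rfl
      · rw [if_neg h, if_neg (by omega), zero_m, map_zero]
    | n + 1, l + 1 =>
      rw [mulDeg_mulSq_inclV_one, mulDeg_mulSq_one_inclV, ih _ _ hz, ih _ _ hz]
      by_cases h : n + 1 + l = N'
      · rw [if_pos h, if_pos (by omega), if_pos (by omega), shuf_succ, End1.add_apply,
          End1.mul_apply, shuf_mV hc (by omega) hz, shuf_mV hc (by omega) hz]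
      · rw [if_neg h, if_neg (by omega), if_neg (by omega), zero_m, map_zero, add_zero]

theorem cross_mV (hc : c.NormLE 1) {n l N : ℕ} (h : n + l ≤ N) {x : TAlg k V r}
    (hx : x ∈ Deg k V r N) (v : V) :
    (cross (sg r hc) n l).1 (m x (inclV v)) = m ((cross (sg r hc) n l).1 x) (inclV v) :=
  ((cross_pair_mem (A := leftAct k V r N) fun i hi => sg_mem_leftAct hc (by omega)) x hx).2 _

/-- Each additional vector on the right crosses the n factors of a that already stand behind l
others, which is `cyc σ l n`. This is the recursion of `cross`. -/
theorem mul_map_braidPow (hc : c.NormLE 1) {n l : ℕ} (a : tpow k V n) (b : tpow k V l) :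
    mul (CTensor.map (inc r l) (inc r n) (braidPow c n l (CTensor.tmul a b))) =
      (cross (sg r hc) n l).1 (m (inc r n a) (inc r l b)) := by
  induction l with
  | zero =>
    rw [braidPow_zero, CTensor.map_tmul, mul_tmul, inc_zero, m_smul, m_one, smul_m, one_m]
    rfl
  | succ l ih =>
    refine tpow_hom_ext (f := mul.comp ((CTensor.map (inc r (l + 1)) (inc r n)).comp
      ((braidPow c n (l + 1)).comp (CTensor.tmulL _ a))))
      (g := (End1.toB (cross (sg r hc) n (l + 1))).comp ((mL (inc r n a)).comp (inc r (l + 1))))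
      (fun b v => ?_) b
    simp only [BMap.comp_apply, CTensor.tmulL_apply, End1.toB_apply, mL_apply]
    rw [braidPow_snoc, inc_snoc, m_assocV, cross, End1.mul_apply,
      cross_mV hc le_rfl (m_mem_deg (inc_mem_deg a) (inc_mem_deg b)), ← ih]
    refine CTensor.hom_ext_apply
      (f := mul.comp ((CTensor.map (inc r (l + 1)) (inc r n)).comp ((CTensor.map
        (tpowSuccInv k l) (BMap.id k (tpow k V n))).comp (CTensor.assocInv.comp ((CTensor.map
          (BMap.id k (tpow k V l)) (braidOne c n)).comp (CTensor.assoc.comp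
            (CTensor.tmulR _ v)))))))
      (g := (End1.toB (cyc (sg r hc) l n)).comp ((mR (inclV v)).comp
        (mul.comp (CTensor.map (inc r l) (inc r n))))) (fun d e => ?_) _
    simp only [BMap.comp_apply, CTensor.tmulR_apply, CTensor.assoc_tmul, CTensor.map_tmul,
      BMap.id_apply, mul_tmul, mR_apply, End1.toB_apply, CTensor.assocInv_tmul_left]
    rw [← splice_braidOne hc (inc_mem_deg d)]
    refine CTensor.hom_ext_apply
      (f := mul.comp ((CTensor.map (inc r (l + 1)) (inc r n)).comp ((CTensor.map
        (tpowSuccInv k l) (BMap.id k (tpow k V n))).comp (CTensor.assocInvAux d))))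
      (g := splice (inc r l d) n) (fun w e => ?_) _
    simp only [BMap.comp_apply, CTensor.assocInvAux_tmul, CTensor.map_tmul, BMap.id_apply,
      mul_tmul]
    rw [splice_tmul, ← inc_snoc]
    rfl

/-- The bihomogeneous components of the pre-braiding. -/
theorem mulDeg_braid (hc : c.NormLE 1) (i j : ℕ) {n l : ℕ} {x y : TAlg k V r}
    (hx : x ∈ Deg k V r n) (hy : y ∈ Deg k V r l) :
    mulDeg i j (braid hc (CTensor.tmul x y)) =
      if i = l ∧ j = n then (cross (sg r hc) n l).1 (m x y) else 0 := by
  obtain ⟨a, rfl⟩ := hx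
  obtain ⟨b, rfl⟩ := hy
  change mulDeg i j (braid hc (CTensor.tmul (inc r n a) (inc r l b))) =
    if i = l ∧ j = n then (cross (sg r hc) n l).1 (m (inc r n a) (inc r l b)) else 0
  rw [braid_inc, ← mul_map_braidPow]
  refine (CTensor.hom_ext_apply (f := (mulDeg i j).comp (CTensor.map (inc r l) (inc r n)))
    (g := if i = l ∧ j = n then mul.comp (CTensor.map (inc r l) (inc r n)) else
      0) (fun d e => ?_) _).trans (by split_ifs <;> rfl)
  rw [BMap.comp_apply, CTensor.map_tmul, mulDeg_of_mem (inc_mem_deg d) (inc_mem_deg e)]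
  split_ifs
  · simp
  · rfl

end coalgebra

end TAlg

/-! ### The extension of a bilinear form to a pairing -/

section form

variable {k : Type u} [NormedField k] [IsUltrametricDist k] [CompleteSpace k]
  {V : Type v} [NormedAddCommGroup V] [NormedSpace k V]
  {c : BMap k (CTensor k V V) (CTensor k V V)} {B : BMap k (CTensor k V V) k}

/-- The tensor powers of a bilinear form; tensors of different degrees are orthogonal. -/
def tpowForm (B : BMap k (CTensor k V V) k) : ∀ n l, BMap k (CTensor k (tpow k V n) (tpow k V l)) k
  | 0, 0 => CTensor.smulMap.comp (CTensor.map (tpowZero k) (tpowZero k))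
  | 0, _ + 1 => 0
  | _ + 1, 0 => 0
  | n + 1, l + 1 => CTensor.smulMap.comp ((CTensor.map (tpowForm B n l) B).comp
      ((CTensor.mid CTensor.swap).comp (CTensor.map (tpowSucc k n) (tpowSucc k l))))

theorem smulMap_normLE : (CTensor.smulMap : BMap k (CTensor k k k) k).NormLE 1 :=
  CTensor.lift_normLE _ _ zero_le_one fun a b => by simp

/-- Each pair of factors contributes at most rs, which exactly balances the weights of the two
algebras. This is where the bound on the form enters; it makes the extension to the completed
algebras bounded. -/
theorem tpowForm_normLE {r s : {r : ℝ // 0 < r}} (hB : B.NormLE ((r : ℝ) * (s : ℝ))) :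
    ∀ n l, (tpowForm B n l).NormLE ((r : ℝ) ^ n * (s : ℝ) ^ l)
  | 0, 0 => by
    rw [tpowForm, pow_zero, pow_zero, one_mul]
    exact smulMap_normLE.comp_one (CTensor.map_normLE_one tpowZero_normLE tpowZero_normLE)
  | 0, l + 1 => fun x => by
    have := r.2; have := s.2
    rw [tpowForm, BMap.zero_apply, norm_zero]; positivity
  | n + 1, 0 => fun x => by
    have := r.2; have := s.2
    rw [tpowForm, BMap.zero_apply, norm_zero]; positivity
  | n + 1, l + 1 => by
    have hr := r.2; have hs := s.2
    rw [tpowForm]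
    refine smulMap_normLE.comp_one ?_
    have h := BMap.NormLE.comp (by positivity) (CTensor.map_normLE (by positivity) (by positivity)
      (tpowForm_normLE hB n l) hB)
      ((CTensor.mid_normLE (E := tpow k V n) (H := V) (CTensor.swap_normLE (k := k) (E := V)
        (F := tpow k V l))).comp_one
        (CTensor.map_normLE_one (tpowSucc_normLE (k := k) (V := V) n) (tpowSucc_normLE l)))
    convert h using 1
    ring

theorem tpowForm_zero (a b : tpow k V 0) :
    tpowForm B 0 0 (CTensor.tmul a b) = tpowZero k a * tpowZero k b := by simp [tpowForm]

theorem tpowForm_snoc {n l : ℕ} (a : tpow k V n) (b : tpow k V l) (v w : V) :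
    tpowForm B (n + 1) (l + 1) (CTensor.tmul (snoc a v) (snoc b w)) =
      tpowForm B n l (CTensor.tmul a b) * B (CTensor.tmul v w) := by simp [tpowForm, snoc]

theorem tpow_hom_ext₂ {n l : ℕ} {G : Type*} [NormedAddCommGroup G] [NormedSpace k G]
    {f g : BMap k (CTensor k (tpow k V (n + 1)) (tpow k V (l + 1))) G}
    (h : ∀ a v b w, f (CTensor.tmul (snoc a v) (snoc b w)) =
      g (CTensor.tmul (snoc a v) (snoc b w)))
    (x : tpow k V (n + 1)) (y : tpow k V (l + 1)) :
    f (CTensor.tmul x y) = g (CTensor.tmul x y) :=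
  tpow_hom_ext (f := f.comp (CTensor.tmulR _ y)) (g := g.comp (CTensor.tmulR _ y)) (fun a v =>
    tpow_hom_ext (f := f.comp (CTensor.tmulL _ (snoc a v)))
      (g := g.comp (CTensor.tmulL _ (snoc a v))) (fun b w => h a v b w) y) x

theorem tpowForm_of_ne {n l : ℕ} (h : n ≠ l) (a : tpow k V n) (b : tpow k V l) :
    tpowForm B n l (CTensor.tmul a b) = 0 := by
  induction n generalizing l with
  | zero => cases l with
    | zero => omega
    | succ l => rfl
  | succ n ih => cases l with
    | zero => rfl
    | succ l =>
      refine tpow_hom_ext₂ (f := tpowForm B (n + 1) (l + 1)) (g := 0) (fun a v b w => ?_) a b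
      rw [tpowForm_snoc, ih (by omega), zero_mul]
      rfl

theorem tpowForm_symm (hB : ∀ v w, B (CTensor.tmul v w) = B (CTensor.tmul w v)) {n l : ℕ}
    (a : tpow k V n) (b : tpow k V l) :
    tpowForm B n l (CTensor.tmul a b) = tpowForm B l n (CTensor.tmul b a) := by
  by_cases h : n = l
  · subst h
    induction n with
    | zero => rw [tpowForm_zero, tpowForm_zero, mul_comm]
    | succ n ih =>
      refine tpow_hom_ext₂ (f := tpowForm B (n + 1) (n + 1))
        (g := (tpowForm B (n + 1) (n + 1)).comp CTensor.swap) (fun a v b w => ?_) a b |>.trans (by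
            simp)
      rw [BMap.comp_apply, CTensor.swap_tmul, tpowForm_snoc, tpowForm_snoc, ih, hB]
  · rw [tpowForm_of_ne h, tpowForm_of_ne (Ne.symm h)]

end form

namespace TAlg

section pairing

variable {k : Type u} [NormedField k] [IsUltrametricDist k] [CompleteSpace k]
  {V : Type v} [NormedAddCommGroup V] [NormedSpace k V]
  {c : BMap k (CTensor k V V) (CTensor k V V)} {B : BMap k (CTensor k V V) k}
  {r s : {r : ℝ // 0 < r}}

/-- The form on the tensor algebra given by the tensor powers of a bilinear form. -/
def tensorForm (hB : B.NormLE ((r : ℝ) * (s : ℝ))) :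
    BMap k (CTensor k (TAlg k V r) (TAlg k V s)) k :=
  C0Sum.lift₂ (tpowForm B) (tpowForm_normLE hB)

variable (hB : B.NormLE ((r : ℝ) * (s : ℝ)))

theorem tensorForm_inc {n l : ℕ} (a : tpow k V n) (b : tpow k V l) :
    tensorForm hB (CTensor.tmul (inc r n a) (inc s l b)) = tpowForm B n l (CTensor.tmul a b) := by
  rw [tensorForm, C0Sum.lift₂_tmul_incl]

theorem tensorForm_of_ne {n l : ℕ} (h : n ≠ l) {x : TAlg k V r} {y : TAlg k V s}
    (hx : x ∈ Deg k V r n) (hy : y ∈ Deg k V s l) : tensorForm hB (CTensor.tmul x y) = 0 := by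
  obtain ⟨a, rfl⟩ := hx
  obtain ⟨b, rfl⟩ := hy
  exact (tensorForm_inc hB a b).trans (tpowForm_of_ne h a b)

theorem tensorForm_one_one : tensorForm hB (CTensor.tmul one one) = 1 :=
  (tensorForm_inc hB (tpowZeroInv k 1) (tpowZeroInv k 1)).trans (by simp [tpowForm_zero])

theorem tensorForm_mV (x : TAlg k V r) (y : TAlg k V s) (v w : V) :
    tensorForm hB (CTensor.tmul (m x (inclV v)) (m y (inclV w))) =
      tensorForm hB (CTensor.tmul x y) * B (CTensor.tmul v w) := by
  refine (hom_ext_inc₂ (f := (tensorForm hB).comp (CTensor.map (mR (inclV v)) (mR (inclV w))))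
    (g := BMap.comp ⟨LinearMap.mulRight k (B (CTensor.tmul v w)), ‖B (CTensor.tmul v w)‖,
      fun x => by simp [mul_comm]⟩ (tensorForm hB)) (fun n a l b => ?_)
    (CTensor.tmul x y)).trans rfl |> fun h => by simpa using h
  rw [BMap.comp_apply, CTensor.map_tmul, mR_apply, mR_apply, ← inc_snoc, ← inc_snoc, tensorForm_inc,
    tpowForm_snoc, BMap.comp_apply, tensorForm_inc]
  rfl

/-- A property of pairs of homogeneous elements of the same degree can be checked by induction
on the degree. -/
theorem deg_ext_rec₂ {G : Type*} [NormedAddCommGroup G] [NormedSpace k G]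
    {f g : BMap k (CTensor k (TAlg k V r) (TAlg k V s)) G} {n : ℕ}
    (h : ∀ n' x v y w, n = n' + 1 → x ∈ Deg k V r n' → y ∈ Deg k V s n' →
      f (CTensor.tmul (m x (inclV v)) (m y (inclV w))) =
        g (CTensor.tmul (m x (inclV v)) (m y (inclV w))))
    (h0 : n = 0 → f (CTensor.tmul one one) = g (CTensor.tmul one one))
    {x : TAlg k V r} {y : TAlg k V s} (hx : x ∈ Deg k V r n) (hy : y ∈ Deg k V s n) :
    f (CTensor.tmul x y) = g (CTensor.tmul x y) :=
  deg_ext_rec (f := f.comp (CTensor.tmulR _ y)) (g := g.comp (CTensor.tmulR _ y))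
    (fun n' x v hn hx => deg_ext_rec (f := f.comp (CTensor.tmulL _ (m x (inclV v))))
      (g := g.comp (CTensor.tmulL _ (m x (inclV v))))
      (fun n'' y w hn' hy => by
        obtain rfl : n' = n'' := by omega
        exact h n' x v y w hn hx hy) (by omega) hy)
    (fun hn => deg_ext_rec (f := f.comp (CTensor.tmulL _ one))
      (g := g.comp (CTensor.tmulL _ one)) (by omega) h0 hy) hx

/-- The form pairs factors position by position. With left factors of the same degree n, the
positions on both sides match and the form splits as a product. -/
theorem tensorForm_m {n i j : ℕ} {x x' : TAlg k V r} {y y' : TAlg k V s} (hx : x ∈ Deg k V r n)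
    (hy : y ∈ Deg k V s n) (hx' : x' ∈ Deg k V r i) (hy' : y' ∈ Deg k V s j) :
    tensorForm hB (CTensor.tmul (m x x') (m y y')) =
      tensorForm hB (CTensor.tmul x y) * tensorForm hB (CTensor.tmul x' y') := by
  by_cases hij : i = j
  swap
  · rw [tensorForm_of_ne hB hij hx' hy', mul_zero,
      tensorForm_of_ne hB (by omega) (m_mem_deg hx hx') (m_mem_deg hy hy')]
  subst hij
  let g : BMap k (CTensor k (TAlg k V r) (TAlg k V s)) k :=
    BMap.comp ⟨LinearMap.mulLeft k (tensorForm hB (CTensor.tmul x y)), ‖tensorForm hB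
        (CTensor.tmul x y)‖,
      fun x => by simp⟩ (tensorForm hB)
  have hg : ∀ x' y', g (CTensor.tmul x' y') =
    tensorForm hB (CTensor.tmul x y) * tensorForm hB (CTensor.tmul x' y') := fun x' y' => rfl
  rw [← hg]
  induction i generalizing x' y' with
  | zero =>
    refine (deg_ext_rec₂ (f := (tensorForm hB).comp (CTensor.map (mL x) (mL y)))
      (g := g) (by omega) (fun _ => ?_) hx' hy') |> fun h => by simpa using h
    rw [BMap.comp_apply, CTensor.map_tmul, mL_apply, mL_apply, m_one, m_one, hg, tensorForm_one_one,
      mul_one]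
  | succ i ih =>
    refine (deg_ext_rec₂ (f := (tensorForm hB).comp (CTensor.map (mL x) (mL y)))
      (g := g) (fun i' x₁ v y₁ w hi hx₁ hy₁ => ?_) (by omega) hx' hy') |> fun h => by simpa using h
    obtain rfl : i' = i := by omega
    rw [BMap.comp_apply, CTensor.map_tmul, mL_apply, mL_apply, m_assocV, m_assocV, tensorForm_mV,
      ih hx₁ hy₁, hg, hg, tensorForm_mV, mul_assoc]

theorem tensorForm_symm (hsymm : ∀ v w, B (CTensor.tmul v w) = B (CTensor.tmul w v))
    (hB' : B.NormLE ((s : ℝ) * (r : ℝ))) (x : TAlg k V r) (y : TAlg k V s) :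
    tensorForm hB (CTensor.tmul x y) = tensorForm hB' (CTensor.tmul y x) := by
  refine (hom_ext_inc₂ (f := tensorForm hB) (g := (tensorForm hB').comp CTensor.swap) (fun n a l b
      => ?_)
    (CTensor.tmul x y)) |> fun h => by simpa using h
  rw [BMap.comp_apply, CTensor.swap_tmul, tensorForm_inc, tensorForm_inc, tpowForm_symm hsymm]

theorem tensorForm_app (x : TAlg k V r) (y : TAlg k V s) (z w : CTensor k V V) :
    tensorForm hB (CTensor.tmul (app x z) (app y w)) =
      tensorForm hB (CTensor.tmul x y) * pairSq B (CTensor.tmul z w) := by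
  let g : BMap k (CTensor k (CTensor k V V) (CTensor k V V)) k :=
    BMap.comp ⟨LinearMap.mulLeft k (tensorForm hB (CTensor.tmul x y)), ‖tensorForm hB
        (CTensor.tmul x y)‖,
      fun x => by simp⟩ (pairSq B)
  have hg : ∀ z, g z = tensorForm hB (CTensor.tmul x y) * pairSq B z := fun z => rfl
  rw [← hg]
  refine CTensor.hom_ext_apply (f := (tensorForm hB).comp ((CTensor.tmulR _ (app y w)).comp (app
      x)))
    (g := g.comp (CTensor.tmulR _ w)) (fun v₁ v₂ => ?_) z
  refine CTensor.hom_ext_apply (f := (tensorForm hB).comp ((CTensor.tmulL _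
    (app x (CTensor.tmul v₁ v₂))).comp (app y)))
    (g := g.comp (CTensor.tmulL _ (CTensor.tmul v₁ v₂))) (fun w₁ w₂ => ?_) w
  simp only [BMap.comp_apply, CTensor.tmulL_apply]
  rw [hg, app_tmul, app_tmul, tensorForm_mV, tensorForm_mV, pairSq_tmul, mul_assoc]

/-- The operators `c` are self-adjoint. -/
theorem tensorForm_sg (hc : c.NormLE 1) (hcomp : ∀ x y : CTensor k V V,
      pairSq B (CTensor.tmul (c x) y) = pairSq B (CTensor.tmul x (c y)))
    (i : ℕ) (x : TAlg k V r) (y : TAlg k V s) :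
    tensorForm hB (CTensor.tmul ((sg r hc i).1 x) y) = tensorForm hB (CTensor.tmul x ((sg s hc
        i).1 y)) := by
  let f := (tensorForm hB).comp (CTensor.map (End1.toB (sg r hc i)) (BMap.id k _))
  let g := (tensorForm hB).comp (CTensor.map (BMap.id k _) (End1.toB (sg s hc i)))
  have hf : ∀ x y, f (CTensor.tmul x y) = tensorForm hB (CTensor.tmul ((sg r hc i).1 x) y) :=
    fun x y => by simp [f]
  have hg : ∀ x y, g (CTensor.tmul x y) = tensorForm hB (CTensor.tmul x ((sg s hc i).1 y)) :=
    fun x y => by simp [g]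
  have key : ∀ n (x : TAlg k V r) (y : TAlg k V s), x ∈ Deg k V r n → y ∈ Deg k V s n →
      f (CTensor.tmul x y) = g (CTensor.tmul x y) := by
    intro n
    induction n with
    | zero =>
      intro x y hx hy
      rw [hf, hg, sg_eq_zero hc (by omega) hx, sg_eq_zero hc (by omega) hy]
      simp
    | succ n ih =>
      intro x y hx hy
      refine deg_ext_rec₂ (fun n₁ x₁ v y₁ w hn hx₁ hy₁ => ?_) (by omega) hx hy
      obtain rfl : n = n₁ := by omega
      -- If the operator acts on the last two positions, both trailing pairs are removed at once and
      -- the compatibility of the form with c is used. Otherwise the last vectors are spectators and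
      -- the induction hypothesis applies.
      by_cases hi : i + 1 = n
      · have h2 := deg_ext_rec₂ (f := f.comp (CTensor.map (mR (inclV v)) (mR (inclV w))))
          (g := g.comp (CTensor.map (mR (inclV v)) (mR (inclV w)))) (n := n)
          (fun n₂ x₂ v' y₂ w' hn₂ hx₂ hy₂ => by
            obtain rfl : i = n₂ := by omega
            simp only [BMap.comp_apply, CTensor.map_tmul, mR_apply]
            rw [hf, hg, ← app_tmul, ← app_tmul, sg_app hc hx₂, sg_app hc hy₂, tensorForm_app,
                tensorForm_app,
              hcomp]) (by omega) hx₁ hy₁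
        simpa using h2
      · rw [hf, hg, sg_mV hc hi hx₁, sg_mV hc hi hy₁, tensorForm_mV, tensorForm_mV, ← hf, ← hg, ih
          x₁ y₁ hx₁ hy₁]
  rw [← hf, ← hg]
  refine hom_ext_inc₂ (fun n a l b => ?_) (CTensor.tmul x y)
  by_cases h : n = l
  · subst h
    exact key n _ _ (inc_mem_deg a) (inc_mem_deg b)
  · rw [hf, hg, tensorForm_of_ne hB h (sg_mem_deg hc i (inc_mem_deg a)) (inc_mem_deg b),
      tensorForm_of_ne hB h (inc_mem_deg a) (sg_mem_deg hc i (inc_mem_deg b))]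

/-- The pairs of adjoint operators. -/
def adj : Subring (End1 k (TAlg k V r) × (End1 k (TAlg k V s))ᵐᵒᵖ) where
  carrier := {p | ∀ x y, tensorForm hB (CTensor.tmul (p.1.1 x) y) =
    tensorForm hB (CTensor.tmul x (p.2.unop.1 y))}
  one_mem' := fun x y => rfl
  zero_mem' := fun x y => by simp
  mul_mem' {p q} hp hq x y := by
    change tensorForm hB (CTensor.tmul (p.1.1 (q.1.1 x)) y) =
      tensorForm hB (CTensor.tmul x (q.2.unop.1 (p.2.unop.1 y)))
    rw [hp, hq]
  add_mem' {p q} hp hq x y := by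
    change tensorForm hB (CTensor.tmul (p.1.1 x + q.1.1 x) y) =
      tensorForm hB (CTensor.tmul x (p.2.unop.1 y + q.2.unop.1 y))
    rw [map_add, map_add, LinearMap.add_apply, map_add, map_add, hp, hq]
  neg_mem' {p} hp x y := by
    change tensorForm hB (CTensor.tmul (-p.1.1 x) y) = tensorForm hB (CTensor.tmul x (-p.2.unop.1
        y))
    rw [map_neg, map_neg, LinearMap.neg_apply, map_neg, map_neg, hp]

/-! ### The symmetrizer -/

/-- Evaluating polynomials in the σ_i commutes with assembling operators degree by degree. So the
symmetrizer, which uses a different polynomial in each degree, may be replaced on degree n by one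
polynomial in the global operators. -/
theorem symz_sg (hc : c.NormLE 1) (n : ℕ) :
    symz (sg r hc) n = diag r fun N => symz (sig hc N) n := by
  have h := map_symz (diag (k := k) (V := V) r) (fun i N => sig hc N i) n
  have h2 : symz (fun i N => sig hc N i) n = fun N => symz (sig hc N) n :=
    funext fun N => map_symz (Pi.evalRingHom _ N) (fun i N => sig hc N i) n
  rw [h2] at h
  exact h.symm

/-- The braided symmetrizer on `T_r(V)`. -/
def symmetrizer (r : {r : ℝ // 0 < r}) (hc : c.NormLE 1) : End1 k (TAlg k V r) :=
  diag r fun n => symz (sig hc n) n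

theorem symmetrizer_of_mem (hc : c.NormLE 1) {n : ℕ} {x : TAlg k V r} (hx : x ∈ Deg k V r n) :
    (symmetrizer r hc).1 x = (symz (sg r hc) n).1 x := by
  obtain ⟨a, rfl⟩ := hx
  change (symmetrizer r hc).1 (inc r n a) = (symz (sg r hc) n).1 (inc r n a)
  rw [symz_sg, symmetrizer, diag_inc, diag_inc]

theorem symmetrizer_mem_deg (hc : c.NormLE 1) {n : ℕ} {x : TAlg k V r} (hx : x ∈ Deg k V r n) :
    (symmetrizer r hc).1 x ∈ Deg k V r n := diag_mem_deg _ hx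

theorem symz_mul_m (hc : c.NormLE 1) {n l : ℕ} {x y : TAlg k V r} (hx : x ∈ Deg k V r n)
    (hy : y ∈ Deg k V r l) :
    (symz (sg r hc) n * symz (fun i => sg r hc (n + i)) l).1 (m x y) =
      m ((symmetrizer r hc).1 x) ((symmetrizer r hc).1 y) := by
  have h1 := ((symz_pair_mem (A := rightAct k V r n l) (n := l) fun i hi =>
    sg_mem_rightAct hc (by omega)) y hy).2 x hx
  have h2 := ((symz_pair_mem (A := leftAct k V r n) (n := n) fun i hi =>
    sg_mem_leftAct hc (by omega)) x hx).2 ((symz (sg r hc) l).1 y)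
  rw [End1.mul_apply, h1, h2, symmetrizer_of_mem hc hx, symmetrizer_of_mem hc hy]

/-! ### The pairing (x | S y) and the Hopf pairing identities -/

variable {c : BMap k (CTensor k V V) (CTensor k V V)} (hc : c.NormLE 1)

/-- The extension of a bilinear form to the tensor algebra. -/
def pairing : BMap k (CTensor k (TAlg k V r) (TAlg k V s)) k :=
  (tensorForm hB).comp (CTensor.map (BMap.id k _) (End1.toB (symmetrizer s hc)))

theorem pairing_tmul (x : TAlg k V r) (y : TAlg k V s) :
    pairing hB hc (CTensor.tmul x y) = tensorForm hB (CTensor.tmul x ((symmetrizer s hc).1 y)) := by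
  simp [pairing]

theorem pairing_of_ne {n l : ℕ} (h : n ≠ l) {x : TAlg k V r} {y : TAlg k V s}
    (hx : x ∈ Deg k V r n) (hy : y ∈ Deg k V s l) : pairing hB hc (CTensor.tmul x y) = 0 := by
  rw [pairing_tmul, tensorForm_of_ne hB h hx (symmetrizer_mem_deg hc hy)]

theorem pairing_degProj (n : ℕ) (x : TAlg k V r) (y : TAlg k V s) :
    pairing hB hc (CTensor.tmul (degProj n x) y) =
      pairing hB hc (CTensor.tmul x (degProj n y)) := by
  refine (hom_ext_inc₂ (f := (pairing hB hc).comp (CTensor.map (degProj n) (BMap.id k _)))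
    (g := (pairing hB hc).comp (CTensor.map (BMap.id k _) (degProj n))) (fun i a j b => ?_)
    (CTensor.tmul x y)) |> fun h => by simpa using h
  simp only [BMap.comp_apply, CTensor.map_tmul, BMap.id_apply, degProj_inc]
  by_cases hij : i = j
  · subst hij
    split_ifs <;> simp
  · have := pairing_of_ne hB hc hij (inc_mem_deg a) (inc_mem_deg b)
    split_ifs <;> simp [this]

/-- Only the component of z in bidegree (n, l) pairs non-trivially with x ⊗ x'. On it the two
symmetrizers act on the separate legs, which after concatenation is S_n times the shifted S_l.
Pairings of tensors thereby become values of the form on the tensor algebra. -/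
theorem pairSq_pairing_left {n l : ℕ} {x x' : TAlg k V r} (hx : x ∈ Deg k V r n)
    (hx' : x' ∈ Deg k V r l) (z : CTensor k (TAlg k V s) (TAlg k V s)) :
    pairSq (pairing hB hc) (CTensor.tmul (CTensor.tmul x x') z) = tensorForm hB (CTensor.tmul (m x
        x')
      ((symz (sg s hc) n * symz (fun i => sg s hc (n + i)) l).1 (mulDeg n l z))) := by
  refine hom_ext_inc₂ (f := (pairSq (pairing hB hc)).comp (CTensor.tmulL _ (CTensor.tmul x x')))
    (g := (tensorForm hB).comp ((CTensor.tmulL _ (m x x')).comp ((End1.toB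
      (symz (sg s hc) n * symz (fun i => sg s hc (n + i)) l)).comp (mulDeg n l))))
    (fun i a j b => ?_) z
  simp only [BMap.comp_apply, CTensor.tmulL_apply, End1.toB_apply]
  rw [pairSq_tmul, mulDeg_of_mem (inc_mem_deg a) (inc_mem_deg b)]
  split_ifs with h
  · obtain ⟨rfl, rfl⟩ := h
    rw [symz_mul_m hc (inc_mem_deg a) (inc_mem_deg b), tensorForm_m hB hx (symmetrizer_mem_deg hc
        (inc_mem_deg a))
      hx' (symmetrizer_mem_deg hc (inc_mem_deg b)), pairing_tmul, pairing_tmul]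
  · rw [map_zero, map_zero, map_zero]
    by_cases hn : n = i
    · rw [pairing_of_ne hB hc (n := l) (l := j) (by tauto) hx' (inc_mem_deg b), mul_zero]
    · rw [pairing_of_ne hB hc hn hx (inc_mem_deg a), zero_mul]

theorem pairSq_pairing_right {n l : ℕ} {y y' : TAlg k V s} (hy : y ∈ Deg k V s n)
    (hy' : y' ∈ Deg k V s l) (z : CTensor k (TAlg k V r) (TAlg k V r)) :
    pairSq (pairing hB hc) (CTensor.tmul z (CTensor.tmul y y')) = tensorForm hB (CTensor.tmul
        (mulDeg n l z)
      ((symz (sg s hc) n * symz (fun i => sg s hc (n + i)) l).1 (m y y'))) := by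
  rw [symz_mul_m hc hy hy']
  refine hom_ext_inc₂ (f := (pairSq (pairing hB hc)).comp (CTensor.tmulR _ (CTensor.tmul y y')))
    (g := (tensorForm hB).comp ((CTensor.tmulR _ (m ((symmetrizer s hc).1 y) ((symmetrizer s hc).1
        y'))).comp (mulDeg n l)))
    (fun i a j b => ?_) z
  simp only [BMap.comp_apply, CTensor.tmulR_apply]
  rw [pairSq_tmul, mulDeg_of_mem (inc_mem_deg a) (inc_mem_deg b)]
  split_ifs with h
  · obtain ⟨rfl, rfl⟩ := h
    rw [tensorForm_m hB (inc_mem_deg a) (symmetrizer_mem_deg hc hy) (inc_mem_deg b)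
        (symmetrizer_mem_deg hc hy'),
      pairing_tmul, pairing_tmul]
  · rw [map_zero, LinearMap.zero_apply, map_zero]
    by_cases hn : i = n
    · rw [pairing_of_ne hB hc (n := j) (l := l) (fun h' => h ⟨hn.symm, h'.symm⟩) (inc_mem_deg b)
        hy', mul_zero]
    · rw [pairing_of_ne hB hc hn (inc_mem_deg a) hy, zero_mul]

variable (hbr : IsPreBraiding c) (hcomp : ∀ x y : CTensor k V V,
      pairSq B (CTensor.tmul (c x) y) = pairSq B (CTensor.tmul x (c y)))
  (hsymm : ∀ v w, B (CTensor.tmul v w) = B (CTensor.tmul w v))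

include hbr

/-- In degree n + l the left side contains S_{n+l} y and the right side (S_n ⊗ S_l) applied to the
shuffle component of Δy. They agree by `IsBraid.symz_add`; in other degrees both sides vanish. -/
theorem pairing_mul_left (x x' : TAlg k V r) (y : TAlg k V s) :
    pairing hB hc (CTensor.tmul (mul (CTensor.tmul x x')) y) =
      pairSq (pairing hB hc) (CTensor.tmul (CTensor.tmul x x') (comul hc y)) := by
  refine hom_ext_inc₂ (f := (pairing hB hc).comp ((CTensor.tmulR _ y).comp mul))
    (g := (pairSq (pairing hB hc)).comp (CTensor.tmulR _ (comul hc y))) (fun n a l b => ?_)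
    (CTensor.tmul x x')
  refine hom_ext_inc (f := (pairing hB hc).comp (CTensor.tmulL _
      (mul (CTensor.tmul (inc r n a) (inc r l b)))))
    (g := (pairSq (pairing hB hc)).comp ((CTensor.tmulL _
      (CTensor.tmul (inc r n a) (inc r l b))).comp (comul hc))) (fun N d => ?_) y
  simp only [BMap.comp_apply, CTensor.tmulL_apply, mul_tmul]
  rw [pairSq_pairing_left hB hc (inc_mem_deg a) (inc_mem_deg b),
    mulDeg_comul hc n l (inc_mem_deg d)]
  split_ifs with h
  · subst h
    rw [pairing_tmul, symmetrizer_of_mem hc (inc_mem_deg d), (sg_isBraid hc hbr).symz_add]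
    rfl
  · rw [map_zero, map_zero, map_zero,
      pairing_of_ne hB hc h (m_mem_deg (inc_mem_deg a) (inc_mem_deg b)) (inc_mem_deg d)]

include hcomp

theorem tensorForm_symmetrizer (x : TAlg k V r) (y : TAlg k V s) :
    tensorForm hB (CTensor.tmul ((symmetrizer r hc).1 x) y) = tensorForm hB (CTensor.tmul x
        ((symmetrizer s hc).1 y)) := by
  refine (hom_ext_inc₂ (f := (tensorForm hB).comp (CTensor.map (End1.toB (symmetrizer r hc))
      (BMap.id k _)))
    (g := (tensorForm hB).comp (CTensor.map (BMap.id k _) (End1.toB (symmetrizer s hc)))) (fun n a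
        l b => ?_)
    (CTensor.tmul x y)) |> fun h => by simpa using h
  simp only [BMap.comp_apply, CTensor.map_tmul, BMap.id_apply, End1.toB_apply]
  by_cases h : n = l
  · subst h
    have h1 := (symz_pair_mem (A := adj hB) (n := n) (σ := sg r hc)
      (σ' := fun i => MulOpposite.op (sg s hc i))
      fun i _ => tensorForm_sg hB hc hcomp i) (inc r n a) (inc s n b)
    -- Passing to adjoints reverses products, so `adj` yields the symmetrizer with reversed words.
    -- The reversal invariance identifies it with the symmetrizer itself.
    rw [(sg_isBraid hc hbr).symz_op] at h1
    rw [symmetrizer_of_mem hc (inc_mem_deg a), symmetrizer_of_mem hc (inc_mem_deg b)]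
    exact h1
  · rw [tensorForm_of_ne hB h (symmetrizer_mem_deg hc (inc_mem_deg a)) (inc_mem_deg b),
      tensorForm_of_ne hB h (inc_mem_deg a) (symmetrizer_mem_deg hc (inc_mem_deg b))]

/-- The adjoint of the crossing of n and m strands is the crossing of m and n strands, by word
reversal, and crossings commute with the symmetrizers of the two groups. This is what makes the
pre-braiding descend to the quotient by the radical. -/
theorem pairSq_pairing_braid (z : CTensor k (TAlg k V r) (TAlg k V r))
    (w : CTensor k (TAlg k V s) (TAlg k V s)) :
    pairSq (pairing hB hc) (CTensor.tmul (braid hc z) w) =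
      pairSq (pairing hB hc) (CTensor.tmul z (braid hc w)) := by
  refine hom_ext_inc₂ (f := (pairSq (pairing hB hc)).comp ((CTensor.tmulR _ w).comp (braid hc)))
    (g := (pairSq (pairing hB hc)).comp (CTensor.tmulR _ (braid hc w))) (fun n a l b => ?_) z
  refine hom_ext_inc₂ (f := (pairSq (pairing hB hc)).comp (CTensor.tmulL _
      (braid hc (CTensor.tmul (inc r n a) (inc r l b)))))
    (g := (pairSq (pairing hB hc)).comp ((CTensor.tmulL _
      (CTensor.tmul (inc r n a) (inc r l b))).comp (braid hc))) (fun i d j e => ?_) w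
  simp only [BMap.comp_apply, CTensor.tmulL_apply]
  rw [pairSq_pairing_left hB hc (inc_mem_deg a) (inc_mem_deg b),
    pairSq_pairing_right hB hc (inc_mem_deg d) (inc_mem_deg e),
    mulDeg_braid hc _ _ (inc_mem_deg a) (inc_mem_deg b),
    mulDeg_braid hc _ _ (inc_mem_deg d) (inc_mem_deg e)]
  by_cases h : i = l ∧ j = n
  · obtain ⟨rfl, rfl⟩ := h
    rw [if_pos ⟨rfl, rfl⟩, if_pos ⟨rfl, rfl⟩]
    have h1 := (cross_pair_mem (A := adj hB) (n := j) (m := i) (σ := sg r hc)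
      (σ' := fun i => MulOpposite.op (sg s hc i))
      fun i _ => tensorForm_sg hB hc hcomp i) (m (inc r j a) (inc r i b))
        ((symz (sg s hc) i * symz (fun t => sg s hc (i + t)) j).1 (m (inc s i d) (inc s j e)))
    rw [(sg_isBraid hc hbr).cross_op] at h1
    refine h1.trans ?_
    rw [MulOpposite.unop_op, ← End1.mul_apply, (sg_isBraid hc hbr).cross_mul_symz,
      End1.mul_apply]
  · rw [if_neg h, if_neg fun h' => h ⟨h'.2.symm, h'.1.symm⟩]
    simp

include hsymm

theorem pairing_symm (hB' : B.NormLE ((s : ℝ) * (r : ℝ))) (x : TAlg k V r) (y : TAlg k V s) :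
    pairing hB hc (CTensor.tmul x y) = pairing hB' hc (CTensor.tmul y x) := by
  rw [pairing_tmul, pairing_tmul, ← tensorForm_symmetrizer hB hc hbr hcomp, tensorForm_symm hB
      hsymm hB']

theorem pairSq_pairing_symm (hB' : B.NormLE ((s : ℝ) * (r : ℝ)))
    (z : CTensor k (TAlg k V r) (TAlg k V r)) (w : CTensor k (TAlg k V s) (TAlg k V s)) :
    pairSq (pairing hB hc) (CTensor.tmul z w) = pairSq (pairing hB' hc) (CTensor.tmul w z) := by
  refine CTensor.hom_ext_apply (f := (pairSq (pairing hB hc)).comp (CTensor.tmulR _ w))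
    (g := (pairSq (pairing hB' hc)).comp (CTensor.tmulL _ w)) (fun x x' => ?_) z
  refine CTensor.hom_ext_apply
    (f := (pairSq (pairing hB hc)).comp (CTensor.tmulL _ (CTensor.tmul x x')))
    (g := (pairSq (pairing hB' hc)).comp (CTensor.tmulR _ (CTensor.tmul x x')))
    (fun y y' => ?_) w
  simp only [BMap.comp_apply, CTensor.tmulL_apply, CTensor.tmulR_apply]
  rw [pairSq_tmul, pairSq_tmul, pairing_symm hB hc hbr hcomp hsymm hB',
    pairing_symm hB hc hbr hcomp hsymm hB']

omit hsymm hcomp hbr in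
theorem pairing_one_left (y : TAlg k V s) :
    pairing hB hc (CTensor.tmul one y) = counit y := by
  refine hom_ext_inc (f := (pairing hB hc).comp (CTensor.tmulL _ one)) (g := counit)
    (fun n b => ?_) y
  simp only [BMap.comp_apply, CTensor.tmulL_apply]
  by_cases h : n = 0
  · subst h
    rw [inc_zero, map_smul, map_smul, map_smul, pairing_tmul, symmetrizer_of_mem hc one_mem_deg]
    have h1 : counit (one : TAlg k V s) = 1 :=
      by
      simp [counit, one, C0Sum.coord_incl_same]
    rw [h1]
    exact congrArg _ (tensorForm_one_one hB)
  · rw [pairing_of_ne hB hc (Ne.symm h) one_mem_deg (inc_mem_deg b)]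
    exact ((congrArg (tpowZero k) (C0Sum.coord_incl_of_ne (E := fun n => tpow k V n)
      (Ne.symm h) b)).trans (map_zero _)).symm

theorem pairing_isPairingExtending : IsPairingExtending hc B (pairing hB hc) := by
  have hB' : B.NormLE ((s : ℝ) * (r : ℝ)) := by rwa [mul_comm]
  refine ⟨pairing_mul_left hB hc hbr, fun x y y' => ?_, pairing_one_left hB hc, fun x => ?_,
    fun v w => ?_⟩
  -- The second Hopf identity is the first one with the roles of r and s exchanged, through the
  -- symmetry of the pairing.
  · rw [pairing_symm hB hc hbr hcomp hsymm hB', pairing_mul_left hB' hc hbr,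
      pairSq_pairing_symm hB hc hbr hcomp hsymm hB']
  · rw [pairing_symm hB hc hbr hcomp hsymm hB', pairing_one_left]
  · rw [pairing_tmul, symmetrizer_of_mem hc (inclV_mem_deg w)]
    have h1 : symz (sg s hc) 1 = 1 := by simp [symz, ins]
    have h2 := tensorForm_mV hB one one v w
    rw [one_m, one_m, tensorForm_one_one, one_mul] at h2
    rw [h1, End1.one_apply, h2]

end pairing

/-! ### Uniqueness of the pairing -/

section uniqueness

variable {k : Type u} [NormedField k] [IsUltrametricDist k] [CompleteSpace k]
  {V : Type v} [NormedAddCommGroup V] [NormedSpace k V]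
  {c : BMap k (CTensor k V V) (CTensor k V V)} {B : BMap k (CTensor k V V) k}
  {r s : {r : ℝ // 0 < r}}

theorem comul_inclV (hc : c.NormLE 1) (v : V) :
    comul hc (inclV v : TAlg k V r) = comulV v := by
  have h1 : braid hc (CTensor.tmul one (inclV v : TAlg k V r)) = CTensor.tmul (inclV v) one := by
    refine (braid_inclV hc (tpowZeroInv k 1) v).trans ?_
    rw [braidOne, CTensor.swap_tmul, CTensor.map_tmul]
    rfl
  have h := comul_mV hc (one_mem_deg (k := k) (V := V) (r := r)) v
  rw [one_m, comul_one, comulV_apply, map_add, map_add, mulSq_tmul, mulSq_tmul, braid_one, h1,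
    CTensor.map_tmul, CTensor.map_tmul] at h
  simpa [one_m, m_one, comulV_apply] using h

/-- With w in V on the right, Δ(w) = 1 ⊗ w + w ⊗ 1 makes ⟨-, w⟩ a derivation relative to the counit
(`hV`), so its values on V determine it. The identity for ⟨x, yw⟩ then reduces the degree on the
right. -/
theorem pairing_unique (hc : c.NormLE 1) {P P' : BMap k (CTensor k (TAlg k V r) (TAlg k V s)) k}
    (h : IsPairingExtending hc B P) (h' : IsPairingExtending hc B P') : P = P' := by
  have hV : ∀ (Q : BMap k (CTensor k (TAlg k V r) (TAlg k V s)) k),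
      IsPairingExtending hc B Q → ∀ x x' w, Q (CTensor.tmul (m x x') (inclV w)) =
        counit x * Q (CTensor.tmul x' (inclV w)) + Q (CTensor.tmul x (inclV w)) * counit x' :=
    fun Q hQ x x' w => by
      have := hQ.mul_left x x' (inclV w)
      rwa [comul_inclV, comulV_apply, map_add, map_add, pairSq_tmul, pairSq_tmul, hQ.one_right,
        hQ.one_right, mul_tmul] at this
  have hPV : ∀ x w, P (CTensor.tmul x (inclV w)) = P' (CTensor.tmul x (inclV w)) := fun x w => by
    refine hom_ext_rec (f := P.comp (CTensor.tmulR _ (inclV w)))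
      (g := P'.comp (CTensor.tmulR _ (inclV w))) ?_ (fun n ih a v => ?_) x
    · simp only [BMap.comp_apply, CTensor.tmulR_apply]
      rw [h.one_left, h'.one_left]
    · have := ih a
      simp only [BMap.comp_apply, CTensor.tmulR_apply] at this ⊢
      rw [hV P h, hV P' h', h.extend, h'.extend, this]
  have hy : ∀ n (b : tpow k V n) x,
      P (CTensor.tmul x (inc s n b)) = P' (CTensor.tmul x (inc s n b)) := by
    intro n
    induction n with
    | zero =>
      intro b x
      rw [inc_zero, map_smul, map_smul, map_smul, h.one_right, h'.one_right]
    | succ n ih =>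
      intro b x
      refine tpow_hom_ext (f := (P.comp (CTensor.tmulL _ x)).comp (inc s (n + 1)))
        (g := (P'.comp (CTensor.tmulL _ x)).comp (inc s (n + 1))) (fun b w => ?_) b
      simp only [BMap.comp_apply, CTensor.tmulL_apply, inc_snoc]
      rw [← mul_tmul, h.mul_right, h'.mul_right]
      refine CTensor.hom_ext_apply
        (f := (pairSq P).comp (CTensor.tmulR _ (CTensor.tmul (inc s n b) (inclV w))))
        (g := (pairSq P').comp (CTensor.tmulR _ (CTensor.tmul (inc s n b) (inclV w))))
        (fun x x' => ?_) _
      simp only [BMap.comp_apply, CTensor.tmulR_apply]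
      rw [pairSq_tmul, pairSq_tmul, ih, hPV]
  exact DFunLike.ext _ _ (hom_ext_inc₂ fun n a l b => hy l b _)

end uniqueness

end TAlg

/-! ### The radical of a pairing -/

section radical

variable {k : Type*} [NormedField k] {E F : Type*} [NormedAddCommGroup E] [NormedSpace k E]
  [SeminormedAddCommGroup F] [NormedSpace k F] {P : BMap k (CTensor k E F) k}

instance radical.isClosed : IsClosed (radical P : Set E) := by
  have : (radical P : Set E) = ⋂ y, {x | P.comp (CTensor.tmulR E y) x = 0} := by
    ext x
    rw [Set.mem_iInter]
    rfl
  rw [this]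
  exact isClosed_iInter fun y => isClosed_eq (BMap.continuous _) continuous_const

variable [IsUltrametricDist k] [CompleteSpace k]

theorem pairSq_eq_zero_of_mem {a b : E} (h : a ∈ radical P ∨ b ∈ radical P)
    (w : CTensor k F F) : pairSq P (CTensor.tmul (CTensor.tmul a b) w) = 0 :=
  CTensor.hom_ext_apply (f := (pairSq P).comp (CTensor.tmulL _ (CTensor.tmul a b))) (g := 0)
    (fun y y' => by
      refine (pairSq_tmul P a b y y').trans ?_
      rcases h with h | h
      · rw [h y, zero_mul]; rfl
      · rw [h y', mul_zero]; rfl) w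

/-- The elements that are orthogonal to all tensors vanish modulo the radical. -/
theorem map_quot_radical_eq_zero [IsUltrametricDist E] [CompleteSpace E] {z : CTensor k E E}
    (hz : ∀ y y', pairSq P (CTensor.tmul z (CTensor.tmul y y')) = 0) :
    CTensor.map (BMap.quot (radical P)) (BMap.quot (radical P)) z = 0 := by
  -- By definition of the radical these functionals separate the points of the quotient, so their
  -- products separate the points of its completed tensor square.
  let φ : F → BMap k (E ⧸ radical P) k := fun y =>
    (P.comp (CTensor.tmulR E y)).descend fun x hx => hx y
  have hφ : ∀ y x, φ y (BMap.quot _ x) = P (CTensor.tmul x y) := fun y x => rfl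
  have hsep : ∀ x, (∀ y, φ y x = 0) → x = 0 := fun x hx => by
    obtain ⟨x, rfl⟩ := BMap.quot_surjective _ x
    exact BMap.quot_eq_zero.2 hx
  refine CTensor.eq_zero_of_map hsep hsep fun y y' => (Eq.trans ?_ (hz y y'))
  refine CTensor.hom_ext_apply (f := CTensor.smulMap.comp ((CTensor.map (φ y) (φ y')).comp
    (CTensor.map (BMap.quot (radical P)) (BMap.quot (radical P)))))
    (g := (pairSq P).comp (CTensor.tmulR _ (CTensor.tmul y y'))) (fun a b => ?_) z
  refine Eq.trans ?_ (pairSq_tmul P a b y y').symm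
  simp [hφ]

end radical

/-! ### Quotients of the tensor algebra -/

section refl

variable {k : Type*} [NormedField k] {A : Type*} [SeminormedAddCommGroup A] [NormedSpace k A]

theorem CTensor.map_ofIso_refl :
    CTensor.map (BMap.ofIso (LinearIsometryEquiv.refl k A))
      (BMap.ofIso (LinearIsometryEquiv.refl k A)) = BMap.id k (CTensor k A A) :=
  CTensor.hom_ext fun x y => CTensor.map_tmul _ _ x y

theorem BraidedData.isHom_refl (D : BraidedData k A) :
    D.IsHom D (BMap.ofIso (LinearIsometryEquiv.refl k A)) where
  mul := by rw [CTensor.map_ofIso_refl]; rfl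
  one := rfl
  comul := by rw [CTensor.map_ofIso_refl]; rfl
  counit := rfl
  braid := by rw [CTensor.map_ofIso_refl]; rfl
  degProj _ := rfl

end refl

section quotient

variable {k : Type u} [NormedField k] [IsUltrametricDist k] [CompleteSpace k]
  {V : Type v} [NormedAddCommGroup V] [NormedSpace k V]
  {c : BMap k (CTensor k V V) (CTensor k V V)} {r : {r : ℝ // 0 < r}}

/-- The conditions under which all structure maps of `T_r(V)` descend to the quotient by `I`. -/
structure StructureDescends (hc : c.NormLE 1) (I : Submodule k (TAlg k V r)) : Prop where
  mul : ∀ a b, a ∈ I ∨ b ∈ I → TAlg.mul (CTensor.tmul a b) ∈ I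
  comul : ∀ x ∈ I, CTensor.map (BMap.quot I) (BMap.quot I) (TAlg.comul hc x) = 0
  counit : ∀ x ∈ I, TAlg.counit x = 0
  braid : ∀ a b, a ∈ I ∨ b ∈ I →
    CTensor.map (BMap.quot I) (BMap.quot I) (TAlg.braid hc (CTensor.tmul a b)) = 0
  degProj : ∀ n, ∀ x ∈ I, TAlg.degProj n x ∈ I

variable {hc : c.NormLE 1} {I : Submodule k (TAlg k V r)} [IsClosed (I : Set (TAlg k V r))]

/-- The structure maps induced on the quotient by `I`. -/
def StructureDescends.data (h : StructureDescends hc I) : BraidedData k (TAlg k V r ⧸ I) where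
  mul := CTensor.descend ((BMap.quot I).comp TAlg.mul) fun a b hab =>
    BMap.quot_eq_zero.2 (h.mul a b hab)
  one := BMap.quot I TAlg.one
  comul := BMap.descend ((CTensor.map (BMap.quot I) (BMap.quot I)).comp (TAlg.comul hc)) h.comul
  counit := BMap.descend TAlg.counit h.counit
  braid := CTensor.descend ((CTensor.map (BMap.quot I) (BMap.quot I)).comp (TAlg.braid hc)) h.braid
  degProj n := BMap.descend ((BMap.quot I).comp (TAlg.degProj n)) fun x hx =>
    BMap.quot_eq_zero.2 (h.degProj n x hx)

theorem StructureDescends.isHom (h : StructureDescends hc I) :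
    (tensorData r hc).IsHom h.data (BMap.quot I) where
  mul := (CTensor.descend_comp _ fun a b hab => BMap.quot_eq_zero.2 (h.mul a b hab)).symm
  one := rfl
  comul := rfl
  counit := rfl
  braid := (CTensor.descend_comp _ h.braid).symm
  degProj _ := rfl

theorem StructureDescends.naturalIso (h : StructureDescends hc I) : NaturalIso hc I I :=
  ⟨inferInstance, inferInstance, h.data, h.data, h.isHom, h.isHom,
    LinearIsometryEquiv.refl k _, fun _ => rfl, h.data.isHom_refl⟩

end quotient

/-! ### The Nichols ideal is the radical -/

namespace TAlg

section

variable {k : Type u} [NormedField k] [IsUltrametricDist k] [CompleteSpace k]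
  {V : Type v} [NormedAddCommGroup V] [NormedSpace k V]
  {c : BMap k (CTensor k V V) (CTensor k V V)} {hc : c.NormLE 1} {B : BMap k (CTensor k V V) k}
  {r s : {r : ℝ // 0 < r}} {P : BMap k (CTensor k (TAlg k V r) (TAlg k V s)) k}

/-- Degree one is the completed tensor product of k and V. Completeness of V makes the scalar
multiplication map to V available, and this map inverts the inclusion. -/
theorem exists_inclV_eq [IsUltrametricDist V] [CompleteSpace V] {x : TAlg k V r}
    (hx : x ∈ Deg k V r 1) : ∃ v, inclV v = x := by
  obtain ⟨a, rfl⟩ := hx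
  let L : BMap k (tpow k V 1) V :=
    (CTensor.contract V (tpowZero k)).comp (CTensor.swap.comp (tpowSucc k 0))
  refine ⟨L a, (tpow_hom_ext (f := inc r 1) (g := inclV.comp L) (fun b v => ?_) a).symm⟩
  have hL : L (snoc b v) = tpowZero k b • v := by simp [L, snoc, CTensor.contract]
  rw [BMap.comp_apply, hL, map_smul, inc_snoc, inc_zero, smul_m, one_m]

theorem counit_eq_zero {x : TAlg k V r} (hx : degProj 0 x = 0) : counit x = 0 := by
  have : counit (degProj 0 x) = counit x :=
    congrArg (tpowZero k) (C0Sum.coord_incl_same (k := k) (E := fun n => tpow k V n) (r := r) 0 _)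
  rw [← this, hx, map_zero]

theorem degProj_zero_eq (x : TAlg k V r) : degProj 0 x = counit x • one :=
  inc_zero _

theorem radical_mul (h : IsPairingExtending hc B P) (a b : TAlg k V r)
    (hab : a ∈ radical P ∨ b ∈ radical P) : mul (CTensor.tmul a b) ∈ radical P := fun y => by
  rw [h.mul_left, pairSq_eq_zero_of_mem hab]

/-- The pairing of Δx with y ⊗ y' is ⟨x, yy'⟩ = 0, so the separation argument in the tensor square
of the quotient applies. -/
theorem map_quot_comul (h : IsPairingExtending hc B P) {x : TAlg k V r} (hx : x ∈ radical P) :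
    CTensor.map (BMap.quot (radical P)) (BMap.quot (radical P)) (comul hc x) = 0 :=
  map_quot_radical_eq_zero fun y y' => by rw [← h.mul_right, hx]

theorem radical_counit (h : IsPairingExtending hc B P) {x : TAlg k V r} (hx : x ∈ radical P) :
    counit x = 0 := by rw [← h.one_right, hx]

theorem radical_structureDescends (h : IsPairingExtending hc B P)
    (hdeg : ∀ n x y, P (CTensor.tmul (degProj n x) y) = P (CTensor.tmul x (degProj n y)))
    (hbr : ∀ z w, pairSq P (CTensor.tmul (braid hc z) w) =
      pairSq P (CTensor.tmul z (braid hc w))) : StructureDescends hc (radical P) where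
  mul := radical_mul h
  comul _ := map_quot_comul h
  counit _ := radical_counit h
  braid a b hab := map_quot_radical_eq_zero fun y y' => by
    rw [hbr, pairSq_eq_zero_of_mem hab]
  degProj n x hx y := by rw [hdeg, hx]

theorem radical_isNicholsIdeal [IsUltrametricDist V] [CompleteSpace V]
    (h : IsPairingExtending hc B P) (hB : ∀ v, (∀ w, B (CTensor.tmul v w) = 0) → v = 0)
    (hdeg : ∀ n x y, P (CTensor.tmul (degProj n x) y) = P (CTensor.tmul x (degProj n y))) :
    IsNicholsIdeal hc (radical P) where
  mul_left x y hy := radical_mul h x y (Or.inr hy)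
  mul_right x hx y := radical_mul h x y (Or.inl hx)
  homogeneous x hx n y := by rw [hdeg, hx]
  degree x hx n hn := by
    obtain rfl | rfl : n = 0 ∨ n = 1 := by omega
    · rw [degProj_zero_eq, radical_counit h hx, zero_smul]
    · obtain ⟨v, hv⟩ := exists_inclV_eq (degProj_mem 1 x)
      -- The component of degree one is some v in V. It pairs with w as x does with the degree-one
      -- part of w, hence to zero, and non-degeneracy of the form gives v = 0.
      have : v = 0 := hB v fun w => by rw [← h.extend, hv, hdeg, hx]
      rw [← hv, this, map_zero]
  coideal x hx := CTensor.mem_closure_of_map_quot (map_quot_comul h hx)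

/-- Induction on the degree of the second argument through ⟨x, yw⟩ = ⟨Δx, y ⊗ w⟩. Of a tensor with
one factor in I, the case of the first factor is the induction hypothesis for y; the second factor
pairs to zero with w because I has no part in degree one. -/
theorem le_radical {I : Submodule k (TAlg k V r)} (hI : IsNicholsIdeal hc I)
    (h : IsPairingExtending hc B P)
    (hdeg : ∀ n x y, P (CTensor.tmul (degProj n x) y) = P (CTensor.tmul x (degProj n y))) :
    I ≤ radical P := by
  have hV : ∀ x ∈ I, ∀ v, P (CTensor.tmul x (inclV v)) = 0 := fun x hx v => by
    have h1 := hdeg 1 x (inclV v)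
    rwa [hI.degree x hx 1 (by omega), map_zero, LinearMap.zero_apply, map_zero,
      degProj_of_mem (inclV_mem_deg v), if_pos rfl, eq_comm] at h1
  have key : ∀ n (b : tpow k V n), ∀ x ∈ I, P (CTensor.tmul x (inc s n b)) = 0 := by
    intro n
    induction n with
    | zero =>
      intro b x hx
      rw [inc_zero, map_smul, map_smul, h.one_right,
        counit_eq_zero (hI.degree x hx 0 (by omega)), smul_zero]
    | succ n ih =>
      intro b x hx
      refine tpow_hom_ext (f := (P.comp (CTensor.tmulL _ x)).comp (inc s (n + 1))) (g := 0)
        (fun b w => ?_) b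
      rw [BMap.comp_apply, inc_snoc, ← mul_tmul]
      refine (h.mul_right _ _ _).trans ?_
      -- Δx lies only in the closure of the span of such tensors, but the functional is continuous,
      -- so checking them is enough.
      refine CTensor.idealSpan_closure_le
        (f := (pairSq P).comp (CTensor.tmulR _ (CTensor.tmul (inc s n b) (inclV w))))
        (fun a a' ha => (pairSq_tmul P _ _ _ _).trans ?_) (hI.coideal x hx)
      rcases ha with ha | ha
      · rw [ih b a ha, zero_mul]
      · rw [hV a' ha, mul_zero]
  exact fun x hx y => hom_ext_inc (f := P.comp (CTensor.tmulL _ x)) (g := 0)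
    (fun n b => key n b x hx) y

/-- The radical is one of the ideals being summed and contains all the others, so the sum is the
radical and in particular closed. -/
theorem nicholsIdeal_eq_radical [IsUltrametricDist V] [CompleteSpace V]
    (h : IsPairingExtending hc B P) (hB : ∀ v, (∀ w, B (CTensor.tmul v w) = 0) → v = 0)
    (hdeg : ∀ n x y, P (CTensor.tmul (degProj n x) y) = P (CTensor.tmul x (degProj n y))) :
    nicholsIdeal r hc = radical P :=
  le_antisymm (sSup_le fun _ hI => le_radical hI h hdeg)
    (le_sSup (radical_isNicholsIdeal h hB hdeg))

end

end TAlg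

end NichNA

end

theorem proposition3p11 {k : Type*} [NormedField k] [IsUltrametricDist k] [CompleteSpace k]
    {V : Type*} [NormedAddCommGroup V] [NormedSpace k V] [IsUltrametricDist V] [CompleteSpace V]
    (c : NichNA.BMap k (NichNA.CTensor k V V) (NichNA.CTensor k V V))
    (hc : c.NormLE 1) (hbraid : NichNA.IsPreBraiding c) :
    -- for every form and every radius: the extended pairing, its radical, the natural isomorphism
    (∀ B : NichNA.BMap k (NichNA.CTensor k V V) k, NichNA.IsNondegSymmForm c B →
      ∀ r s : {r : ℝ // 0 < r}, B.NormLE ((r : ℝ) * (s : ℝ)) →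
        (∃! P : NichNA.BMap k (NichNA.CTensor k (NichNA.TAlg k V r) (NichNA.TAlg k V s)) k,
          NichNA.IsPairingExtending hc B P) ∧
        ∀ P : NichNA.BMap k (NichNA.CTensor k (NichNA.TAlg k V r) (NichNA.TAlg k V s)) k,
          NichNA.IsPairingExtending hc B P →
          NichNA.NaturalIso hc (NichNA.nicholsIdeal r hc) (NichNA.radical P)) ∧
    -- the radical depends neither on the form nor on the second radius
    (∀ B B' : NichNA.BMap k (NichNA.CTensor k V V) k,
      NichNA.IsNondegSymmForm c B → NichNA.IsNondegSymmForm c B' →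
      ∀ r s s' : {r : ℝ // 0 < r},
        B.NormLE ((r : ℝ) * (s : ℝ)) → B'.NormLE ((r : ℝ) * (s' : ℝ)) →
        ∀ (P : NichNA.BMap k (NichNA.CTensor k (NichNA.TAlg k V r) (NichNA.TAlg k V s)) k)
          (P' : NichNA.BMap k (NichNA.CTensor k (NichNA.TAlg k V r) (NichNA.TAlg k V s')) k),
          NichNA.IsPairingExtending hc B P → NichNA.IsPairingExtending hc B' P' →
          NichNA.radical P = NichNA.radical P') := by
  have hunique : ∀ (B : NichNA.BMap k (NichNA.CTensor k V V) k) (hB : NichNA.IsNondegSymmForm c B)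
      (r s : {r : ℝ // 0 < r}) (hrs : B.NormLE ((r : ℝ) * (s : ℝ)))
      (P : NichNA.BMap k (NichNA.CTensor k (NichNA.TAlg k V r) (NichNA.TAlg k V s)) k),
      NichNA.IsPairingExtending hc B P → P = NichNA.TAlg.pairing hrs hc :=
    -- An abstract Hopf pairing is not assumed to respect the grading or the pre-braiding.
    -- Uniqueness identifies it with the constructed one, for which both properties are known.
    fun B hB r s hrs P hP => NichNA.TAlg.pairing_unique hc hP
      (NichNA.TAlg.pairing_isPairingExtending hrs hc hbraid hB.compat hB.symm)
  have hrad : ∀ (B : NichNA.BMap k (NichNA.CTensor k V V) k), NichNA.IsNondegSymmForm c B →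
      ∀ (r s : {r : ℝ // 0 < r}), B.NormLE ((r : ℝ) * (s : ℝ)) →
      ∀ (P : NichNA.BMap k (NichNA.CTensor k (NichNA.TAlg k V r) (NichNA.TAlg k V s)) k),
      NichNA.IsPairingExtending hc B P → NichNA.nicholsIdeal r hc = NichNA.radical P :=
    fun B hB r s hrs P hP => NichNA.TAlg.nicholsIdeal_eq_radical hP hB.nondeg_left <| by
      rw [hunique B hB r s hrs P hP]
      exact NichNA.TAlg.pairing_degProj hrs hc
  refine ⟨fun B hB r s hrs => ⟨⟨_, NichNA.TAlg.pairing_isPairingExtending hrs hc hbraid hB.compat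
    hB.symm, fun P hP => hunique B hB r s hrs P hP⟩, fun P hP => ?_⟩, ?_⟩
  · rw [hrad B hB r s hrs P hP]
    obtain rfl := hunique B hB r s hrs P hP
    exact (NichNA.TAlg.radical_structureDescends hP (NichNA.TAlg.pairing_degProj hrs hc)
      (NichNA.TAlg.pairSq_pairing_braid hrs hc hbraid hB.compat)).naturalIso
  · intro B B' hB hB' r s s' hrs hrs' P P' hP hP'
    -- Both radicals are the Nichols ideal, whose definition involves neither the form nor the
    -- second radius.
    rw [← hrad B hB r s hrs P hP, hrad B' hB' r s' hrs' P' hP']
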